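/- **Setting.** Let $n\ge 4$. A *generalized Kerr–Schild (GKS) family* consists of a smooth $n$-manifold $M$, a smooth Lorentzian metric $\bar g$ on $M$ of signature $(-,+,\dots,+)$ (the background), a nowhere vanishing smooth vector field $k$ that is null for $\bar g$, and smooth functions $H_\mu$ on $M$, where $\mu$ ranges over a space of parameter values in which $0$ is not isolated. Here $\bar g$ and $k$ do not depend on $\mu$, $H_0=0$, and at each point of $M$ the function $H_\mu$ and its first and second partial derivatives tend to $0$ as $\mu\to0$. The full geometry at $\mu$ is $g_\mu=\bar g-2H_\mu\,k\otimes k$, with $k_a=\bar g_{ab}k^b$; so $g_0=\bar g$. A *null frame* of a Lorentzian metric $g$ at a point is a basis $m_{(0)},\dots,m_{(n-1)}$ with $m_{(0)},m_{(1)}$ null, $m_{(0)}\cdot m_{(1)}=1$, and $m_{(2)},\dots,m_{(n-1)}$ orthonormal and orthogonal to both. The frame component $C_{abcd}$ of the Weyl tensor has boost weight equal to the number of indices $0$ minus the number of indices $1$. For $r\in\{1,2,3,4\}$, a non-zero null vector $l$ is a Weyl aligned null direction (*WAND*) of multiplicity at least $r$ if in a null frame with $m_{(0)}=l$ all Weyl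 components of boost weight greater than $2-r$ vanish; its multiplicity is the largest such $r$ (so it is $4$ if the Weyl tensor vanishes), or $0$ if there is none. $l$ is a *single WAND* if the multiplicity is $1$ and an *mWAND* if it is at least $2$. The Weyl type at a point is *$II$ or more special* if there is an mWAND at that point. **Theorem.** Let $k$ be geodesic for $\bar g$ (not necessarily affinely parametrized). At every point of $M$ the following holds. 1. For every $\mu$: $k$ is a single WAND of $\bar g$ if and only if it is a single WAND of $g_\mu$. 2. For every $\mu$: $k$ is an mWAND of $\bar g$ if and only if it is an mWAND of $g_\mu$. 3. Let $l_\mu$, $\mu\neq0$, be WANDs of the full geometries $g_\mu$ that define null directions distinct from $k$, normalized by $l_\mu\cdot k=1$, such that $\bar l=l_\mu-H_\mu k$ does not depend on $\mu$. Then $\bar l$ is a WAND of $\bar g$. 4. If $k$ has multiplicity at least $\tau$ as a WAND of $g_\mu$ for all $\mu\ne0$, then it has multiplicity at least $\tau$ as a WAND of $\bar g$. 5. In the situation of 3, if $l_\mu$ has multiplicity at least $\chi$ for $g_\mu$ for all $\mu\neq0$, then $\bar l$ has multiplicity at least $\chi$ for $\bar g$. The same is true if $l_\mu-H_\mu k$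 depends on $\mu$ and converges to $\bar l$ as $\mu\to0$. 6. (Kerr–Schild case.) If the Weyl tensor of $\bar g$ vanishes at the point, then $k$ is an mWAND of $g_\mu$ for every $\mu$, so that $g_\mu$ is of Weyl type $II$ or more special there. In contrast to 6, GKS spacetimes may be of Weyl type less special than $II$: for every $n\ge4$ there is a GKS family on $\mathbb R^n$ with one real parameter $\mu$ and geodesic $k$ such that for all $\mu\ne0$ the function $H_\mu$ has no zeros and the Weyl type of $g_\mu$ is not $II$ or more special at any point. -/

import Mathlib

open scoped Manifold ContDiff Topology
open Filter

noncomputable section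

namespace GKS

/-! ### Curvature of a metric given by its components in a coordinate patch

`G y i j` are the components at the coordinate point `y` of a symmetric non-degenerate metric. -/

/-- The partial derivative `∂_i f` at `y`. -/
def pderiv {n : ℕ} (i : Fin n) (f : EuclideanSpace ℝ (Fin n) → ℝ)
    (y : EuclideanSpace ℝ (Fin n)) : ℝ :=
  fderiv ℝ f y (EuclideanSpace.single i 1)

/-- Christoffel symbols `Γ^k_{ij} = ½ g^{kl} (∂_i g_{jl} + ∂_j g_{il} - ∂_l g_{ij})`. -/
def christoffel {n : ℕ} (G : EuclideanSpace ℝ (Fin n) → Matrix (Fin n) (Fin n) ℝ)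
    (k i j : Fin n) (y : EuclideanSpace ℝ (Fin n)) : ℝ :=
  (1 / 2) * ∑ l, (G y)⁻¹ k l *
    (pderiv i (fun z => G z j l) y + pderiv j (fun z => G z i l) y - pderiv l (fun z => G z i j) y)

/-- `R^a_{bcd} = ∂_c Γ^a_{db} - ∂_d Γ^a_{cb} + Γ^a_{ce} Γ^e_{db} - Γ^a_{de} Γ^e_{cb}`. -/
def riemannUp {n : ℕ} (G : EuclideanSpace ℝ (Fin n) → Matrix (Fin n) (Fin n) ℝ)
    (a b c d : Fin n) (y : EuclideanSpace ℝ (Fin n)) : ℝ :=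
  pderiv c (christoffel G a d b) y - pderiv d (christoffel G a c b) y +
    ∑ e, (christoffel G a c e y * christoffel G e d b y -
      christoffel G a d e y * christoffel G e c b y)

/-- `R_{abcd} = g_{ae} R^e_{bcd}`. -/
def riemann {n : ℕ} (G : EuclideanSpace ℝ (Fin n) → Matrix (Fin n) (Fin n) ℝ)
    (a b c d : Fin n) (y : EuclideanSpace ℝ (Fin n)) : ℝ :=
  ∑ e, G y a e * riemannUp G e b c d y

/-- `R_{bd} = R^a_{bad}`. -/
def ricci {n : ℕ} (G : EuclideanSpace ℝ (Fin n) → Matrix (Fin n) (Fin n) ℝ)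
    (b d : Fin n) (y : EuclideanSpace ℝ (Fin n)) : ℝ :=
  ∑ a, riemannUp G a b a d y

/-- `R = g^{bd} R_{bd}`. -/
def scalarCurvature {n : ℕ} (G : EuclideanSpace ℝ (Fin n) → Matrix (Fin n) (Fin n) ℝ)
    (y : EuclideanSpace ℝ (Fin n)) : ℝ :=
  ∑ b, ∑ d, (G y)⁻¹ b d * ricci G b d y

/-- The Weyl tensor `C_{abcd}` (for `n ≥ 3`). -/
def weyl {n : ℕ} (G : EuclideanSpace ℝ (Fin n) → Matrix (Fin n) (Fin n) ℝ)
    (a b c d : Fin n) (y : EuclideanSpace ℝ (Fin n)) : ℝ :=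
  riemann G a b c d y
    - (1 / ((n : ℝ) - 2)) *
      (G y a c * ricci G b d y - G y a d * ricci G b c y
        - G y b c * ricci G a d y + G y b d * ricci G a c y)
    + (scalarCurvature G y / (((n : ℝ) - 1) * ((n : ℝ) - 2))) *
      (G y a c * G y b d - G y a d * G y b c)

/-! ### Metrics and vector fields on a manifold -/

section Manifold

variable {n : ℕ} {M : Type*} [TopologicalSpace M] [ChartedSpace (EuclideanSpace ℝ (Fin n)) M]

/-- A field of bilinear forms on the tangent spaces of `M`. -/
abbrev BilinField (n : ℕ) (M : Type*) [TopologicalSpace M]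
    [ChartedSpace (EuclideanSpace ℝ (Fin n)) M] : Type _ :=
  (p : M) → TangentSpace (𝓡 n) p →L[ℝ] TangentSpace (𝓡 n) p →L[ℝ] ℝ

/-- `g_p` is symmetric of signature `(-, +, …, +)`. -/
def IsLorentzAt (g : BilinField n M) (p : M) : Prop :=
  (∀ v w, g p v w = g p w v) ∧
  ∃ b : Module.Basis (Fin n) ℝ (TangentSpace (𝓡 n) p), ∀ i j,
    g p (b i) (b j) = if i = j then (if i.val = 0 then -1 else 1) else 0

variable [IsManifold (𝓡 n) ∞ M]

/-- The `i`-th coordinate vector of the chart at `c`, at the point `p` of its domain. -/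
def coordBasis (c p : M) (i : Fin n) : TangentSpace (𝓡 n) p :=
  tangentCoordChange (𝓡 n) c p p (EuclideanSpace.single i (1 : ℝ))

/-- The components of `g` in the chart at `c`, as functions of the coordinates `y`. -/
def coordMetric (g : BilinField n M) (c : M) (y : EuclideanSpace ℝ (Fin n)) :
    Matrix (Fin n) (Fin n) ℝ :=
  fun i j =>
    g ((extChartAt (𝓡 n) c).symm y)
      (coordBasis c ((extChartAt (𝓡 n) c).symm y) i)
      (coordBasis c ((extChartAt (𝓡 n) c).symm y) j)

/-- The components of the vector field `X` in the chart at `c`. -/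
def coordVector (X : (p : M) → TangentSpace (𝓡 n) p) (c : M)
    (y : EuclideanSpace ℝ (Fin n)) : EuclideanSpace ℝ (Fin n) :=
  tangentCoordChange (𝓡 n) ((extChartAt (𝓡 n) c).symm y) c ((extChartAt (𝓡 n) c).symm y)
    (X ((extChartAt (𝓡 n) c).symm y))

/-- All components of `g` are smooth in every chart `chartAt c`. -/
def SmoothMetric (g : BilinField n M) : Prop :=
  ∀ (c : M) (i j : Fin n),
    ContDiffOn ℝ ∞ (fun y => coordMetric g c y i j) (extChartAt (𝓡 n) c).target

/-- All components of `X` are smooth in every chart `chartAt c`. -/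
def SmoothVectorField (X : (p : M) → TangentSpace (𝓡 n) p) : Prop :=
  ∀ c : M, ContDiffOn ℝ ∞ (coordVector X c) (extChartAt (𝓡 n) c).target

/-- `X` is geodesic for `g`, not necessarily affinely parametrized: `∇_X X = f X`. -/
def IsGeodesic (g : BilinField n M) (X : (p : M) → TangentSpace (𝓡 n) p) : Prop :=
  ∀ (c : M), ∀ y ∈ (extChartAt (𝓡 n) c).target, ∃ f : ℝ, ∀ a : Fin n,
    (∑ b, coordVector X c y b * pderiv b (fun z => coordVector X c z a) y) +
      (∑ b, ∑ d, christoffel (coordMetric g c) a b d y *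
        coordVector X c y b * coordVector X c y d) =
    f * coordVector X c y a

/-- The coordinates of `v` in the chart at `p`, by which the tangent space at `p` is identified
with `ℝⁿ`. -/
def coords {p : M} (v : TangentSpace (𝓡 n) p) : EuclideanSpace ℝ (Fin n) := v

/-- The Weyl tensor of `g` at `p`, as a function of four tangent vectors. -/
def weylAt (g : BilinField n M) (p : M) (v w x z : TangentSpace (𝓡 n) p) : ℝ :=
  ∑ a, ∑ b, ∑ c, ∑ d,
    weyl (coordMetric g p) a b c d (extChartAt (𝓡 n) p p) *
      coords v a * coords w b * coords x c * coords z d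

/-- The Weyl tensor of `g` vanishes at `p` (Weyl type `O`). -/
def WeylVanishesAt (g : BilinField n M) (p : M) : Prop :=
  ∀ v w x z : TangentSpace (𝓡 n) p, weylAt g p v w x z = 0

/-! ### Null frames, boost weights and Weyl aligned null directions -/

/-- `m 0, m 1` are null with `m 0 · m 1 = 1`, and `m 2, …, m (n-1)` are orthonormal and orthogonal
to both. -/
def IsNullFrame (g : BilinField n M) (p : M) (m : Fin n → TangentSpace (𝓡 n) p) : Prop :=
  ∀ a b : Fin n, g p (m a) (m b) =
    if (a.val = 0 ∧ b.val = 1) ∨ (a.val = 1 ∧ b.val = 0) ∨ (a = b ∧ 2 ≤ a.val) then 1 else 0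

/-- The boost weight of a covariant frame index: `+1` for `0`, `-1` for `1`, `0` otherwise. -/
def boostWeight {n : ℕ} (a : Fin n) : ℤ :=
  if a.val = 0 then 1 else if a.val = 1 then -1 else 0

/-- In some null frame with `m 0 = l`, all components of the Weyl tensor of boost weight larger
than `2 - r` vanish. (Boost weights of Weyl components are at most `2`; the condition depends only
on the null direction of `l`.) -/
def AlignedToOrder (g : BilinField n M) (p : M) (l : TangentSpace (𝓡 n) p) (r : ℕ) : Prop :=
  ∃ m : Fin n → TangentSpace (𝓡 n) p, IsNullFrame g p m ∧
    (∀ a : Fin n, a.val = 0 → m a = l) ∧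
    ∀ a b c d : Fin n,
      2 - (r : ℤ) < boostWeight a + boostWeight b + boostWeight c + boostWeight d →
      weylAt g p (m a) (m b) (m c) (m d) = 0

open Classical in
/-- The multiplicity, in `{0, 1, 2, 3, 4}`, of `l` as a WAND of `g` at `p`. It is `0` if `l` is not
a WAND (in particular, if `l` is not a non-zero null vector), and `4` for all null directions if the
Weyl tensor vanishes at `p`. -/
def wandMultiplicity (g : BilinField n M) (p : M) (l : TangentSpace (𝓡 n) p) : ℕ :=
  Nat.findGreatest (AlignedToOrder g p l) 4

/-- `l` is a WAND of `g` at `p`. -/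
def IsWAND (g : BilinField n M) (p : M) (l : TangentSpace (𝓡 n) p) : Prop :=
  1 ≤ wandMultiplicity g p l

/-- `l` is a single WAND of `g` at `p`. -/
def IsSingleWAND (g : BilinField n M) (p : M) (l : TangentSpace (𝓡 n) p) : Prop :=
  wandMultiplicity g p l = 1

/-- `l` is a multiple WAND of `g` at `p`. -/
def IsMWAND (g : BilinField n M) (p : M) (l : TangentSpace (𝓡 n) p) : Prop :=
  2 ≤ wandMultiplicity g p l

/-- The Weyl type at `p` is `II` or more special: there is a multiple WAND at `p`. -/
def WeylTypeIIOrMoreSpecial (g : BilinField n M) (p : M) : Prop :=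
  ∃ l : TangentSpace (𝓡 n) p, IsMWAND g p l

end Manifold

/-! ### Generalized Kerr-Schild spacetimes -/

/-- A generalized Kerr-Schild family on the `n`-dimensional manifold `M`: a Lorentzian background
metric `gbar`, a null vector field `k` (the associated 1-form is `gbar k`) and scalar functions
`H μ`, where `μ` ranges over a space `P` of parameter values (for constant parameters `P` is `ℝ^J`
or a part of it, for local parameters a space of functions). The background and `k` do not depend on
the parameters, `H` vanishes at `μ = 0`, the parameter value `0` is not isolated, and `H μ` and its
first and second partial derivatives depend continuously on `μ` at `μ = 0`, pointwise on `M`. -/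
structure GKSFamily (n : ℕ) (M : Type*) [TopologicalSpace M]
    [ChartedSpace (EuclideanSpace ℝ (Fin n)) M] [IsManifold (𝓡 n) ∞ M]
    (P : Type*) [TopologicalSpace P] [Zero P] where
  gbar : BilinField n M
  gbar_lorentz : ∀ p, IsLorentzAt gbar p
  gbar_smooth : SmoothMetric gbar
  k : (p : M) → TangentSpace (𝓡 n) p
  k_smooth : SmoothVectorField k
  k_ne_zero : ∀ p, k p ≠ 0
  k_null : ∀ p, gbar p (k p) (k p) = 0
  H : P → M → ℝ
  H_smooth : ∀ μ, ContMDiff (𝓡 n) 𝓘(ℝ, ℝ) ∞ (H μ)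
  H_zero : ∀ p, H 0 p = 0
  zero_not_isolated : (𝓝[≠] (0 : P)).NeBot
  H_continuous_at_zero : ∀ (p : M) (j : ℕ), j ≤ 2 →
    Tendsto (fun μ => iteratedFDeriv ℝ j (H μ ∘ (extChartAt (𝓡 n) p).symm) (extChartAt (𝓡 n) p p))
      (𝓝 0) (𝓝 0)

/-- The full metric `g = gbar - 2 H k ⊗ k` at the parameter value `μ`. -/
def GKSFamily.metric {n : ℕ} {M : Type*} [TopologicalSpace M]
    [ChartedSpace (EuclideanSpace ℝ (Fin n)) M] [IsManifold (𝓡 n) ∞ M]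
    {P : Type*} [TopologicalSpace P] [Zero P] (S : GKSFamily n M P) (μ : P) : BilinField n M :=
  fun p => S.gbar p - (2 * S.H μ p) • (S.gbar p (S.k p)).smulRight (S.gbar p (S.k p))

end GKS

end

/-! Write `κ = ḡ(k, ·)` and let `D` be the difference tensor of the Levi-Civita connections of `g`
and `ḡ`. Because `k` is null, `g(k, ·) = κ` as well, and the inverse of `g` is exactly `ḡ⁻¹ + 2H k ⊗
k`. With `k^c ∇_b k_c = 0` (nullness) and `k^b ∇_b k_c = f k_c` (the geodesic equation), and with `φ
= k(H) + 2fH`, one finds three identities: `κ(D(Y,Z)) = φ κ(Y) κ(Z)`, `D(k,Z) = -φ κ(Z) k`, and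
`D(Y,Z)` is proportional to `k` when `Y, Z ⊥ k`.

Inserted into the curvature difference, they show that `R(k,Z,X,Y)` is the same for both metrics if
`X, Y ⊥ k` and either `Z ⊥ k` or `X = k`. Taking a trace, `Ric(k,Y)` is the same for `Y ⊥ k`, so the
same holds for the Weyl components `C(k,Z,X,Y)` (`eval₄_weyl_eq`). Up to the symmetries of the Weyl
tensor these are all the components of positive boost weight with respect to `k`, and the flag `span
k ⊂ k^⊥ ⊂ T_pM` on which they depend is common to both metrics (`weylAt_eq_of_boost_pos`). Being a
WAND or an mWAND only concerns positive boost weights, whence the two equivalences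
(`alignedToOrder_k_iff`). If the background Weyl tensor vanishes, `k` is trivially an mWAND of `ḡ`,
hence of `g`.

The statements on multiplicities and on `l̄` are limits. The 2-jet of `g_μ` converges to that of
`ḡ`, so the Weyl tensor converges; every vector of the flag of `l̄` is a limit of vectors in the
flags of `l_μ`, so vanishing Weyl components stay zero in the limit (`alignedToOrder_of_tendsto`).

The counterexample is `2 du dv - 2μ du² + ∑ e^{2 p_i v} dx_i²` with `k = ∂_v`, `H = μ` and exponents
`-2, 1, …, 1`. An mWAND `l` must satisfy `C(l,w,l,z) = 0` for all `w` and all `z ⊥ l`; a few choices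
of `w, z` force `l = 0` (`eq_zero_of_weyl_exampleMetric`). -/

namespace GKS

/-! ### Calculus of partial derivatives on open subsets of `ℝⁿ`. -/

section Calculus

variable {n : ℕ} {U : Set (EuclideanSpace ℝ (Fin n))} {y : EuclideanSpace ℝ (Fin n)}
  {f g : EuclideanSpace ℝ (Fin n) → ℝ}

theorem pderiv_congr {i : Fin n} (h : f =ᶠ[𝓝 y] g) : pderiv i f y = pderiv i g y := by
  simp only [pderiv, h.fderiv_eq]

theorem pderiv_congr_of_isOpen {i : Fin n} (hU : IsOpen U) (hy : y ∈ U) (h : ∀ z ∈ U, f z = g z) :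
    pderiv i f y = pderiv i g y :=
  pderiv_congr (Filter.eventually_of_mem (hU.mem_nhds hy) h)

theorem pderiv_const (i : Fin n) (c : ℝ) : pderiv i (fun _ => c) y = 0 := by
  simp [pderiv]

theorem pderiv_add {i : Fin n} (hf : DifferentiableAt ℝ f y) (hg : DifferentiableAt ℝ g y) :
    pderiv i (fun z => f z + g z) y = pderiv i f y + pderiv i g y := by
  simp [pderiv, fderiv_fun_add hf hg]

theorem pderiv_sub {i : Fin n} (hf : DifferentiableAt ℝ f y) (hg : DifferentiableAt ℝ g y) :
    pderiv i (fun z => f z - g z) y = pderiv i f y - pderiv i g y := by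
  simp [pderiv, fderiv_fun_sub hf hg]

theorem pderiv_mul {i : Fin n} (hf : DifferentiableAt ℝ f y) (hg : DifferentiableAt ℝ g y) :
    pderiv i (fun z => f z * g z) y = pderiv i f y * g y + f y * pderiv i g y := by
  simp [pderiv, fderiv_fun_mul hf hg]; ring

theorem pderiv_const_mul {i : Fin n} (c : ℝ) (hf : DifferentiableAt ℝ f y) :
    pderiv i (fun z => c * f z) y = c * pderiv i f y := by
  simp [pderiv, fderiv_const_mul hf]

theorem pderiv_sum {ι : Type*} {s : Finset ι} {i : Fin n}
    {F : ι → EuclideanSpace ℝ (Fin n) → ℝ} (hF : ∀ j ∈ s, DifferentiableAt ℝ (F j) y) :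
    pderiv i (fun z => ∑ j ∈ s, F j z) y = ∑ j ∈ s, pderiv i (F j) y := by
  simp [pderiv, fderiv_fun_sum hF]

theorem contDiffOn_pderiv (hU : IsOpen U) (hf : ContDiffOn ℝ ∞ f U) (i : Fin n) :
    ContDiffOn ℝ ∞ (pderiv i f) U :=
  (hf.fderiv_of_isOpen hU (m := ∞) (by simp)).clm_apply contDiffOn_const

theorem differentiableAt_of_contDiffOn (hU : IsOpen U) (hf : ContDiffOn ℝ ∞ f U) (hy : y ∈ U) :
    DifferentiableAt ℝ f y :=
  (hf.contDiffAt (hU.mem_nhds hy)).differentiableAt (by simp)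

theorem pderiv_pderiv_eq (hU : IsOpen U) (hf : ContDiffOn ℝ ∞ f U) (hy : y ∈ U) (i j : Fin n) :
    pderiv i (pderiv j f) y =
      fderiv ℝ (fderiv ℝ f) y (EuclideanSpace.single i 1) (EuclideanSpace.single j 1) := by
  have h : DifferentiableAt ℝ (fderiv ℝ f) y :=
    ((hf.fderiv_of_isOpen hU (m := ∞) (by simp)).contDiffAt
      (hU.mem_nhds hy)).differentiableAt (by simp)
  change fderiv ℝ (fun z => fderiv ℝ f z (EuclideanSpace.single j 1)) y
    (EuclideanSpace.single i 1) = _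
  rw [fderiv_clm_apply h (differentiableAt_const _)]
  simp

theorem pderiv_comm (hU : IsOpen U) (hf : ContDiffOn ℝ ∞ f U) (hy : y ∈ U) (i j : Fin n) :
    pderiv i (pderiv j f) y = pderiv j (pderiv i f) y := by
  rw [pderiv_pderiv_eq hU hf hy, pderiv_pderiv_eq hU hf hy]
  exact ((hf.contDiffAt (hU.mem_nhds hy)).isSymmSndFDerivAt
    (by simpa using (WithTop.coe_le_coe.2 (le_top : (2 : ℕ∞) ≤ ⊤)))) _ _

end Calculus

/-! ### Curvature of a metric in a coordinate patch and its index symmetries. -/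

section LocalMetric

variable {n : ℕ} {U : Set (EuclideanSpace ℝ (Fin n))} {y : EuclideanSpace ℝ (Fin n)}
  {G : EuclideanSpace ℝ (Fin n) → Matrix (Fin n) (Fin n) ℝ}

/-- The components `G` of a smooth pseudo-Riemannian metric on the open set `U`. -/
structure IsLocalMetric (U : Set (EuclideanSpace ℝ (Fin n)))
    (G : EuclideanSpace ℝ (Fin n) → Matrix (Fin n) (Fin n) ℝ) : Prop where
  isOpen : IsOpen U
  smooth : ∀ i j, ContDiffOn ℝ ∞ (fun z => G z i j) U
  symm : ∀ z ∈ U, ∀ i j, G z i j = G z j i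
  det_ne : ∀ z ∈ U, IsUnit (G z).det

/-- Christoffel symbols of the first kind, `Γ_{l,ij}`. -/
noncomputable def christoffelLower (G : EuclideanSpace ℝ (Fin n) → Matrix (Fin n) (Fin n) ℝ)
    (l i j : Fin n) (y : EuclideanSpace ℝ (Fin n)) : ℝ :=
  (1 / 2) * (pderiv i (fun z => G z j l) y + pderiv j (fun z => G z i l) y
    - pderiv l (fun z => G z i j) y)

theorem christoffel_eq_sum (k i j : Fin n) :
    christoffel G k i j y = ∑ l, (G y)⁻¹ k l * christoffelLower G l i j y := by
  simp only [christoffel, christoffelLower, Finset.mul_sum]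
  exact Finset.sum_congr rfl fun l _ => by ring

theorem contDiffOn_matrix_det (hG : ∀ i j, ContDiffOn ℝ ∞ (fun z => G z i j) U) :
    ContDiffOn ℝ ∞ (fun z => (G z).det) U := by
  simp only [Matrix.det_apply]
  refine ContDiffOn.sum fun σ _ => ?_
  refine ContDiffOn.const_smul _ ?_
  exact contDiffOn_prod fun i _ => hG _ _

namespace IsLocalMetric

theorem differentiableAt (h : IsLocalMetric U G) (hy : y ∈ U) (i j : Fin n) :
    DifferentiableAt ℝ (fun z => G z i j) y :=
  differentiableAt_of_contDiffOn h.isOpen (h.smooth i j) hy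

/-- Cramer's rule: each entry is a determinant with one row replaced by a constant, divided by the
nowhere vanishing `det G`. -/
theorem contDiffOn_inv (h : IsLocalMetric U G) (i j : Fin n) :
    ContDiffOn ℝ ∞ (fun z => (G z)⁻¹ i j) U := by
  simp only [Matrix.inv_def, Matrix.smul_apply, Ring.inverse_eq_inv', smul_eq_mul,
    Matrix.adjugate_apply]
  refine ContDiffOn.mul (ContDiffOn.inv (contDiffOn_matrix_det h.smooth)
    fun z hz => (h.det_ne z hz).ne_zero) ?_
  refine contDiffOn_matrix_det fun a b => ?_
  by_cases ha : a = j
  · subst ha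
    simpa using contDiffOn_const
  · simpa [Matrix.updateRow_ne ha] using h.smooth a b

theorem inv_symm (h : IsLocalMetric U G) (hy : y ∈ U) (i j : Fin n) :
    (G y)⁻¹ i j = (G y)⁻¹ j i := by
  have hs : (G y).transpose = G y := Matrix.ext fun i j => h.symm y hy j i
  have := Matrix.transpose_nonsing_inv (G y)
  rw [hs] at this
  exact congrFun (congrFun this.symm i) j

theorem sum_mul_inv (h : IsLocalMetric U G) (hy : y ∈ U) (i j : Fin n) :
    ∑ a, G y i a * (G y)⁻¹ a j = if i = j then 1 else 0 := by
  rw [← Matrix.mul_apply, Matrix.mul_nonsing_inv _ (h.det_ne y hy), Matrix.one_apply]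

theorem sum_mul_sum_inv (h : IsLocalMetric U G) (hy : y ∈ U) (i : Fin n) (w : Fin n → ℝ) :
    ∑ a, G y i a * ∑ b, (G y)⁻¹ a b * w b = w i := by
  have := congrFun (Matrix.mulVec_mulVec w (G y) (G y)⁻¹) i
  rw [Matrix.mul_nonsing_inv _ (h.det_ne y hy), Matrix.one_mulVec] at this
  exact this

theorem sum_inv_sum_mul (h : IsLocalMetric U G) (hy : y ∈ U) (i : Fin n) (w : Fin n → ℝ) :
    ∑ a, (G y)⁻¹ i a * ∑ b, G y a b * w b = w i := by
  have := congrFun (Matrix.mulVec_mulVec w (G y)⁻¹ (G y)) i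
  rw [Matrix.nonsing_inv_mul _ (h.det_ne y hy), Matrix.one_mulVec] at this
  exact this

theorem contDiffOn_christoffelLower (h : IsLocalMetric U G) (l i j : Fin n) :
    ContDiffOn ℝ ∞ (christoffelLower G l i j) U :=
  contDiffOn_const.mul (((contDiffOn_pderiv h.isOpen (h.smooth _ _) _).add
    (contDiffOn_pderiv h.isOpen (h.smooth _ _) _)).sub
      (contDiffOn_pderiv h.isOpen (h.smooth _ _) _))

theorem contDiffOn_christoffel (h : IsLocalMetric U G) (k i j : Fin n) :
    ContDiffOn ℝ ∞ (christoffel G k i j) U := by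
  have : christoffel G k i j = fun y => ∑ l, (G y)⁻¹ k l * christoffelLower G l i j y :=
    funext fun y => christoffel_eq_sum k i j
  rw [this]
  exact ContDiffOn.sum fun l _ => (h.contDiffOn_inv k l).mul (h.contDiffOn_christoffelLower l i j)

theorem sum_mul_christoffel (h : IsLocalMetric U G) (hy : y ∈ U) (a i j : Fin n) :
    ∑ e, G y a e * christoffel G e i j y = christoffelLower G a i j y := by
  simp only [christoffel_eq_sum]
  exact h.sum_mul_sum_inv hy a fun l => christoffelLower G l i j y

theorem pderiv_symm (h : IsLocalMetric U G) (hy : y ∈ U) (c i j : Fin n) :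
    pderiv c (fun z => G z i j) y = pderiv c (fun z => G z j i) y :=
  pderiv_congr_of_isOpen h.isOpen hy fun z hz => h.symm z hz i j

theorem christoffelLower_comm (h : IsLocalMetric U G) (hy : y ∈ U) (l i j : Fin n) :
    christoffelLower G l i j y = christoffelLower G l j i y := by
  simp only [christoffelLower, h.pderiv_symm hy l i j]; ring

theorem christoffel_comm (h : IsLocalMetric U G) (hy : y ∈ U) (l i j : Fin n) :
    christoffel G l i j y = christoffel G l j i y := by
  simp only [christoffel_eq_sum, h.christoffelLower_comm hy _ i j]

/-- Metric compatibility `∇g = 0`, written in coordinates. -/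
theorem pderiv_eq_christoffelLower (h : IsLocalMetric U G) (hy : y ∈ U) (c a e : Fin n) :
    pderiv c (fun z => G z a e) y = christoffelLower G a c e y + christoffelLower G e c a y := by
  simp only [christoffelLower, h.pderiv_symm hy c a e, h.pderiv_symm hy e c a]
  ring

theorem pderiv_christoffelLower (h : IsLocalMetric U G) (hy : y ∈ U) (c a i j : Fin n) :
    pderiv c (christoffelLower G a i j) y =
      (1 / 2) * (pderiv c (pderiv i fun z => G z j a) y + pderiv c (pderiv j fun z => G z i a) y
        - pderiv c (pderiv a fun z => G z i j) y) := by
  have hd : ∀ b p q, DifferentiableAt ℝ (pderiv b fun z => G z p q) y := fun b p q =>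
    differentiableAt_of_contDiffOn h.isOpen (contDiffOn_pderiv h.isOpen (h.smooth p q) b) hy
  have h1 := pderiv_const_mul (i := c) (1 / 2)
    (((hd i j a).fun_add (hd j i a)).fun_sub (hd a i j))
  refine h1.trans ?_
  rw [pderiv_sub ((hd i j a).fun_add (hd j i a)) (hd a i j), pderiv_add (hd i j a) (hd j i a)]

/-- The product `g^{ef} Γ_{e,ij} Γ_{f,kl}`. -/
theorem sum_christoffelLower_mul_christoffel (h : IsLocalMetric U G) (hy : y ∈ U)
    (i j k l : Fin n) :
    ∑ e, christoffelLower G e i j y * christoffel G e k l y =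
      ∑ e, christoffelLower G e k l y * christoffel G e i j y := by
  simp only [christoffel_eq_sum, Finset.mul_sum]
  rw [Finset.sum_comm]
  refine Finset.sum_congr rfl fun a _ => Finset.sum_congr rfl fun b _ => ?_
  rw [h.inv_symm hy b a]; ring

/-- The Riemann tensor with all indices down in terms of the second derivatives of the metric and
of the Christoffel symbols. -/
theorem riemann_eq (h : IsLocalMetric U G) (hy : y ∈ U) (a b c d : Fin n) :
    riemann G a b c d y =
      (1 / 2) * (pderiv c (pderiv b fun z => G z a d) y + pderiv d (pderiv a fun z => G z b c) y
        - pderiv c (pderiv a fun z => G z b d) y - pderiv d (pderiv b fun z => G z a c) y)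
      + ∑ e, christoffelLower G e a d y * christoffel G e b c y
      - ∑ e, christoffelLower G e a c y * christoffel G e b d y := by
  -- The metric is pulled through the derivative of `Γ^e_{db}` by the product rule. The `Γ_{a,ce}`
  -- half of `∂_c g_{ae}` will cancel against `h2`; the other half leaves the quadratic terms of the
  -- claim. The resulting formula contains no derivative of the inverse metric.
  have key : ∀ c d : Fin n, ∑ e, G y a e * pderiv c (christoffel G e d b) y =
      pderiv c (christoffelLower G a d b) y
        - ∑ e, (christoffelLower G a c e y + christoffelLower G e c a y)
          * christoffel G e d b y := by
    intro c d
    have hd : ∀ e, DifferentiableAt ℝ (christoffel G e d b) y := fun e =>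
      differentiableAt_of_contDiffOn h.isOpen (h.contDiffOn_christoffel e d b) hy
    have h1 : pderiv c (christoffelLower G a d b) y =
        pderiv c (fun z => ∑ e, G z a e * christoffel G e d b z) y :=
      pderiv_congr_of_isOpen h.isOpen hy fun z hz => (h.sum_mul_christoffel hz a d b).symm
    rw [h1, pderiv_sum fun e _ => (h.differentiableAt hy a e).fun_mul (hd e)]
    simp only [pderiv_mul (h.differentiableAt hy a _) (hd _), Finset.sum_add_distrib,
      h.pderiv_eq_christoffelLower hy c a]
    ring
  have h2 : ∀ c d : Fin n, ∑ e, G y a e * ∑ f, christoffel G e c f y * christoffel G f d b y =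
      ∑ f, christoffelLower G a c f y * christoffel G f d b y := by
    intro c d
    simp only [Finset.mul_sum]
    rw [Finset.sum_comm]
    refine Finset.sum_congr rfl fun f _ => ?_
    rw [← h.sum_mul_christoffel hy a c f, Finset.sum_mul]
    exact Finset.sum_congr rfl fun e _ => by ring
  have h3 : riemann G a b c d y =
      ∑ e, G y a e * pderiv c (christoffel G e d b) y
      - ∑ e, G y a e * pderiv d (christoffel G e c b) y
      + (∑ e, G y a e * ∑ f, christoffel G e c f y * christoffel G f d b y
      - ∑ e, G y a e * ∑ f, christoffel G e d f y * christoffel G f c b y) := by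
    simp only [riemann, riemannUp, ← Finset.sum_sub_distrib, ← Finset.sum_add_distrib]
    refine Finset.sum_congr rfl fun e _ => ?_
    rw [Finset.sum_sub_distrib]
    ring
  rw [h3, key, key, h2, h2, h.pderiv_christoffelLower hy, h.pderiv_christoffelLower hy,
    pderiv_comm h.isOpen (h.smooth b a) hy c d]
  simp only [add_mul, Finset.sum_add_distrib, h.christoffel_comm hy _ d b,
    h.christoffel_comm hy _ c b, h.christoffelLower_comm hy _ c a,
    h.christoffelLower_comm hy _ d a]
  have e2 : pderiv c (pderiv b fun z => G z d a) y = pderiv c (pderiv b fun z => G z a d) y :=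
    pderiv_congr_of_isOpen h.isOpen hy fun z hz => h.pderiv_symm hz b d a
  have e3 : pderiv c (pderiv a fun z => G z d b) y = pderiv c (pderiv a fun z => G z b d) y :=
    pderiv_congr_of_isOpen h.isOpen hy fun z hz => h.pderiv_symm hz a d b
  have e4 : pderiv d (pderiv b fun z => G z c a) y = pderiv d (pderiv b fun z => G z a c) y :=
    pderiv_congr_of_isOpen h.isOpen hy fun z hz => h.pderiv_symm hz b c a
  have e5 : pderiv d (pderiv a fun z => G z c b) y = pderiv d (pderiv a fun z => G z b c) y :=
    pderiv_congr_of_isOpen h.isOpen hy fun z hz => h.pderiv_symm hz a c b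
  rw [e2, e3, e4, e5]
  ring

theorem pderiv_pderiv_symm (h : IsLocalMetric U G) (hy : y ∈ U) (c d i j : Fin n) :
    pderiv c (pderiv d fun z => G z i j) y = pderiv c (pderiv d fun z => G z j i) y :=
  pderiv_congr_of_isOpen h.isOpen hy fun _ hz => h.pderiv_symm hz d i j

theorem riemann_antisymm_left (h : IsLocalMetric U G) (hy : y ∈ U) (a b c d : Fin n) :
    riemann G a b c d y = - riemann G b a c d y := by
  rw [h.riemann_eq hy, h.riemann_eq hy, h.sum_christoffelLower_mul_christoffel hy a d b c,
    h.sum_christoffelLower_mul_christoffel hy a c b d]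
  ring

theorem riemann_antisymm_right (a b c d : Fin n) :
    riemann G a b c d y = - riemann G a b d c y := by
  simp only [riemann, riemannUp, ← Finset.sum_neg_distrib]
  refine Finset.sum_congr rfl fun e _ => ?_
  simp only [Finset.sum_sub_distrib]
  ring

theorem riemann_pair_symm (h : IsLocalMetric U G) (hy : y ∈ U) (a b c d : Fin n) :
    riemann G a b c d y = riemann G c d a b y := by
  rw [h.riemann_eq hy, h.riemann_eq hy, h.sum_christoffelLower_mul_christoffel hy c b d a,
    h.pderiv_pderiv_symm hy c b a d, h.pderiv_pderiv_symm hy d a b c,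
    h.pderiv_pderiv_symm hy c a b d, h.pderiv_pderiv_symm hy d b a c,
    pderiv_comm h.isOpen (h.smooth d a) hy c b, pderiv_comm h.isOpen (h.smooth c b) hy d a,
    pderiv_comm h.isOpen (h.smooth d b) hy c a, pderiv_comm h.isOpen (h.smooth c a) hy d b]
  simp only [h.christoffelLower_comm hy _ d a, h.christoffel_comm hy _ c b,
    h.christoffelLower_comm hy _ c a, h.christoffel_comm hy _ d b]
  ring

theorem ricci_eq (h : IsLocalMetric U G) (hy : y ∈ U) (b d : Fin n) :
    ricci G b d y = ∑ a, ∑ c, (G y)⁻¹ a c * riemann G c b a d y := by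
  simp only [ricci, riemann]
  exact Finset.sum_congr rfl fun a _ =>
    (h.sum_inv_sum_mul hy a fun e => riemannUp G e b a d y).symm

theorem ricci_symm (h : IsLocalMetric U G) (hy : y ∈ U) (b d : Fin n) :
    ricci G b d y = ricci G d b y := by
  rw [h.ricci_eq hy, h.ricci_eq hy, Finset.sum_comm]
  refine Finset.sum_congr rfl fun a _ => Finset.sum_congr rfl fun c _ => ?_
  rw [h.inv_symm hy c a, h.riemann_pair_symm hy a b c d]

/-- The Weyl symmetries are used to move a factor `k` into the first slot when components of
positive boost weight are compared. -/
theorem weyl_antisymm_left (h : IsLocalMetric U G) (hy : y ∈ U) (a b c d : Fin n) :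
    weyl G a b c d y = - weyl G b a c d y := by
  simp only [weyl, h.riemann_antisymm_left hy a b c d]; ring

theorem weyl_antisymm_right (a b c d : Fin n) : weyl G a b c d y = - weyl G a b d c y := by
  simp only [weyl, riemann_antisymm_right a b c d]; ring

theorem weyl_pair_symm (h : IsLocalMetric U G) (hy : y ∈ U) (a b c d : Fin n) :
    weyl G a b c d y = weyl G c d a b y := by
  simp only [weyl, h.riemann_pair_symm hy a b c d, h.symm y hy c a, h.symm y hy d b,
    h.symm y hy c b, h.symm y hy d a, h.ricci_symm hy d b, h.ricci_symm hy d a,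
    h.ricci_symm hy c b, h.ricci_symm hy c a]
  ring

end IsLocalMetric

end LocalMetric

/-! ### Inverse metric and connection of a generalized Kerr-Schild metric. -/

section KerrSchild

variable {n : ℕ} {U : Set (EuclideanSpace ℝ (Fin n))} {y : EuclideanSpace ℝ (Fin n)}
  {Gb G : EuclideanSpace ℝ (Fin n) → Matrix (Fin n) (Fin n) ℝ}
  {k : EuclideanSpace ℝ (Fin n) → EuclideanSpace ℝ (Fin n)}
  {H : EuclideanSpace ℝ (Fin n) → ℝ} {f : EuclideanSpace ℝ (Fin n) → ℝ}

/-- The components `k_i` of the 1-form associated to the vector field `k`. -/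
noncomputable def lowerIndex (G : EuclideanSpace ℝ (Fin n) → Matrix (Fin n) (Fin n) ℝ)
    (k : EuclideanSpace ℝ (Fin n) → EuclideanSpace ℝ (Fin n)) (i : Fin n)
    (y : EuclideanSpace ℝ (Fin n)) : ℝ :=
  ∑ j, G y i j * k y j

/-- The covariant derivative `∇_b k_c` of the 1-form associated to `k`. -/
noncomputable def covDeriv (G : EuclideanSpace ℝ (Fin n) → Matrix (Fin n) (Fin n) ℝ)
    (k : EuclideanSpace ℝ (Fin n) → EuclideanSpace ℝ (Fin n)) (b c : Fin n)
    (y : EuclideanSpace ℝ (Fin n)) : ℝ :=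
  pderiv b (lowerIndex G k c) y - ∑ e, lowerIndex G k e y * christoffel G e b c y

/-- A generalized Kerr-Schild metric `G = Gb - 2 H k ⊗ k` on the open set `U`. -/
structure IsLocalKerrSchild (U : Set (EuclideanSpace ℝ (Fin n)))
    (Gb G : EuclideanSpace ℝ (Fin n) → Matrix (Fin n) (Fin n) ℝ)
    (k : EuclideanSpace ℝ (Fin n) → EuclideanSpace ℝ (Fin n))
    (H : EuclideanSpace ℝ (Fin n) → ℝ) : Prop where
  background : IsLocalMetric U Gb
  k_smooth : ContDiffOn ℝ ∞ k U
  H_smooth : ContDiffOn ℝ ∞ H U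
  k_null : ∀ z ∈ U, ∑ i, lowerIndex Gb k i z * k z i = 0
  metric_eq : ∀ z ∈ U, ∀ i j,
    G z i j = Gb z i j - 2 * H z * (lowerIndex Gb k i z * lowerIndex Gb k j z)

/-- The difference of the Christoffel symbols of a generalized Kerr-Schild metric and of the
background, with the upper index lowered by the full metric. -/
noncomputable def christoffelDiff (Gb : EuclideanSpace ℝ (Fin n) → Matrix (Fin n) (Fin n) ℝ)
    (k : EuclideanSpace ℝ (Fin n) → EuclideanSpace ℝ (Fin n))
    (H : EuclideanSpace ℝ (Fin n) → ℝ) (a b c : Fin n) (y : EuclideanSpace ℝ (Fin n)) : ℝ :=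
  -(lowerIndex Gb k a y * lowerIndex Gb k c y * pderiv b H y
    + lowerIndex Gb k a y * lowerIndex Gb k b y * pderiv c H y
    - lowerIndex Gb k b y * lowerIndex Gb k c y * pderiv a H y
    + H y * (lowerIndex Gb k c y * (covDeriv Gb k b a y - covDeriv Gb k a b y)
      + lowerIndex Gb k b y * (covDeriv Gb k c a y - covDeriv Gb k a c y)
      + lowerIndex Gb k a y * (covDeriv Gb k b c y + covDeriv Gb k c b y)))

namespace IsLocalKerrSchild

theorem mono (h : IsLocalKerrSchild U Gb G k H) {V : Set (EuclideanSpace ℝ (Fin n))}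
    (hV : IsOpen V) (hVU : V ⊆ U) : IsLocalKerrSchild V Gb G k H where
  background :=
    { isOpen := hV
      smooth := fun i j => (h.background.smooth i j).mono hVU
      symm := fun z hz => h.background.symm z (hVU hz)
      det_ne := fun z hz => h.background.det_ne z (hVU hz) }
  k_smooth := h.k_smooth.mono hVU
  H_smooth := h.H_smooth.mono hVU
  k_null := fun z hz => h.k_null z (hVU hz)
  metric_eq := fun z hz => h.metric_eq z (hVU hz)

theorem contDiffOn_k (h : IsLocalKerrSchild U Gb G k H) (i : Fin n) :
    ContDiffOn ℝ ∞ (fun z => k z i) U :=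
  (contDiffOn_piLp 2).1 h.k_smooth i

theorem contDiffOn_lowerIndex (h : IsLocalKerrSchild U Gb G k H) (i : Fin n) :
    ContDiffOn ℝ ∞ (lowerIndex Gb k i) U :=
  ContDiffOn.sum fun j _ => (h.background.smooth i j).mul (h.contDiffOn_k j)

theorem differentiableAt_k (h : IsLocalKerrSchild U Gb G k H) (hy : y ∈ U) (i : Fin n) :
    DifferentiableAt ℝ (fun z => k z i) y :=
  differentiableAt_of_contDiffOn h.background.isOpen (h.contDiffOn_k i) hy

theorem differentiableAt_lowerIndex (h : IsLocalKerrSchild U Gb G k H) (hy : y ∈ U) (i : Fin n) :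
    DifferentiableAt ℝ (lowerIndex Gb k i) y :=
  differentiableAt_of_contDiffOn h.background.isOpen (h.contDiffOn_lowerIndex i) hy

theorem differentiableAt_H (h : IsLocalKerrSchild U Gb G k H) (hy : y ∈ U) :
    DifferentiableAt ℝ H y :=
  differentiableAt_of_contDiffOn h.background.isOpen h.H_smooth hy

/-- The correction carries the factor `k_j k^j = 0`. Hence `k` has the same associated 1-form for
both metrics, which is why no separate lowered `k` is ever needed for `G`. -/
theorem sum_metric_mul_k (h : IsLocalKerrSchild U Gb G k H) (hy : y ∈ U) (i : Fin n) :
    ∑ j, G y i j * k y j = lowerIndex Gb k i y := by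
  have : ∀ j, G y i j * k y j = Gb y i j * k y j
      - 2 * H y * lowerIndex Gb k i y * (lowerIndex Gb k j y * k y j) := fun j => by
    rw [h.metric_eq y hy]; ring
  simp only [this, Finset.sum_sub_distrib, ← Finset.mul_sum, h.k_null y hy]
  simp [lowerIndex]

theorem sum_lowerIndex_mul (h : IsLocalKerrSchild U Gb G k H) (hy : y ∈ U) (w : Fin n → ℝ) :
    ∑ i, lowerIndex Gb k i y * w i = ∑ l, k y l * ∑ e, Gb y l e * w e := by
  simp only [lowerIndex, Finset.sum_mul, Finset.mul_sum]
  rw [Finset.sum_comm]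
  refine Finset.sum_congr rfl fun l _ => Finset.sum_congr rfl fun e _ => ?_
  rw [h.background.symm y hy e l]; ring

/-- A rank one update inverted exactly: the term quadratic in `H` drops out because `k` is null. -/
theorem mul_inv_candidate (h : IsLocalKerrSchild U Gb G k H) (hy : y ∈ U) :
    G y * ((Gb y)⁻¹ + Matrix.of fun i j => 2 * H y * (k y i * k y j)) = 1 := by
  ext i j
  rw [Matrix.mul_apply]
  have e1 : ∀ a, G y i a * ((Gb y)⁻¹ + Matrix.of fun i j => 2 * H y * (k y i * k y j)) a j =
      Gb y i a * (Gb y)⁻¹ a j - 2 * H y * lowerIndex Gb k i y *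
        (lowerIndex Gb k a y * (Gb y)⁻¹ a j) + 2 * H y * k y j * (G y i a * k y a) := fun a => by
    rw [Matrix.add_apply, Matrix.of_apply, mul_add, h.metric_eq y hy i a]; ring
  have e2 : ∑ a, lowerIndex Gb k a y * (Gb y)⁻¹ a j = k y j := by
    rw [h.sum_lowerIndex_mul hy fun a => (Gb y)⁻¹ a j]
    simp [h.background.sum_mul_inv hy]
  simp only [e1, Finset.sum_add_distrib, Finset.sum_sub_distrib, ← Finset.mul_sum, e2,
    h.sum_metric_mul_k hy, h.background.sum_mul_inv hy]
  rw [Matrix.one_apply]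
  ring

theorem isLocalMetric (h : IsLocalKerrSchild U Gb G k H) : IsLocalMetric U G where
  isOpen := h.background.isOpen
  smooth i j := by
    refine ContDiffOn.congr ?_ fun z hz => h.metric_eq z hz i j
    exact (h.background.smooth i j).sub ((contDiffOn_const.mul h.H_smooth).mul
      ((h.contDiffOn_lowerIndex i).mul (h.contDiffOn_lowerIndex j)))
  symm z hz i j := by
    rw [h.metric_eq z hz, h.metric_eq z hz, h.background.symm z hz i j]; ring
  det_ne z hz := by
    have := congrArg Matrix.det (h.mul_inv_candidate hz)
    rw [Matrix.det_mul, Matrix.det_one] at this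
    exact IsUnit.of_mul_eq_one _ this

theorem inv_eq (h : IsLocalKerrSchild U Gb G k H) (hy : y ∈ U) (i j : Fin n) :
    (G y)⁻¹ i j = (Gb y)⁻¹ i j + 2 * H y * (k y i * k y j) := by
  rw [Matrix.inv_eq_right_inv (h.mul_inv_candidate hy)]
  rfl

theorem sum_inv_mul_lowerIndex (h : IsLocalKerrSchild U Gb G k H) (hy : y ∈ U) (m : Fin n) :
    ∑ a, (G y)⁻¹ m a * lowerIndex Gb k a y = k y m := by
  simp only [← h.sum_metric_mul_k hy]
  exact h.isLocalMetric.sum_inv_sum_mul hy m fun j => k y j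

theorem sum_lowerIndex_mul_sum_inv (h : IsLocalKerrSchild U Gb G k H) (hy : y ∈ U)
    (w : Fin n → ℝ) :
    ∑ m, lowerIndex Gb k m y * ∑ a, (G y)⁻¹ m a * w a = ∑ a, k y a * w a := by
  simp only [Finset.mul_sum]
  rw [Finset.sum_comm]
  refine Finset.sum_congr rfl fun a _ => ?_
  rw [← h.sum_inv_mul_lowerIndex hy a, Finset.sum_mul]
  exact Finset.sum_congr rfl fun m _ => by rw [h.isLocalMetric.inv_symm hy m a]; ring

/-- The derivative of the background metric contracted twice with `k`. -/
theorem sum_covDeriv_aux (h : IsLocalKerrSchild U Gb G k H) (hy : y ∈ U) (b : Fin n) :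
    ∑ c, k y c * ∑ e, lowerIndex Gb k e y * christoffel Gb e b c y =
      ∑ c, k y c * pderiv b (lowerIndex Gb k c) y := by
  have hB := h.background
  have e1 : ∀ c, ∑ e, lowerIndex Gb k e y * christoffel Gb e b c y =
      ∑ l, k y l * christoffelLower Gb l b c y := fun c => by
    rw [h.sum_lowerIndex_mul hy]
    simp only [hB.sum_mul_christoffel hy]
  -- Contraction with the symmetric `k^c k^l` keeps only the symmetric part of `Γ_{l,bc}`, which is
  -- half of `∂_b g_{cl}`.
  have e2 : ∑ c, ∑ l, k y c * (k y l * christoffelLower Gb l b c y) =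
      (1 / 2) * ∑ c, ∑ l, k y c * (k y l * pderiv b (fun z => Gb z c l) y) := by
    have : ∑ c, ∑ l, k y c * (k y l * christoffelLower Gb l b c y) =
        ∑ c, ∑ l, k y c * (k y l * christoffelLower Gb c b l y) := by
      rw [Finset.sum_comm]
      exact Finset.sum_congr rfl fun _ _ => Finset.sum_congr rfl fun _ _ => by ring
    have h2 : ∑ c, ∑ l, k y c * (k y l * pderiv b (fun z => Gb z c l) y) =
        ∑ c, ∑ l, k y c * (k y l * christoffelLower Gb l b c y) +
        ∑ c, ∑ l, k y c * (k y l * christoffelLower Gb c b l y) := by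
      simp only [← Finset.sum_add_distrib, hB.pderiv_eq_christoffelLower hy]
      exact Finset.sum_congr rfl fun _ _ => Finset.sum_congr rfl fun _ _ => by ring
    rw [h2, ← this]; ring
  have e3 : ∀ c, pderiv b (lowerIndex Gb k c) y =
      ∑ l, pderiv b (fun z => Gb z c l) y * k y l + ∑ l, Gb y c l * pderiv b (fun z => k z l) y := by
    intro c
    have : pderiv b (lowerIndex Gb k c) y = pderiv b (fun z => ∑ l, Gb z c l * k z l) y := rfl
    rw [this, pderiv_sum fun l _ =>
      (hB.differentiableAt hy c l).fun_mul (h.differentiableAt_k hy l)]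
    simp only [pderiv_mul (hB.differentiableAt hy c _) (h.differentiableAt_k hy _),
      Finset.sum_add_distrib]
  -- The derivative of the identity `k_c k^c = 0`.
  have e4 : ∑ c, pderiv b (lowerIndex Gb k c) y * k y c
      + ∑ c, lowerIndex Gb k c y * pderiv b (fun z => k z c) y = 0 := by
    have h0 : pderiv b (fun z => ∑ i, lowerIndex Gb k i z * k z i) y = 0 := by
      rw [← pderiv_const (y := y) b 0]
      exact pderiv_congr_of_isOpen hB.isOpen hy h.k_null
    rw [pderiv_sum fun l _ =>
      (h.differentiableAt_lowerIndex hy l).fun_mul (h.differentiableAt_k hy l)] at h0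
    simpa only [pderiv_mul (h.differentiableAt_lowerIndex hy _) (h.differentiableAt_k hy _),
      Finset.sum_add_distrib] using h0
  have e5 : ∑ c, k y c * pderiv b (lowerIndex Gb k c) y =
      ∑ c, ∑ l, k y c * (k y l * pderiv b (fun z => Gb z c l) y)
      + ∑ c, lowerIndex Gb k c y * pderiv b (fun z => k z c) y := by
    rw [h.sum_lowerIndex_mul hy]
    simp only [e3, mul_add, Finset.sum_add_distrib, Finset.mul_sum]
    congr 1
    exact Finset.sum_congr rfl fun _ _ => Finset.sum_congr rfl fun _ _ => by ring
  have e6 : ∑ c, pderiv b (lowerIndex Gb k c) y * k y c =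
      ∑ c, k y c * pderiv b (lowerIndex Gb k c) y :=
    Finset.sum_congr rfl fun _ _ => mul_comm _ _
  simp only [e1]
  rw [Finset.sum_congr rfl fun c _ => Finset.mul_sum .., e2]
  linarith

/-- This is half of the derivative of `k_c k^c = 0`. -/
theorem sum_covDeriv_mul_k (h : IsLocalKerrSchild U Gb G k H) (hy : y ∈ U) (b : Fin n) :
    ∑ c, k y c * covDeriv Gb k b c y = 0 := by
  simp only [covDeriv, mul_sub, Finset.sum_sub_distrib, h.sum_covDeriv_aux hy, sub_self]

/-- The geodesic equation for the associated 1-form. -/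
theorem sum_k_mul_covDeriv (h : IsLocalKerrSchild U Gb G k H) (hy : y ∈ U) {r : ℝ}
    (hr : ∀ a : Fin n, (∑ b, k y b * pderiv b (fun z => k z a) y) +
      (∑ b, ∑ d, christoffel Gb a b d y * k y b * k y d) = r * k y a) (c : Fin n) :
    ∑ b, k y b * covDeriv Gb k b c y = r * lowerIndex Gb k c y := by
  have hB := h.background
  have e3 : ∀ b, pderiv b (lowerIndex Gb k c) y =
      ∑ l, pderiv b (fun z => Gb z c l) y * k y l + ∑ l, Gb y c l * pderiv b (fun z => k z l) y := by
    intro b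
    have : pderiv b (lowerIndex Gb k c) y = pderiv b (fun z => ∑ l, Gb z c l * k z l) y := rfl
    rw [this, pderiv_sum fun l _ =>
      (hB.differentiableAt hy c l).fun_mul (h.differentiableAt_k hy l)]
    simp only [pderiv_mul (hB.differentiableAt hy c _) (h.differentiableAt_k hy _),
      Finset.sum_add_distrib]
  have e1 : ∀ b, ∑ e, lowerIndex Gb k e y * christoffel Gb e b c y =
      ∑ l, k y l * christoffelLower Gb l b c y := fun b => by
    rw [h.sum_lowerIndex_mul hy]
    simp only [hB.sum_mul_christoffel hy]
  have e2 : r * lowerIndex Gb k c y = ∑ b, k y b * ∑ l, Gb y c l * pderiv b (fun z => k z l) y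
      + ∑ b, ∑ d, christoffelLower Gb c b d y * (k y b * k y d) := by
    have : r * lowerIndex Gb k c y = ∑ a, Gb y c a * (r * k y a) := by
      simp only [lowerIndex, Finset.mul_sum]
      exact Finset.sum_congr rfl fun _ _ => by ring
    rw [this]
    simp only [← hr, mul_add, Finset.sum_add_distrib, Finset.mul_sum]
    congr 1
    · rw [Finset.sum_comm]
      exact Finset.sum_congr rfl fun _ _ => Finset.sum_congr rfl fun _ _ => by ring
    · rw [Finset.sum_comm]
      refine Finset.sum_congr rfl fun b _ => ?_
      rw [Finset.sum_comm]
      refine Finset.sum_congr rfl fun d _ => ?_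
      rw [← hB.sum_mul_christoffel hy c b d, Finset.sum_mul]
      exact Finset.sum_congr rfl fun _ _ => by ring
  rw [e2]
  simp only [covDeriv, e1, e3, mul_sub, mul_add, Finset.sum_sub_distrib, Finset.sum_add_distrib,
    hB.pderiv_eq_christoffelLower hy _ c, Finset.mul_sum, add_mul]
  have e4 : ∑ b, ∑ l, k y b * (christoffelLower Gb l b c y * k y l) =
      ∑ b, ∑ l, k y b * (k y l * christoffelLower Gb l b c y) :=
    Finset.sum_congr rfl fun _ _ => Finset.sum_congr rfl fun _ _ => by ring
  have e5 : ∑ b, ∑ l, k y b * (christoffelLower Gb c b l y * k y l) =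
      ∑ b, ∑ l, christoffelLower Gb c b l y * (k y b * k y l) :=
    Finset.sum_congr rfl fun _ _ => Finset.sum_congr rfl fun _ _ => by ring
  rw [e4, e5]
  ring

theorem pderiv_metric (h : IsLocalKerrSchild U Gb G k H) (hy : y ∈ U) (c i j : Fin n) :
    pderiv c (fun z => G z i j) y = pderiv c (fun z => Gb z i j) y
      - 2 * (pderiv c H y * (lowerIndex Gb k i y * lowerIndex Gb k j y)
        + H y * (pderiv c (lowerIndex Gb k i) y * lowerIndex Gb k j y
          + lowerIndex Gb k i y * pderiv c (lowerIndex Gb k j) y)) := by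
  have hH := h.differentiableAt_H hy
  have hi := h.differentiableAt_lowerIndex hy i
  have hj := h.differentiableAt_lowerIndex hy j
  rw [pderiv_congr_of_isOpen h.background.isOpen hy fun z hz => h.metric_eq z hz i j,
    pderiv_sub (h.background.differentiableAt hy i j) ((hH.const_mul 2).fun_mul (hi.fun_mul hj)),
    pderiv_mul (hH.const_mul 2) (hi.fun_mul hj), pderiv_const_mul 2 hH,
    pderiv_mul hi hj]
  ring

/-- The usual formula for the difference of two Levi-Civita connections: with `h = -2H k ⊗ k`,
`christoffelDiff` is `½ (∇_b h_{ac} + ∇_c h_{ab} - ∇_a h_{bc})` for the background derivative, and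
its index is raised with the full metric. -/
theorem christoffel_sub (h : IsLocalKerrSchild U Gb G k H) (hy : y ∈ U) (m b c : Fin n) :
    christoffel G m b c y - christoffel Gb m b c y =
      ∑ a, (G y)⁻¹ m a * christoffelDiff Gb k H a b c y := by
  -- The background symbol is lowered with `G` and raised again, so that both symbols carry the same
  -- factor `G⁻¹`.
  have e1 : christoffel Gb m b c y = ∑ a, (G y)⁻¹ m a * (christoffelLower Gb a b c y
      - 2 * H y * lowerIndex Gb k a y * ∑ e, lowerIndex Gb k e y * christoffel Gb e b c y) := by
    rw [← h.isLocalMetric.sum_inv_sum_mul hy m fun e => christoffel Gb e b c y]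
    refine Finset.sum_congr rfl fun a _ => ?_
    congr 1
    rw [← h.background.sum_mul_christoffel hy, Finset.mul_sum, ← Finset.sum_sub_distrib]
    exact Finset.sum_congr rfl fun e _ => by rw [h.metric_eq y hy]; ring
  rw [e1, christoffel_eq_sum, ← Finset.sum_sub_distrib]
  refine Finset.sum_congr rfl fun a _ => ?_
  rw [← mul_sub]
  congr 1
  simp only [christoffelLower, h.pderiv_metric hy, christoffelDiff, covDeriv]
  have e2 : ∑ e, lowerIndex Gb k e y * christoffel Gb e b c y =
      ∑ e, lowerIndex Gb k e y * christoffel Gb e c b y := by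
    simp only [h.background.christoffel_comm hy _ b c]
  have e3 : ∑ e, lowerIndex Gb k e y * christoffel Gb e b a y =
      ∑ e, lowerIndex Gb k e y * christoffel Gb e a b y := by
    simp only [h.background.christoffel_comm hy _ b a]
  have e4 : ∑ e, lowerIndex Gb k e y * christoffel Gb e c a y =
      ∑ e, lowerIndex Gb k e y * christoffel Gb e a c y := by
    simp only [h.background.christoffel_comm hy _ c a]
  rw [e2, e3, e4]
  ring

end IsLocalKerrSchild

end KerrSchild

/-! ### Contractions of the connection difference and of the curvature difference with `k`. -/

section KerrSchildCurvature

variable {n : ℕ} {U : Set (EuclideanSpace ℝ (Fin n))} {y : EuclideanSpace ℝ (Fin n)}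
  {Gb G : EuclideanSpace ℝ (Fin n) → Matrix (Fin n) (Fin n) ℝ}
  {k : EuclideanSpace ℝ (Fin n) → EuclideanSpace ℝ (Fin n)}
  {H : EuclideanSpace ℝ (Fin n) → ℝ} {f : EuclideanSpace ℝ (Fin n) → ℝ}

/-- `k` satisfies the geodesic equation `∇_k k = f k` on `U` with a smooth function `f`. -/
structure IsLocalGeodesic (U : Set (EuclideanSpace ℝ (Fin n)))
    (G : EuclideanSpace ℝ (Fin n) → Matrix (Fin n) (Fin n) ℝ)
    (k : EuclideanSpace ℝ (Fin n) → EuclideanSpace ℝ (Fin n))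
    (f : EuclideanSpace ℝ (Fin n) → ℝ) : Prop where
  smooth : ContDiffOn ℝ ∞ f U
  eq : ∀ z ∈ U, ∀ a : Fin n, (∑ b, k z b * pderiv b (fun z => k z a) z) +
    (∑ b, ∑ d, christoffel G a b d z * k z b * k z d) = f z * k z a

/-- The function `φ = k(H) + 2 f H`. -/
noncomputable def transportTerm (k : EuclideanSpace ℝ (Fin n) → EuclideanSpace ℝ (Fin n))
    (H f : EuclideanSpace ℝ (Fin n) → ℝ) (y : EuclideanSpace ℝ (Fin n)) : ℝ :=
  ∑ a, k y a * pderiv a H y + 2 * f y * H y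

namespace IsLocalKerrSchild

theorem differentiableAt_transportTerm (h : IsLocalKerrSchild U Gb G k H)
    (hf : IsLocalGeodesic U Gb k f) (hy : y ∈ U) :
    DifferentiableAt ℝ (transportTerm k H f) y := by
  refine differentiableAt_of_contDiffOn h.background.isOpen ?_ hy
  exact (ContDiffOn.sum fun a _ => (h.contDiffOn_k a).mul
    (contDiffOn_pderiv h.background.isOpen h.H_smooth a)).add
      ((contDiffOn_const.mul hf.smooth).mul h.H_smooth)

theorem k_null' (h : IsLocalKerrSchild U Gb G k H) (hy : y ∈ U) :
    ∑ i, k y i * lowerIndex Gb k i y = 0 := by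
  rw [← h.k_null y hy]
  exact Finset.sum_congr rfl fun _ _ => mul_comm _ _

/-- Raising `k_m` with `G⁻¹` gives `k^a`. Nullness removes the terms with `k^a k_a` or `k^a ∇_b
k_a`; the geodesic equation turns the two terms with `k^a ∇_a` into the summand `2fH` of `φ`. -/
theorem sum_lowerIndex_mul_christoffel_sub (h : IsLocalKerrSchild U Gb G k H)
    (hf : IsLocalGeodesic U Gb k f) (hy : y ∈ U) (b c : Fin n) :
    ∑ m, lowerIndex Gb k m y * (christoffel G m b c y - christoffel Gb m b c y) =
      transportTerm k H f y * (lowerIndex Gb k b y * lowerIndex Gb k c y) := by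
  simp only [h.christoffel_sub hy]
  rw [h.sum_lowerIndex_mul_sum_inv hy]
  have e1 : ∀ a, k y a * christoffelDiff Gb k H a b c y =
      (-(lowerIndex Gb k c y * pderiv b H y) - lowerIndex Gb k b y * pderiv c H y
        - H y * (covDeriv Gb k b c y + covDeriv Gb k c b y)) * (k y a * lowerIndex Gb k a y)
      + (lowerIndex Gb k b y * lowerIndex Gb k c y) * (k y a * pderiv a H y)
      - (H y * lowerIndex Gb k c y) * (k y a * covDeriv Gb k b a y)
      + (H y * lowerIndex Gb k c y) * (k y a * covDeriv Gb k a b y)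
      - (H y * lowerIndex Gb k b y) * (k y a * covDeriv Gb k c a y)
      + (H y * lowerIndex Gb k b y) * (k y a * covDeriv Gb k a c y) := fun a => by
    rw [christoffelDiff]; ring
  simp only [e1, Finset.sum_add_distrib, Finset.sum_sub_distrib, ← Finset.mul_sum, h.k_null' hy,
    h.sum_covDeriv_mul_k hy, h.sum_k_mul_covDeriv hy (hf.eq y hy), transportTerm]
  ring

/-- The same cancellations with `k` in a lower slot: what survives is `-φ k_a k_b`, and raising the
index `a` gives a multiple of `k`. -/
theorem sum_christoffel_sub_mul_k (h : IsLocalKerrSchild U Gb G k H)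
    (hf : IsLocalGeodesic U Gb k f) (hy : y ∈ U) (m b : Fin n) :
    ∑ c, k y c * (christoffel G m c b y - christoffel Gb m c b y) =
      -transportTerm k H f y * lowerIndex Gb k b y * k y m := by
  simp only [h.christoffel_sub hy, Finset.mul_sum]
  rw [Finset.sum_comm]
  have e1 : ∀ a c, k y c * ((G y)⁻¹ m a * christoffelDiff Gb k H a c b y) =
      (G y)⁻¹ m a * (k y c * christoffelDiff Gb k H a c b y) := fun a c => by ring
  simp only [e1, ← Finset.mul_sum]
  have e2 : ∀ a, ∑ c, k y c * christoffelDiff Gb k H a c b y =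
      -transportTerm k H f y * lowerIndex Gb k b y * lowerIndex Gb k a y := by
    intro a
    have e3 : ∀ c, k y c * christoffelDiff Gb k H a c b y =
        (-(lowerIndex Gb k a y * pderiv b H y) + lowerIndex Gb k b y * pderiv a H y
          - H y * (covDeriv Gb k b a y - covDeriv Gb k a b y)) * (k y c * lowerIndex Gb k c y)
        - (lowerIndex Gb k a y * lowerIndex Gb k b y) * (k y c * pderiv c H y)
        - (H y * lowerIndex Gb k b y) * (k y c * covDeriv Gb k c a y)
        + (H y * lowerIndex Gb k b y) * (k y c * covDeriv Gb k a c y)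
        - (H y * lowerIndex Gb k a y) * (k y c * covDeriv Gb k b c y)
        - (H y * lowerIndex Gb k a y) * (k y c * covDeriv Gb k c b y) := fun c => by
      rw [christoffelDiff]; ring
    simp only [e3, Finset.sum_add_distrib, Finset.sum_sub_distrib, ← Finset.mul_sum, h.k_null' hy,
      h.sum_covDeriv_mul_k hy, h.sum_k_mul_covDeriv hy (hf.eq y hy), transportTerm]
    ring
  have e4 : ∀ a, (G y)⁻¹ m a * (-transportTerm k H f y * lowerIndex Gb k b y * lowerIndex Gb k a y)
      = -transportTerm k H f y * lowerIndex Gb k b y * ((G y)⁻¹ m a * lowerIndex Gb k a y) :=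
    fun a => by ring
  simp only [e2, e4, ← Finset.mul_sum, h.sum_inv_mul_lowerIndex hy]

/-- Each term of `christoffelDiff` containing `k_b` or `k_c` dies on `Y, Z`; the one remaining is
the symmetrized `∇k` times `k_a`. -/
theorem sum_christoffel_sub_orthogonal (h : IsLocalKerrSchild U Gb G k H) (hy : y ∈ U)
    {Y Z : Fin n → ℝ} (hY : ∑ i, lowerIndex Gb k i y * Y i = 0)
    (hZ : ∑ i, lowerIndex Gb k i y * Z i = 0) :
    ∃ t : ℝ, ∀ m, ∑ b, ∑ c, (christoffel G m b c y - christoffel Gb m b c y) * (Y b * Z c) =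
      t * k y m := by
  refine ⟨-H y * ∑ b, ∑ c, (covDeriv Gb k b c y + covDeriv Gb k c b y) * (Y b * Z c), fun m => ?_⟩
  have e0 : ∀ a, ∑ b, ∑ c, christoffelDiff Gb k H a b c y * (Y b * Z c) =
      (-H y * ∑ b, ∑ c, (covDeriv Gb k b c y + covDeriv Gb k c b y) * (Y b * Z c))
        * lowerIndex Gb k a y := by
    intro a
    have e1 : ∀ b c, christoffelDiff Gb k H a b c y * (Y b * Z c) =
        (-(lowerIndex Gb k a y * pderiv b H y) + lowerIndex Gb k b y * pderiv a H y
          - H y * (covDeriv Gb k b a y - covDeriv Gb k a b y)) * Y b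
            * (lowerIndex Gb k c y * Z c)
        + (lowerIndex Gb k b y * Y b) * (-(lowerIndex Gb k a y * pderiv c H y
          - -(H y * (covDeriv Gb k c a y - covDeriv Gb k a c y))) * Z c)
        + (-H y * lowerIndex Gb k a y)
          * ((covDeriv Gb k b c y + covDeriv Gb k c b y) * (Y b * Z c)) := fun b c => by
      rw [christoffelDiff]; ring
    simp only [e1, Finset.sum_add_distrib, ← Finset.mul_sum, ← Finset.sum_mul, hZ, hY]
    simp only [mul_zero, zero_mul]
    ring
  simp only [h.christoffel_sub hy, Finset.sum_mul]
  have e2 : ∑ b, ∑ c, ∑ a, (G y)⁻¹ m a * christoffelDiff Gb k H a b c y * (Y b * Z c) =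
      ∑ a, (G y)⁻¹ m a * ∑ b, ∑ c, christoffelDiff Gb k H a b c y * (Y b * Z c) := by
    simp only [Finset.mul_sum]
    refine ((Finset.sum_congr rfl fun b _ => Finset.sum_comm).trans Finset.sum_comm).trans ?_
    exact Finset.sum_congr rfl fun a _ => Finset.sum_congr rfl fun b _ =>
      Finset.sum_congr rfl fun c _ => by ring
  rw [e2]
  simp only [e0]
  generalize (-H y * ∑ b, ∑ c, (covDeriv Gb k b c y + covDeriv Gb k c b y) * (Y b * Z c)) = t
  rw [← h.sum_inv_mul_lowerIndex hy m, Finset.mul_sum]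
  exact Finset.sum_congr rfl fun a _ => by ring

/-- The curvature difference contracted with `k` in the first index. -/
theorem sum_lowerIndex_mul_riemannUp_sub (h : IsLocalKerrSchild U Gb G k H)
    (hf : IsLocalGeodesic U Gb k f) (hy : y ∈ U) :
    ∃ P : Fin n → Fin n → ℝ, ∀ b c d,
      ∑ e, lowerIndex Gb k e y * (riemannUp G e b c d y - riemannUp Gb e b c d y) =
        lowerIndex Gb k c y * P d b - lowerIndex Gb k d y * P c b
        + transportTerm k H f y * lowerIndex Gb k b y * (covDeriv Gb k c d y - covDeriv Gb k d c y)
        - ∑ m, covDeriv Gb k c m y * (christoffel G m d b y - christoffel Gb m d b y)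
        + ∑ m, covDeriv Gb k d m y * (christoffel G m c b y - christoffel Gb m c b y) := by
  have hB := h.background
  have hG := h.isLocalMetric
  have hφ := h.differentiableAt_transportTerm hf hy
  have hκ := h.differentiableAt_lowerIndex hy
  have hC : ∀ m b c, DifferentiableAt ℝ
      (fun z => christoffel G m b c z - christoffel Gb m b c z) y := fun m b c =>
    differentiableAt_of_contDiffOn hB.isOpen
      ((hG.contDiffOn_christoffel m b c).sub (hB.contDiffOn_christoffel m b c)) hy
  have hΓ : ∀ m b c, DifferentiableAt ℝ (christoffel G m b c) y := fun m b c =>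
    differentiableAt_of_contDiffOn hB.isOpen (hG.contDiffOn_christoffel m b c) hy
  have hΓb : ∀ m b c, DifferentiableAt ℝ (christoffel Gb m b c) y := fun m b c =>
    differentiableAt_of_contDiffOn hB.isOpen (hB.contDiffOn_christoffel m b c) hy
  -- Differentiating the identity `k_e D^e_{db} = φ k_d k_b` trades the derivative of `D` for
  -- derivatives of `φ` and `k`. This is where differentiability of `φ`, hence regularity of `f`,
  -- enters.
  have hψ : ∀ b c d, ∑ e, lowerIndex Gb k e y *
      (pderiv c (christoffel G e d b) y - pderiv c (christoffel Gb e d b) y) =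
      pderiv c (transportTerm k H f) y * (lowerIndex Gb k d y * lowerIndex Gb k b y)
      + transportTerm k H f y * (pderiv c (lowerIndex Gb k d) y * lowerIndex Gb k b y
        + lowerIndex Gb k d y * pderiv c (lowerIndex Gb k b) y)
      - ∑ e, pderiv c (lowerIndex Gb k e) y
        * (christoffel G e d b y - christoffel Gb e d b y) := by
    intro b c d
    have e1 := pderiv_congr_of_isOpen (i := c) hB.isOpen hy
      fun z hz => h.sum_lowerIndex_mul_christoffel_sub hf hz d b
    rw [pderiv_sum fun m _ => (hκ m).fun_mul (hC m d b),
      pderiv_mul hφ ((hκ d).fun_mul (hκ b)), pderiv_mul (hκ d) (hκ b)] at e1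
    simp only [pderiv_mul (hκ _) (hC _ d b), Finset.sum_add_distrib,
      pderiv_sub (hΓ _ d b) (hΓb _ d b)] at e1
    linarith
  have hΓΓ : ∀ b c d, ∑ e, lowerIndex Gb k e y *
      (∑ m, christoffel G e c m y * christoffel G m d b y
        - ∑ m, christoffel Gb e c m y * christoffel Gb m d b y) =
      transportTerm k H f y * lowerIndex Gb k c y
        * ∑ m, lowerIndex Gb k m y * christoffel G m d b y
      + ∑ m, (∑ e, lowerIndex Gb k e y * christoffel Gb e c m y)
        * (christoffel G m d b y - christoffel Gb m d b y) := by
    intro b c d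
    have e1 : ∀ m, transportTerm k H f y * lowerIndex Gb k c y
        * (lowerIndex Gb k m y * christoffel G m d b y) =
        (∑ e, lowerIndex Gb k e y * (christoffel G e c m y - christoffel Gb e c m y))
          * christoffel G m d b y := fun m => by
      rw [h.sum_lowerIndex_mul_christoffel_sub hf hy]; ring
    rw [Finset.mul_sum]
    simp only [e1, ← Finset.sum_sub_distrib, Finset.mul_sum, Finset.sum_mul]
    rw [Finset.sum_comm]
    simp only [← Finset.sum_add_distrib]
    exact Finset.sum_congr rfl fun _ _ => Finset.sum_congr rfl fun _ _ => by ring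
  -- `P` collects the coefficients of the free factors `k_c` and `k_d`. Its form is irrelevant
  -- later, since these factors vanish on vectors orthogonal to `k`.
  refine ⟨fun d b => -(lowerIndex Gb k b y * pderiv d (transportTerm k H f) y)
    - transportTerm k H f y * pderiv d (lowerIndex Gb k b) y
    + transportTerm k H f y * ∑ m, lowerIndex Gb k m y * christoffel G m d b y, fun b c d => ?_⟩
  have e1 : ∀ e, lowerIndex Gb k e y * (riemannUp G e b c d y - riemannUp Gb e b c d y) =
      lowerIndex Gb k e y
        * (pderiv c (christoffel G e d b) y - pderiv c (christoffel Gb e d b) y)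
      - lowerIndex Gb k e y
        * (pderiv d (christoffel G e c b) y - pderiv d (christoffel Gb e c b) y)
      + lowerIndex Gb k e y * (∑ m, christoffel G e c m y * christoffel G m d b y
        - ∑ m, christoffel Gb e c m y * christoffel Gb m d b y)
      - lowerIndex Gb k e y * (∑ m, christoffel G e d m y * christoffel G m c b y
        - ∑ m, christoffel Gb e d m y * christoffel Gb m c b y) := fun e => by
    simp only [riemannUp, Finset.sum_sub_distrib]; ring
  rw [Finset.sum_congr rfl fun e _ => e1 e, Finset.sum_sub_distrib, Finset.sum_add_distrib,
    Finset.sum_sub_distrib]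
  rw [hψ, hψ, hΓΓ, hΓΓ]
  have e2 : ∀ c d : Fin n, ∑ m, covDeriv Gb k c m y
      * (christoffel G m d b y - christoffel Gb m d b y) =
      ∑ e, pderiv c (lowerIndex Gb k e) y * (christoffel G e d b y - christoffel Gb e d b y)
      - ∑ m, (∑ e, lowerIndex Gb k e y * christoffel Gb e c m y)
        * (christoffel G m d b y - christoffel Gb m d b y) := fun c d => by
    simp only [covDeriv, sub_mul, Finset.sum_sub_distrib]
  have e3 : covDeriv Gb k c d y - covDeriv Gb k d c y =
      pderiv c (lowerIndex Gb k d) y - pderiv d (lowerIndex Gb k c) y := by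
    simp only [covDeriv, hB.christoffel_comm hy _ d c]; ring
  rw [e2, e2, e3]
  ring

end IsLocalKerrSchild

end KerrSchildCurvature

/-! ### Evaluation of covariant tensors given by components. -/

section Multilinear

variable {n : ℕ}

/-- The value of the bilinear form with components `M`. -/
noncomputable def eval₂ (M : Fin n → Fin n → ℝ) (v w : EuclideanSpace ℝ (Fin n)) : ℝ :=
  ∑ a, ∑ b, M a b * v a * w b

/-- The value of the covariant tensor of rank four with components `T`. -/
noncomputable def eval₄ (T : Fin n → Fin n → Fin n → Fin n → ℝ)
    (v w x z : EuclideanSpace ℝ (Fin n)) : ℝ :=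
  ∑ a, ∑ b, ∑ c, ∑ d, T a b c d * v a * w b * x c * z d

theorem linearMap_eq_sum (L : EuclideanSpace ℝ (Fin n) →ₗ[ℝ] ℝ) (v : EuclideanSpace ℝ (Fin n)) :
    L v = ∑ a, v a * L (EuclideanSpace.single a 1) := by
  have h := (EuclideanSpace.basisFun (Fin n) ℝ).sum_repr v
  conv_lhs => rw [← h]
  simp [map_sum]

section

variable {T : Fin n → Fin n → Fin n → Fin n → ℝ} (v v' w x z : EuclideanSpace ℝ (Fin n)) (r : ℝ)

theorem eval₄_add_1 : eval₄ T (v + v') w x z = eval₄ T v w x z + eval₄ T v' w x z := by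
  simp only [eval₄, PiLp.add_apply, ← Finset.sum_add_distrib, mul_add, add_mul]

theorem eval₄_add_2 : eval₄ T w (v + v') x z = eval₄ T w v x z + eval₄ T w v' x z := by
  simp only [eval₄, PiLp.add_apply, ← Finset.sum_add_distrib, mul_add, add_mul]

theorem eval₄_add_3 : eval₄ T w x (v + v') z = eval₄ T w x v z + eval₄ T w x v' z := by
  simp only [eval₄, PiLp.add_apply, ← Finset.sum_add_distrib, mul_add, add_mul]

theorem eval₄_add_4 : eval₄ T w x z (v + v') = eval₄ T w x z v + eval₄ T w x z v' := by
  simp only [eval₄, PiLp.add_apply, ← Finset.sum_add_distrib, mul_add]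

theorem eval₄_smul_1 : eval₄ T (r • v) w x z = r * eval₄ T v w x z := by
  simp only [eval₄, PiLp.smul_apply, smul_eq_mul, Finset.mul_sum]
  exact Finset.sum_congr rfl fun _ _ => Finset.sum_congr rfl fun _ _ =>
    Finset.sum_congr rfl fun _ _ => Finset.sum_congr rfl fun _ _ => by ring

theorem eval₄_smul_2 : eval₄ T w (r • v) x z = r * eval₄ T w v x z := by
  simp only [eval₄, PiLp.smul_apply, smul_eq_mul, Finset.mul_sum]
  exact Finset.sum_congr rfl fun _ _ => Finset.sum_congr rfl fun _ _ =>
    Finset.sum_congr rfl fun _ _ => Finset.sum_congr rfl fun _ _ => by ring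

theorem eval₄_smul_3 : eval₄ T w x (r • v) z = r * eval₄ T w x v z := by
  simp only [eval₄, PiLp.smul_apply, smul_eq_mul, Finset.mul_sum]
  exact Finset.sum_congr rfl fun _ _ => Finset.sum_congr rfl fun _ _ =>
    Finset.sum_congr rfl fun _ _ => Finset.sum_congr rfl fun _ _ => by ring

theorem eval₄_smul_4 : eval₄ T w x z (r • v) = r * eval₄ T w x z v := by
  simp only [eval₄, PiLp.smul_apply, smul_eq_mul, Finset.mul_sum]
  exact Finset.sum_congr rfl fun _ _ => Finset.sum_congr rfl fun _ _ =>
    Finset.sum_congr rfl fun _ _ => Finset.sum_congr rfl fun _ _ => by ring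

end

/-- Linearity in one slot at a time; this transfers the vanishing of frame components to arbitrary
vectors of the spans, and back. -/
theorem eval₄_eq_zero_of_span {T : Fin n → Fin n → Fin n → Fin n → ℝ}
    {S₁ S₂ S₃ S₄ : Set (EuclideanSpace ℝ (Fin n))}
    (h : ∀ v ∈ S₁, ∀ w ∈ S₂, ∀ x ∈ S₃, ∀ z ∈ S₄, eval₄ T v w x z = 0)
    {v w x z : EuclideanSpace ℝ (Fin n)} (hv : v ∈ Submodule.span ℝ S₁)
    (hw : w ∈ Submodule.span ℝ S₂) (hx : x ∈ Submodule.span ℝ S₃)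
    (hz : z ∈ Submodule.span ℝ S₄) : eval₄ T v w x z = 0 := by
  have h4 : ∀ v ∈ S₁, ∀ w ∈ S₂, ∀ x ∈ S₃, eval₄ T v w x z = 0 := by
    intro v hv w hw x hx
    induction hz using Submodule.span_induction with
    | mem z hz => exact h v hv w hw x hx z hz
    | zero => simpa using eval₄_smul_4 (T := T) 0 v w x (0 : ℝ)
    | add z z' _ _ h1 h2 => rw [eval₄_add_4, h1, h2, add_zero]
    | smul r z _ h1 => rw [eval₄_smul_4, h1, mul_zero]
  have h3 : ∀ v ∈ S₁, ∀ w ∈ S₂, eval₄ T v w x z = 0 := by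
    intro v hv w hw
    induction hx using Submodule.span_induction with
    | mem x hx => exact h4 v hv w hw x hx
    | zero => simpa using eval₄_smul_3 (T := T) 0 v w z (0 : ℝ)
    | add x x' _ _ h1 h2 => rw [eval₄_add_3, h1, h2, add_zero]
    | smul r x _ h1 => rw [eval₄_smul_3, h1, mul_zero]
  have h2 : ∀ v ∈ S₁, eval₄ T v w x z = 0 := by
    intro v hv
    induction hw using Submodule.span_induction with
    | mem w hw => exact h3 v hv w hw
    | zero => simpa using eval₄_smul_2 (T := T) 0 v x z (0 : ℝ)
    | add w w' _ _ h1 h2 => rw [eval₄_add_2, h1, h2, add_zero]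
    | smul r w _ h1 => rw [eval₄_smul_2, h1, mul_zero]
  induction hv using Submodule.span_induction with
  | mem v hv => exact h2 v hv
  | zero => simpa using eval₄_smul_1 (T := T) 0 w x z (0 : ℝ)
  | add v v' _ _ h1 h2 => rw [eval₄_add_1, h1, h2, add_zero]
  | smul r v _ h1 => rw [eval₄_smul_1, h1, mul_zero]

/-- A rank four tensor with two slots filled, as a bilinear map in the slots 2 and 3. -/
noncomputable def eval₄Lin (T : Fin n → Fin n → Fin n → Fin n → ℝ)
    (v z : EuclideanSpace ℝ (Fin n)) :
    EuclideanSpace ℝ (Fin n) →ₗ[ℝ] EuclideanSpace ℝ (Fin n) →ₗ[ℝ] ℝ :=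
  LinearMap.mk₂ ℝ (fun w x => eval₄ T v w x z)
    (fun _ _ _ => eval₄_add_2 ..) (fun _ _ _ => eval₄_smul_2 ..)
    (fun _ _ _ => eval₄_add_3 ..) (fun _ _ _ => eval₄_smul_3 ..)

theorem eval₄Lin_apply (T : Fin n → Fin n → Fin n → Fin n → ℝ)
    (v w x z : EuclideanSpace ℝ (Fin n)) : eval₄Lin T v z w x = eval₄ T v w x z := rfl

theorem eval₄_single_single (T : Fin n → Fin n → Fin n → Fin n → ℝ)
    (w z : EuclideanSpace ℝ (Fin n)) (a c : Fin n) :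
    eval₄ T (EuclideanSpace.single a 1) w (EuclideanSpace.single c 1) z =
      ∑ b, ∑ d, T a b c d * w b * z d := by
  simp [eval₄]

theorem eval₄_antisymm_left {T : Fin n → Fin n → Fin n → Fin n → ℝ}
    (hT : ∀ a b c d, T a b c d = -T b a c d) (v w x z : EuclideanSpace ℝ (Fin n)) :
    eval₄ T v w x z = -eval₄ T w v x z := by
  simp only [eval₄, ← Finset.sum_neg_distrib]
  rw [Finset.sum_comm]
  exact Finset.sum_congr rfl fun b _ => Finset.sum_congr rfl fun a _ =>
    Finset.sum_congr rfl fun c _ => Finset.sum_congr rfl fun d _ => by rw [hT a b]; ring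

theorem eval₄_antisymm_right {T : Fin n → Fin n → Fin n → Fin n → ℝ}
    (hT : ∀ a b c d, T a b c d = -T a b d c) (v w x z : EuclideanSpace ℝ (Fin n)) :
    eval₄ T v w x z = -eval₄ T v w z x := by
  simp only [eval₄, ← Finset.sum_neg_distrib]
  refine Finset.sum_congr rfl fun a _ => Finset.sum_congr rfl fun b _ => ?_
  rw [Finset.sum_comm]
  exact Finset.sum_congr rfl fun c _ => Finset.sum_congr rfl fun d _ => by rw [hT a b d c]; ring

theorem eval₄_pair_symm {T : Fin n → Fin n → Fin n → Fin n → ℝ}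
    (hT : ∀ a b c d, T a b c d = T c d a b) (v w x z : EuclideanSpace ℝ (Fin n)) :
    eval₄ T v w x z = eval₄ T x z v w := by
  simp only [eval₄]
  refine ((Finset.sum_congr rfl fun a _ => (Finset.sum_comm.trans
    (Finset.sum_congr rfl fun c _ => Finset.sum_comm))).trans Finset.sum_comm).trans ?_
  refine Finset.sum_congr rfl fun c _ => ?_
  rw [Finset.sum_comm]
  exact Finset.sum_congr rfl fun d _ => Finset.sum_congr rfl fun a _ =>
    Finset.sum_congr rfl fun b _ => by rw [hT a b c d]; ring

theorem eval₂_mul_eval₂ (M N : Fin n → Fin n → ℝ) (v w x z : EuclideanSpace ℝ (Fin n)) :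
    eval₄ (fun a b c d => M a c * N b d) v w x z = eval₂ M v x * eval₂ N w z := by
  simp only [eval₄, eval₂, Finset.sum_mul]
  refine Finset.sum_congr rfl fun a _ => ?_
  rw [Finset.sum_comm]
  refine (Finset.sum_congr rfl fun c _ => ?_)
  simp only [Finset.mul_sum]
  exact Finset.sum_congr rfl fun b _ => Finset.sum_congr rfl fun d _ => by ring

theorem eval₂_mul_eval₂' (M N : Fin n → Fin n → ℝ) (v w x z : EuclideanSpace ℝ (Fin n)) :
    eval₄ (fun a b c d => M a d * N b c) v w x z = eval₂ M v z * eval₂ N w x := by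
  rw [← eval₂_mul_eval₂]
  simp only [eval₄]
  refine Finset.sum_congr rfl fun a _ => Finset.sum_congr rfl fun b _ => ?_
  rw [Finset.sum_comm]
  exact Finset.sum_congr rfl fun c _ => Finset.sum_congr rfl fun d _ => by ring

theorem sum_sum_sum_mul_1 (p : Fin n → ℝ) (q : Fin n → Fin n → ℝ) :
    ∑ b, ∑ c, ∑ d, p b * q c d = (∑ b, p b) * ∑ c, ∑ d, q c d := by
  simp only [← Finset.mul_sum, ← Finset.sum_mul]

theorem sum_sum_sum_mul_2 (p : Fin n → ℝ) (q : Fin n → Fin n → ℝ) :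
    ∑ b, ∑ c, ∑ d, p c * q b d = (∑ b, p b) * ∑ c, ∑ d, q c d := by
  rw [Finset.sum_comm, sum_sum_sum_mul_1]

theorem sum_sum_sum_mul_3 (p : Fin n → ℝ) (q : Fin n → Fin n → ℝ) :
    ∑ b, ∑ c, ∑ d, p d * q b c = (∑ b, p b) * ∑ c, ∑ d, q c d := by
  simp only [← Finset.sum_mul, ← Finset.mul_sum]

theorem sum_sum_sum_sum_mul (p : Fin n → Fin n → ℝ) (q : Fin n → Fin n → Fin n → ℝ) :
    ∑ b, ∑ c, ∑ d, ∑ m, p c m * q m d b = ∑ m, (∑ c, p c m) * ∑ d, ∑ b, q m d b := by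
  refine ((Finset.sum_congr rfl fun b _ => ((Finset.sum_congr rfl fun c _ =>
    Finset.sum_comm).trans Finset.sum_comm)).trans Finset.sum_comm).trans ?_
  refine Finset.sum_congr rfl fun m _ => ?_
  rw [Finset.sum_comm]
  refine (Finset.sum_congr rfl fun c _ => Finset.sum_comm).trans ?_
  simp only [← Finset.mul_sum, ← Finset.sum_mul]

theorem sum_sum_sum_sum_mul' (p : Fin n → Fin n → ℝ) (q : Fin n → Fin n → Fin n → ℝ) :
    ∑ b, ∑ c, ∑ d, ∑ m, p d m * q m c b = ∑ m, (∑ c, p c m) * ∑ d, ∑ b, q m d b := by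
  rw [← sum_sum_sum_sum_mul]
  exact Finset.sum_congr rfl fun b _ => Finset.sum_comm

end Multilinear

/-! ### Curvature components that are common to the background and the full metric. -/

section KerrSchildWeyl

variable {n : ℕ} {U : Set (EuclideanSpace ℝ (Fin n))} {y : EuclideanSpace ℝ (Fin n)}
  {Gb G : EuclideanSpace ℝ (Fin n) → Matrix (Fin n) (Fin n) ℝ}
  {k : EuclideanSpace ℝ (Fin n) → EuclideanSpace ℝ (Fin n)}
  {H : EuclideanSpace ℝ (Fin n) → ℝ} {f : EuclideanSpace ℝ (Fin n) → ℝ}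
  {X Y Z : EuclideanSpace ℝ (Fin n)}

/-- Only the 1-form `κ` of `v` enters besides `riemannUp`. For `v = k` it is the same for both
metrics, so their Riemann tensors can be subtracted without comparing the lowering of indices. -/
theorem eval₄_riemann_of_lower {κ : Fin n → ℝ} {v : EuclideanSpace ℝ (Fin n)}
    (hv : ∀ e, ∑ a, v a * G y a e = κ e) :
    eval₄ (fun a b c d => riemann G a b c d y) v Z X Y =
      ∑ b, ∑ c, ∑ d, (∑ e, κ e * riemannUp G e b c d y) * (Z b * X c * Y d) := by
  simp only [eval₄, riemann, ← hv]
  refine ((Finset.sum_comm.trans (Finset.sum_congr rfl fun b _ =>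
    (Finset.sum_comm.trans (Finset.sum_congr rfl fun c _ => Finset.sum_comm)))))
      |>.trans ?_
  refine Finset.sum_congr rfl fun b _ => Finset.sum_congr rfl fun c _ =>
    Finset.sum_congr rfl fun d _ => ?_
  simp only [Finset.sum_mul]
  rw [Finset.sum_comm]
  exact Finset.sum_congr rfl fun e _ => Finset.sum_congr rfl fun a _ => by ring

namespace IsLocalKerrSchild

theorem sum_k_mul_metric (h : IsLocalKerrSchild U Gb G k H) (hy : y ∈ U) (i : Fin n) :
    ∑ j, k y j * G y j i = lowerIndex Gb k i y := by
  rw [← h.sum_metric_mul_k hy]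
  exact Finset.sum_congr rfl fun j _ => by rw [h.isLocalMetric.symm y hy j i, mul_comm]

theorem sum_k_mul_background (h : IsLocalKerrSchild U Gb G k H) (hy : y ∈ U) (i : Fin n) :
    ∑ j, k y j * Gb y j i = lowerIndex Gb k i y :=
  Finset.sum_congr rfl fun j _ => by rw [h.background.symm y hy j i, mul_comm]

/-- On `X, Y ⊥ k` the unspecified terms with `P` disappear, leaving only `dκ`, `∇k` and the
connection difference. -/
theorem eval₄_riemann_sub (h : IsLocalKerrSchild U Gb G k H)
    (hf : IsLocalGeodesic U Gb k f) (hy : y ∈ U)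
    (hX : ∑ i, lowerIndex Gb k i y * X i = 0) (hY : ∑ i, lowerIndex Gb k i y * Y i = 0) :
    eval₄ (fun a b c d => riemann G a b c d y) (k y) Z X Y
      - eval₄ (fun a b c d => riemann Gb a b c d y) (k y) Z X Y =
    (∑ b, transportTerm k H f y * (lowerIndex Gb k b y * Z b)) *
      (∑ c, ∑ d, (covDeriv Gb k c d y - covDeriv Gb k d c y) * (X c * Y d))
    - ∑ m, (∑ c, X c * covDeriv Gb k c m y) *
        (∑ d, ∑ b, (christoffel G m d b y - christoffel Gb m d b y) * (Y d * Z b))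
    + ∑ m, (∑ d, Y d * covDeriv Gb k d m y) *
        (∑ c, ∑ b, (christoffel G m c b y - christoffel Gb m c b y) * (X c * Z b)) := by
  obtain ⟨P, hP⟩ := h.sum_lowerIndex_mul_riemannUp_sub hf hy
  rw [eval₄_riemann_of_lower (h.sum_k_mul_metric hy),
    eval₄_riemann_of_lower (h.sum_k_mul_background hy)]
  simp only [← Finset.sum_sub_distrib, ← sub_mul, ← mul_sub, hP]
  have e1 : ∀ b c d,
      (lowerIndex Gb k c y * P d b - lowerIndex Gb k d y * P c b
        + transportTerm k H f y * lowerIndex Gb k b y * (covDeriv Gb k c d y - covDeriv Gb k d c y)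
        - ∑ m, covDeriv Gb k c m y * (christoffel G m d b y - christoffel Gb m d b y)
        + ∑ m, covDeriv Gb k d m y * (christoffel G m c b y - christoffel Gb m c b y))
        * (Z b * X c * Y d) =
      (lowerIndex Gb k c y * X c) * (P d b * (Z b * Y d))
      - (lowerIndex Gb k d y * Y d) * (P c b * (Z b * X c))
      + (transportTerm k H f y * (lowerIndex Gb k b y * Z b))
        * ((covDeriv Gb k c d y - covDeriv Gb k d c y) * (X c * Y d))
      - ∑ m, (X c * covDeriv Gb k c m y)
        * ((christoffel G m d b y - christoffel Gb m d b y) * (Y d * Z b))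
      + ∑ m, (Y d * covDeriv Gb k d m y)
        * ((christoffel G m c b y - christoffel Gb m c b y) * (X c * Z b)) := fun b c d => by
    have e2 : ∑ m, (X c * covDeriv Gb k c m y)
        * ((christoffel G m d b y - christoffel Gb m d b y) * (Y d * Z b)) =
        (∑ m, covDeriv Gb k c m y * (christoffel G m d b y - christoffel Gb m d b y))
          * (Z b * X c * Y d) := by
      rw [Finset.sum_mul]; exact Finset.sum_congr rfl fun _ _ => by ring
    have e3 : ∑ m, (Y d * covDeriv Gb k d m y)
        * ((christoffel G m c b y - christoffel Gb m c b y) * (X c * Z b)) =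
        (∑ m, covDeriv Gb k d m y * (christoffel G m c b y - christoffel Gb m c b y))
          * (Z b * X c * Y d) := by
      rw [Finset.sum_mul]; exact Finset.sum_congr rfl fun _ _ => by ring
    rw [e2, e3]; ring
  simp only [e1, Finset.sum_add_distrib, Finset.sum_sub_distrib]
  rw [sum_sum_sum_mul_2 (fun c => lowerIndex Gb k c y * X c) fun b d => P d b * (Z b * Y d),
    sum_sum_sum_mul_3 (fun d => lowerIndex Gb k d y * Y d) fun b c => P c b * (Z b * X c),
    sum_sum_sum_mul_1 (fun b => transportTerm k H f y * (lowerIndex Gb k b y * Z b))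
      fun c d => (covDeriv Gb k c d y - covDeriv Gb k d c y) * (X c * Y d),
    sum_sum_sum_sum_mul (fun c m => X c * covDeriv Gb k c m y)
      fun m d b => (christoffel G m d b y - christoffel Gb m d b y) * (Y d * Z b),
    sum_sum_sum_sum_mul' (fun d m => Y d * covDeriv Gb k d m y)
      fun m c b => (christoffel G m c b y - christoffel Gb m c b y) * (X c * Z b), hX, hY]
  simp only [zero_mul, zero_add, sub_self]

/-- The `dκ` term has the factor `κ(Z) = 0`. In the others the connection difference yields a
multiple of `k`, which is annihilated by the second index of `∇_b k_c`. -/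
theorem eval₄_riemann_eq_of_orthogonal (h : IsLocalKerrSchild U Gb G k H)
    (hf : IsLocalGeodesic U Gb k f) (hy : y ∈ U)
    (hX : ∑ i, lowerIndex Gb k i y * X i = 0) (hY : ∑ i, lowerIndex Gb k i y * Y i = 0)
    (hZ : ∑ i, lowerIndex Gb k i y * Z i = 0) :
    eval₄ (fun a b c d => riemann G a b c d y) (k y) Z X Y =
      eval₄ (fun a b c d => riemann Gb a b c d y) (k y) Z X Y := by
  rw [← sub_eq_zero, h.eval₄_riemann_sub hf hy hX hY, ← Finset.mul_sum, hZ]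
  have key : ∀ {V W : EuclideanSpace ℝ (Fin n)}, ∑ i, lowerIndex Gb k i y * W i = 0 →
      ∑ m, (∑ c, V c * covDeriv Gb k c m y) *
        (∑ d, ∑ b, (christoffel G m d b y - christoffel Gb m d b y) * (W d * Z b)) = 0 := by
    intro V W hW
    obtain ⟨t, ht⟩ := h.sum_christoffel_sub_orthogonal hy hW hZ
    simp only [ht]
    have : ∀ m, (∑ c, V c * covDeriv Gb k c m y) * (t * k y m) =
        t * ∑ c, V c * (k y m * covDeriv Gb k c m y) := fun m => by
      rw [Finset.sum_mul, Finset.mul_sum]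
      exact Finset.sum_congr rfl fun _ _ => by ring
    simp only [this, ← Finset.mul_sum]
    rw [Finset.sum_comm]
    simp [← Finset.mul_sum, h.sum_covDeriv_mul_k hy]
  rw [key hX, key hY]
  ring

/-- Here `Z` is arbitrary and the three terms vanish separately: `dκ(k,Y) = f κ(Y) = 0`; `∇_k κ = f
κ` applied to `D(Y,Z)` gives `f φ κ(Y) κ(Z) = 0`; and `D(k,Z)` is a multiple of `k`, so `∇_Y κ`
kills it. -/
theorem eval₄_riemann_k_k (h : IsLocalKerrSchild U Gb G k H)
    (hf : IsLocalGeodesic U Gb k f) (hy : y ∈ U)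
    (hY : ∑ i, lowerIndex Gb k i y * Y i = 0) (Z : EuclideanSpace ℝ (Fin n)) :
    eval₄ (fun a b c d => riemann G a b c d y) (k y) Z (k y) Y =
      eval₄ (fun a b c d => riemann Gb a b c d y) (k y) Z (k y) Y := by
  rw [← sub_eq_zero, h.eval₄_riemann_sub hf hy (h.k_null y hy) hY]
  have e1 : ∑ c, ∑ d, (covDeriv Gb k c d y - covDeriv Gb k d c y) * (k y c * Y d) = 0 := by
    have : ∀ c d, (covDeriv Gb k c d y - covDeriv Gb k d c y) * (k y c * Y d) =
      Y d * (k y c * covDeriv Gb k c d y) - Y d * (k y c * covDeriv Gb k d c y) := fun c d => by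
        ring
    rw [Finset.sum_comm]
    simp only [this, Finset.sum_sub_distrib, ← Finset.mul_sum, h.sum_covDeriv_mul_k hy,
      h.sum_k_mul_covDeriv hy (hf.eq y hy)]
    have e2 : ∀ d, Y d * (f y * lowerIndex Gb k d y) = f y * (lowerIndex Gb k d y * Y d) :=
      fun d => by ring
    simp only [e2, ← Finset.mul_sum, hY]
    simp
  have e2 : ∑ m, (∑ c, k y c * covDeriv Gb k c m y) *
      (∑ d, ∑ b, (christoffel G m d b y - christoffel Gb m d b y) * (Y d * Z b)) = 0 := by
    simp only [h.sum_k_mul_covDeriv hy (hf.eq y hy), Finset.mul_sum]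
    refine (Finset.sum_comm.trans (Finset.sum_congr rfl fun d _ => Finset.sum_comm)).trans ?_
    have : ∀ d b m, f y * lowerIndex Gb k m y *
        ((christoffel G m d b y - christoffel Gb m d b y) * (Y d * Z b)) =
        f y * (Y d * Z b) * (lowerIndex Gb k m y *
          (christoffel G m d b y - christoffel Gb m d b y)) := fun d b m => by ring
    simp only [this, ← Finset.mul_sum, h.sum_lowerIndex_mul_christoffel_sub hf hy]
    rw [Finset.sum_comm]
    have : ∀ b d, f y * (Y d * Z b) *
        (transportTerm k H f y * (lowerIndex Gb k d y * lowerIndex Gb k b y)) =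
        f y * Z b * transportTerm k H f y * lowerIndex Gb k b y * (lowerIndex Gb k d y * Y d) :=
      fun b d => by ring
    simp only [this, ← Finset.mul_sum, hY, mul_zero, Finset.sum_const_zero]
  have e3 : ∑ m, (∑ d, Y d * covDeriv Gb k d m y) *
      (∑ c, ∑ b, (christoffel G m c b y - christoffel Gb m c b y) * (k y c * Z b)) = 0 := by
    have e4 : ∀ m, ∑ c, ∑ b, (christoffel G m c b y - christoffel Gb m c b y) * (k y c * Z b) =
        (∑ b, -transportTerm k H f y * lowerIndex Gb k b y * Z b) * k y m := by
      intro m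
      have : ∀ b c, (christoffel G m c b y - christoffel Gb m c b y) * (k y c * Z b) =
        Z b * (k y c * (christoffel G m c b y - christoffel Gb m c b y)) := fun b c => by ring
      rw [Finset.sum_comm]
      simp only [this, ← Finset.mul_sum, h.sum_christoffel_sub_mul_k hf hy, Finset.sum_mul]
      exact Finset.sum_congr rfl fun _ _ => by ring
    simp only [e4]
    generalize (∑ b, -transportTerm k H f y * lowerIndex Gb k b y * Z b) = t
    have : ∀ m, (∑ d, Y d * covDeriv Gb k d m y) * (t * k y m) =
        t * ∑ d, Y d * (k y m * covDeriv Gb k d m y) := fun m => by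
      rw [Finset.sum_mul, Finset.mul_sum]
      exact Finset.sum_congr rfl fun _ _ => by ring
    simp only [this, ← Finset.mul_sum]
    rw [Finset.sum_comm]
    simp [← Finset.mul_sum, h.sum_covDeriv_mul_k hy]
  rw [e1, e2, e3]
  ring

end IsLocalKerrSchild

/-! ### Ricci and Weyl tensors as multilinear forms. -/

namespace IsLocalMetric

theorem eval₂_ricci (h : IsLocalMetric U G) (hy : y ∈ U) (v w : EuclideanSpace ℝ (Fin n)) :
    eval₂ (fun b d => ricci G b d y) v w =
      ∑ a, ∑ c, (G y)⁻¹ a c * eval₄ (fun a b c d => riemann G a b c d y)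
        (EuclideanSpace.single c 1) v (EuclideanSpace.single a 1) w := by
  simp only [eval₂, h.ricci_eq hy, eval₄_single_single, Finset.sum_mul, Finset.mul_sum]
  refine ((Finset.sum_congr rfl fun b _ => (Finset.sum_comm.trans
    (Finset.sum_congr rfl fun a _ => Finset.sum_comm))).trans Finset.sum_comm).trans ?_
  refine Finset.sum_congr rfl fun a _ => ?_
  rw [Finset.sum_comm]
  exact Finset.sum_congr rfl fun c _ => Finset.sum_congr rfl fun b _ =>
    Finset.sum_congr rfl fun d _ => by ring

end IsLocalMetric

theorem eval₄_weyl (v w x z : EuclideanSpace ℝ (Fin n)) :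
    eval₄ (fun a b c d => weyl G a b c d y) v w x z =
      eval₄ (fun a b c d => riemann G a b c d y) v w x z
      - (1 / ((n : ℝ) - 2)) *
        (eval₂ (fun a b => G y a b) v x * eval₂ (fun b d => ricci G b d y) w z
          - eval₂ (fun a b => G y a b) v z * eval₂ (fun b d => ricci G b d y) w x
          - eval₂ (fun a b => G y a b) w x * eval₂ (fun b d => ricci G b d y) v z
          + eval₂ (fun a b => G y a b) w z * eval₂ (fun b d => ricci G b d y) v x)
      + (scalarCurvature G y / (((n : ℝ) - 1) * ((n : ℝ) - 2))) *
        (eval₂ (fun a b => G y a b) v x * eval₂ (fun a b => G y a b) w z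
          - eval₂ (fun a b => G y a b) v z * eval₂ (fun a b => G y a b) w x) := by
  rw [mul_comm (eval₂ (fun a b => G y a b) w x) (eval₂ (fun b d => ricci G b d y) v z),
    mul_comm (eval₂ (fun a b => G y a b) w z) (eval₂ (fun b d => ricci G b d y) v x)]
  simp only [← eval₂_mul_eval₂ _ _ v w x z, ← eval₂_mul_eval₂' _ _ v w x z]
  simp only [eval₄, weyl, Finset.mul_sum, ← Finset.sum_sub_distrib, ← Finset.sum_add_distrib]
  exact Finset.sum_congr rfl fun a _ => Finset.sum_congr rfl fun b _ =>
    Finset.sum_congr rfl fun c _ => Finset.sum_congr rfl fun d _ => by ring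

namespace IsLocalKerrSchild

/-- The trace of `R(k,z,x,Y)` over `z, x`. The extra `2H k ⊗ k` in the inverse metric is killed by
antisymmetry, and the background trace of the difference only meets pairs for which the two Riemann
tensors agree. -/
theorem eval₂_ricci_k_eq (h : IsLocalKerrSchild U Gb G k H)
    (hf : IsLocalGeodesic U Gb k f) (hy : y ∈ U) {u : EuclideanSpace ℝ (Fin n)}
    (hu : ∑ i, lowerIndex Gb k i y * u i = 1)
    (hY : ∑ i, lowerIndex Gb k i y * Y i = 0) :
    eval₂ (fun b d => ricci G b d y) (k y) Y = eval₂ (fun b d => ricci Gb b d y) (k y) Y := by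
  have hG := h.isLocalMetric
  have hB := h.background
  rw [hG.eval₂_ricci hy, hB.eval₂_ricci hy]
  simp only [eval₄_antisymm_left (hG.riemann_antisymm_left hy) _ (k y),
    eval₄_antisymm_left (hB.riemann_antisymm_left hy) _ (k y), ← eval₄Lin_apply]
  set A := eval₄Lin (fun a b c d => riemann G a b c d y) (k y) Y with hA
  set B := eval₄Lin (fun a b c d => riemann Gb a b c d y) (k y) Y with hBdef
  have hAk : ∀ x, A (k y) x = 0 := fun x => by
    have := eval₄_antisymm_left (hG.riemann_antisymm_left hy) (k y) (k y) x Y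
    rw [hA, eval₄Lin_apply]; linarith
  have hBk : ∀ x, B (k y) x = 0 := fun x => by
    have := eval₄_antisymm_left (hB.riemann_antisymm_left hy) (k y) (k y) x Y
    rw [hBdef, eval₄Lin_apply]; linarith
  set D := A - B with hD
  have hDk : ∀ x, D (k y) x = 0 := fun x => by
    rw [hD, LinearMap.sub_apply, LinearMap.sub_apply, hAk, hBk, sub_self]
  have hDk' : ∀ z, D z (k y) = 0 := fun z => by
    rw [hD, LinearMap.sub_apply, LinearMap.sub_apply, hA, hBdef, eval₄Lin_apply, eval₄Lin_apply,
      h.eval₄_riemann_k_k hf hy hY, sub_self]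
  have hDo : ∀ x z : EuclideanSpace ℝ (Fin n), ∑ i, lowerIndex Gb k i y * x i = 0 →
      ∑ i, lowerIndex Gb k i y * z i = 0 → D z x = 0 := fun x z hx hz => by
    rw [hD, LinearMap.sub_apply, LinearMap.sub_apply, hA, hBdef, eval₄Lin_apply, eval₄Lin_apply,
      h.eval₄_riemann_eq_of_orthogonal hf hy hx hY hz, sub_self]
  -- Subtracting `κ_a u` projects coordinate vectors to the orthogonal complement of `k`, where the
  -- difference `D` vanishes.
  have hproj : ∀ a : Fin n, ∑ i, lowerIndex Gb k i y *
      (EuclideanSpace.single a (1 : ℝ) - lowerIndex Gb k a y • u) i = 0 := by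
    intro a
    have : ∀ i, lowerIndex Gb k i y *
      (EuclideanSpace.single a (1 : ℝ) - lowerIndex Gb k a y • u) i =
      lowerIndex Gb k i y * (if i = a then 1 else 0)
        - lowerIndex Gb k a y * (lowerIndex Gb k i y * u i) := fun i => by
      simp only [PiLp.sub_apply, PiLp.smul_apply, smul_eq_mul, PiLp.single_apply]; ring
    simp only [this, Finset.sum_sub_distrib, ← Finset.mul_sum, hu]
    simp
  have hDe : ∀ a c : Fin n, D (EuclideanSpace.single c 1) (EuclideanSpace.single a 1) =
      lowerIndex Gb k c y * D u (EuclideanSpace.single a 1)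
      + lowerIndex Gb k a y * D (EuclideanSpace.single c 1) u
      - lowerIndex Gb k c y * lowerIndex Gb k a y * D u u := by
    intro a c
    have := hDo _ _ (hproj a) (hproj c)
    simp only [map_sub, LinearMap.sub_apply, map_smul, LinearMap.smul_apply, smul_eq_mul] at this
    linarith
  have hinv : ∀ m, ∑ a, (Gb y)⁻¹ m a * lowerIndex Gb k a y = k y m := fun m =>
    hB.sum_inv_sum_mul hy m fun j => k y j
  -- After `hDe` each term has a factor `κ`, which the inverse metric raises to `k`; then `D(k,·) =
  -- 0`, `D(·,k) = 0` and nullness finish.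
  have t1 : ∑ a, ∑ c, (Gb y)⁻¹ a c * D (EuclideanSpace.single c 1) (EuclideanSpace.single a 1)
      = 0 := by
    have e1 : ∀ a c, (Gb y)⁻¹ a c * D (EuclideanSpace.single c 1) (EuclideanSpace.single a 1) =
        (D u (EuclideanSpace.single a 1) - lowerIndex Gb k a y * D u u)
          * ((Gb y)⁻¹ a c * lowerIndex Gb k c y)
        + ((Gb y)⁻¹ c a * lowerIndex Gb k a y) * D (EuclideanSpace.single c 1) u := fun a c => by
      rw [hDe, hB.inv_symm hy a c]; ring
    simp only [e1, Finset.sum_add_distrib, ← Finset.mul_sum, hinv]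
    rw [Finset.sum_comm]
    simp only [← Finset.sum_mul, hinv]
    have e2 : ∑ c, k y c * D (EuclideanSpace.single c 1) u = 0 := by
      rw [← hDk u]
      exact (linearMap_eq_sum (D.flip u) (k y)).symm
    have e3 : ∑ a, k y a * D u (EuclideanSpace.single a 1) = 0 := by
      rw [← hDk' u]
      exact (linearMap_eq_sum (D u) (k y)).symm
    have e4 : ∀ a, (D u (EuclideanSpace.single a 1) - lowerIndex Gb k a y * D u u) * k y a =
      k y a * D u (EuclideanSpace.single a 1) - D u u * (lowerIndex Gb k a y * k y a) :=
      fun a => by ring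
    simp only [e2, e4, Finset.sum_sub_distrib, e3, ← Finset.mul_sum, h.k_null y hy]
    simp
  have t2 : ∑ a, ∑ c, 2 * H y * (k y a * k y c)
      * A (EuclideanSpace.single c 1) (EuclideanSpace.single a 1) = 0 := by
    have e1 : ∀ a c, 2 * H y * (k y a * k y c)
        * A (EuclideanSpace.single c 1) (EuclideanSpace.single a 1) =
        2 * H y * k y a * (k y c * A (EuclideanSpace.single c 1) (EuclideanSpace.single a 1)) :=
      fun a c => by ring
    have e2 : ∀ a, ∑ c, k y c * A (EuclideanSpace.single c 1) (EuclideanSpace.single a 1) = 0 :=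
      fun a => by
        rw [← hAk (EuclideanSpace.single a 1)]
        exact (linearMap_eq_sum (A.flip (EuclideanSpace.single a 1)) (k y)).symm
    simp only [e1, ← Finset.mul_sum, e2, mul_zero, Finset.sum_const_zero]
  have e1 : ∀ a c, (G y)⁻¹ a c * -A (EuclideanSpace.single c 1) (EuclideanSpace.single a 1) =
      (Gb y)⁻¹ a c * -B (EuclideanSpace.single c 1) (EuclideanSpace.single a 1)
      - (Gb y)⁻¹ a c * D (EuclideanSpace.single c 1) (EuclideanSpace.single a 1)
      - 2 * H y * (k y a * k y c)
        * A (EuclideanSpace.single c 1) (EuclideanSpace.single a 1) := fun a c => by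
    rw [h.inv_eq hy, hD, LinearMap.sub_apply, LinearMap.sub_apply]; ring
  simp only [e1, Finset.sum_sub_distrib, t1, t2, sub_zero]

theorem eval₂_background_k (h : IsLocalKerrSchild U Gb G k H) (hy : y ∈ U)
    (v : EuclideanSpace ℝ (Fin n)) :
    eval₂ (fun a b => Gb y a b) (k y) v = ∑ i, lowerIndex Gb k i y * v i := by
  rw [eval₂, Finset.sum_comm]
  simp only [← h.sum_k_mul_background hy, Finset.sum_mul]
  exact Finset.sum_congr rfl fun _ _ => Finset.sum_congr rfl fun _ _ => by ring

theorem eval₂_metric (h : IsLocalKerrSchild U Gb G k H) (hy : y ∈ U)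
    (v w : EuclideanSpace ℝ (Fin n)) :
    eval₂ (fun a b => G y a b) v w = eval₂ (fun a b => Gb y a b) v w
      - 2 * H y * (∑ i, lowerIndex Gb k i y * v i) * (∑ i, lowerIndex Gb k i y * w i) := by
  simp only [eval₂, Finset.mul_sum, Finset.sum_mul]
  rw [Finset.sum_comm (f := fun i i_1 => 2 * H y * (lowerIndex Gb k i_1 y * v i_1) *
    (lowerIndex Gb k i y * w i))]
  simp only [← Finset.sum_sub_distrib]
  exact Finset.sum_congr rfl fun _ _ => Finset.sum_congr rfl fun _ _ => by
    rw [h.metric_eq y hy]; ring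

/-- Since `g(k,X) = g(k,Y) = 0`, the scalar curvature drops out and the Ricci part only contains
`Ric(k,X)` and `Ric(k,Y)`, with coefficients `g(Z,Y)` and `g(Z,X)` that are unaffected by `H`. -/
theorem eval₄_weyl_eq (h : IsLocalKerrSchild U Gb G k H)
    (hf : IsLocalGeodesic U Gb k f) (hy : y ∈ U) {u : EuclideanSpace ℝ (Fin n)}
    (hu : ∑ i, lowerIndex Gb k i y * u i = 1)
    (hX : eval₂ (fun a b => Gb y a b) (k y) X = 0) (hY : eval₂ (fun a b => Gb y a b) (k y) Y = 0)
    (hZ : eval₂ (fun a b => Gb y a b) (k y) Z = 0 ∨ X = k y) :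
    eval₄ (fun a b c d => weyl G a b c d y) (k y) Z X Y =
      eval₄ (fun a b c d => weyl Gb a b c d y) (k y) Z X Y := by
  rw [eval₄_weyl, eval₄_weyl]
  simp only [h.eval₂_metric hy, hX, hY]
  rw [h.eval₂_background_k hy] at hX hY
  have hR : eval₄ (fun a b c d => riemann G a b c d y) (k y) Z X Y =
      eval₄ (fun a b c d => riemann Gb a b c d y) (k y) Z X Y := by
    rcases hZ with hZ | rfl
    · rw [h.eval₂_background_k hy] at hZ
      exact h.eval₄_riemann_eq_of_orthogonal hf hy hX hY hZ
    · exact h.eval₄_riemann_k_k hf hy hY Z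
  rw [hR, h.eval₂_ricci_k_eq hf hy hu hX, h.eval₂_ricci_k_eq hf hy hu hY, hX, hY]
  ring

end IsLocalKerrSchild

end KerrSchildWeyl

/-! ### Null frames and the filtration of the tangent space by boost weight. -/

section Frames

variable {n : ℕ} {M : Type*} [TopologicalSpace M] [ChartedSpace (EuclideanSpace ℝ (Fin n)) M]
  {g : BilinField n M} {p : M}

theorem finrank_tangentSpace : Module.finrank ℝ (TangentSpace (𝓡 n) p) = n :=
  finrank_euclideanSpace_fin

instance : FiniteDimensional ℝ (TangentSpace (𝓡 n) p) :=
  inferInstanceAs (FiniteDimensional ℝ (EuclideanSpace ℝ (Fin n)))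

theorem tendsto_coords {Q : Type*} {F : Filter Q} {p : M} {v : Q → TangentSpace (𝓡 n) p}
    {v₀ : TangentSpace (𝓡 n) p} (h : Tendsto v F (𝓝 v₀)) (a : Fin n) :
    Tendsto (fun μ => coords (v μ) a) F (𝓝 (coords v₀ a)) :=
  ((EuclideanSpace.proj (𝕜 := ℝ) a).continuous.tendsto (coords v₀)).comp h

theorem linearIndependent_of_dual {ι V : Type*} [Fintype ι] [DecidableEq ι] [AddCommGroup V]
    [Module ℝ V] {m : ι → V} {φ : ι → V →ₗ[ℝ] ℝ}
    (h : ∀ i j, φ j (m i) = if i = j then 1 else 0) : LinearIndependent ℝ m := by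
  rw [Fintype.linearIndependent_iff]
  intro c hc j
  simpa [map_sum, h] using congrArg (φ j) hc

/-- The involution exchanging the indices `0` and `1`. -/
def nullPartner (a : Fin n) : Fin n :=
  if h : 2 ≤ n then Equiv.swap ⟨0, by omega⟩ ⟨1, by omega⟩ a else a

/-- Exchanging the two null legs gives the dual basis; this yields linear independence and the frame
coefficients of a vector. -/
theorem isNullFrame_dual (hn : 2 ≤ n) {m : Fin n → TangentSpace (𝓡 n) p}
    (hm : IsNullFrame g p m) (i j : Fin n) :
    g p (m (nullPartner j)) (m i) = if i = j then 1 else 0 := by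
  rw [hm]
  simp only [nullPartner, hn, dif_pos, Equiv.swap_apply_def, Fin.ext_iff]
  split_ifs <;> first | rfl | (exfalso; simp_all; try omega)

theorem IsNullFrame.linearIndependent (hn : 2 ≤ n) {m : Fin n → TangentSpace (𝓡 n) p}
    (hm : IsNullFrame g p m) : LinearIndependent ℝ m :=
  linearIndependent_of_dual (φ := fun j => (g p (m (nullPartner j))).toLinearMap)
    fun i j => isNullFrame_dual hn hm i j

theorem IsNullFrame.eq_sum (hn : 2 ≤ n) {m : Fin n → TangentSpace (𝓡 n) p}
    (hm : IsNullFrame g p m) (v : TangentSpace (𝓡 n) p) :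
    v = ∑ a, g p (m (nullPartner a)) v • m a := by
  have : Nonempty (Fin n) := ⟨⟨0, by omega⟩⟩
  have hc : Fintype.card (Fin n) = Module.finrank ℝ (TangentSpace (𝓡 n) p) := by
    rw [finrank_tangentSpace, Fintype.card_fin]
  have hb := (basisOfLinearIndependentOfCardEqFinrank (hm.linearIndependent hn) hc).sum_repr v
  simp only [coe_basisOfLinearIndependentOfCardEqFinrank] at hb
  set r := (basisOfLinearIndependentOfCardEqFinrank (hm.linearIndependent hn) hc).repr v
  have : ∀ a, g p (m (nullPartner a)) v = r a := fun a => by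
    conv_lhs => rw [← hb]
    simp [map_sum, isNullFrame_dual hn hm]
  simp only [this]
  exact hb.symm

/-- The filtration of the tangent space by boost weight given by a null vector `l`. -/
noncomputable def boostFiltration (g : BilinField n M) (p : M) (l : TangentSpace (𝓡 n) p) (w : ℤ) :
    Submodule ℝ (TangentSpace (𝓡 n) p) :=
  if 0 < w then Submodule.span ℝ {l} else if w = 0 then LinearMap.ker (g p l).toLinearMap else ⊤

theorem boostFiltration_one (l : TangentSpace (𝓡 n) p) :
    boostFiltration g p l 1 = Submodule.span ℝ {l} := by simp [boostFiltration]

theorem mem_boostFiltration_zero {l v : TangentSpace (𝓡 n) p} :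
    v ∈ boostFiltration g p l 0 ↔ g p l v = 0 := by simp [boostFiltration]

theorem boostFiltration_neg_one (l : TangentSpace (𝓡 n) p) :
    boostFiltration g p l (-1) = ⊤ := by simp [boostFiltration]

theorem boostWeight_mem (a : Fin n) :
    boostWeight a = -1 ∨ boostWeight a = 0 ∨ boostWeight a = 1 := by
  unfold boostWeight; split_ifs <;> simp

theorem mem_boostFiltration_frame (hn : 2 ≤ n) {m : Fin n → TangentSpace (𝓡 n) p}
    (hm : IsNullFrame g p m) {l : TangentSpace (𝓡 n) p} (hl : ∀ a : Fin n, a.val = 0 → m a = l)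
    (a : Fin n) : m a ∈ boostFiltration g p l (boostWeight a) := by
  have hl0 : m ⟨0, by omega⟩ = l := hl _ rfl
  unfold boostWeight
  split_ifs with h0 h1
  · rw [boostFiltration_one, hl a h0]; exact Submodule.mem_span_singleton_self l
  · rw [boostFiltration_neg_one]; trivial
  · rw [mem_boostFiltration_zero, ← hl0, hm, if_neg]
    simp only [Fin.ext_iff]; omega

/-- For weight `0`: the coefficient of `m 1` in a vector is its product with `m 0 = l`, so it
vanishes on the orthogonal complement of `l`. -/
theorem boostFiltration_le_span (hn : 2 ≤ n) {m : Fin n → TangentSpace (𝓡 n) p}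
    (hm : IsNullFrame g p m) {l : TangentSpace (𝓡 n) p} (hl : ∀ a : Fin n, a.val = 0 → m a = l)
    {w : ℤ} (hw : w = -1 ∨ w = 0 ∨ w = 1) :
    boostFiltration g p l w ≤ Submodule.span ℝ {v | ∃ a, w ≤ boostWeight a ∧ v = m a} := by
  have hl0 : m ⟨0, by omega⟩ = l := hl _ rfl
  intro v hv
  rcases hw with rfl | rfl | rfl
  · rw [hm.eq_sum hn v]
    refine Submodule.sum_mem _ fun a _ => Submodule.smul_mem _ _ (Submodule.subset_span ⟨a, ?_, rfl⟩)
    rcases boostWeight_mem a with h | h | h <;> omega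
  · rw [mem_boostFiltration_zero] at hv
    rw [hm.eq_sum hn v]
    refine Submodule.sum_mem _ fun a _ => ?_
    by_cases ha : a.val = 1
    · have : nullPartner a = ⟨0, by omega⟩ := by
        have : a = ⟨1, by omega⟩ := Fin.ext ha
        rw [this]
        simp [nullPartner, hn]
      rw [this, hl0, hv, zero_smul]
      exact Submodule.zero_mem _
    · refine Submodule.smul_mem _ _ (Submodule.subset_span ⟨a, ?_, rfl⟩)
      unfold boostWeight; split_ifs <;> simp
  · rw [boostFiltration_one] at hv
    refine Submodule.span_le.2 ?_ hv
    rintro _ rfl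
    exact Submodule.subset_span ⟨⟨0, by omega⟩, by simp [boostWeight], hl0.symm⟩

/-! ### Null frames from Lorentzian signature. -/

section Lorentz

theorem lorentz_apply_self {b : Module.Basis (Fin n) ℝ (TangentSpace (𝓡 n) p)}
    (hb : ∀ i j, g p (b i) (b j) = if i = j then (if i.val = 0 then -1 else 1) else 0)
    (u : TangentSpace (𝓡 n) p) :
    g p u u = ∑ i : Fin n, (if i.val = 0 then -1 else 1) * b.repr u i ^ 2 := by
  have hu := b.sum_repr u
  conv_lhs => rw [← hu]
  simp only [map_sum, sum_apply, map_smul, smul_apply,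
    smul_eq_mul, hb]
  refine Finset.sum_congr rfl fun i _ => ?_
  rw [Finset.sum_eq_single i]
  · rw [if_pos rfl]; ring
  · intro j _ hj; simp [hj]
  · simp

theorem lorentz_nonneg_of_spacelike {b : Module.Basis (Fin n) ℝ (TangentSpace (𝓡 n) p)}
    (hb : ∀ i j, g p (b i) (b j) = if i = j then (if i.val = 0 then -1 else 1) else 0)
    {u : TangentSpace (𝓡 n) p} (hu : ∀ i : Fin n, i.val = 0 → b.repr u i = 0) :
    0 ≤ g p u u := by
  rw [lorentz_apply_self hb]
  refine Finset.sum_nonneg fun i _ => ?_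
  by_cases hi : i.val = 0
  · simp [hu i hi]
  · simp [hi, sq_nonneg]

/-- The orthogonal complement of a hyperbolic plane is positive definite. -/
theorem IsLorentzAt.pos_of_orthogonal (hg : IsLorentzAt g p) (hn : 1 ≤ n)
    {l k v : TangentSpace (𝓡 n) p} (hl : g p l l = 0) (hk : g p k k = 0) (hlk : g p l k = 1)
    (hlv : g p l v = 0) (hkv : g p k v = 0) (hv : v ≠ 0) : 0 < g p v v := by
  obtain ⟨hs, b, hb⟩ := hg
  by_contra hneg
  push Not at hneg
  set i₀ : Fin n := ⟨0, by omega⟩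
  have hi₀ : ∀ i : Fin n, i.val = 0 → i = i₀ := fun i hi => Fin.ext hi
  -- `t` is timelike and orthogonal to `v`. The combination `u` of `t` and `v` below has no
  -- component along the timelike basis vector, hence `g(u,u) ≥ 0`; this is incompatible with
  -- `g(v,v) ≤ 0` unless `v = 0`.
  set t := l - k with ht
  have htt : g p t t = -2 := by
    rw [ht]
    simp only [map_sub, sub_apply, hl, hk, hlk, hs k l]; norm_num
  have htv : g p t v = 0 := by
    rw [ht]; simp only [map_sub, sub_apply, hlv, hkv]; norm_num
  have hct : b.repr t i₀ ≠ 0 := by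
    intro h0
    have := lorentz_nonneg_of_spacelike hb (u := t) fun i hi => by rw [hi₀ i hi, h0]
    linarith
  set u := b.repr v i₀ • t - b.repr t i₀ • v with hu
  have hu0 : ∀ i : Fin n, i.val = 0 → b.repr u i = 0 := fun i hi => by
    rw [hi₀ i hi, hu]; simp [mul_comm]
  have huu : g p u u = -2 * b.repr v i₀ ^ 2 + b.repr t i₀ ^ 2 * g p v v := by
    rw [hu]
    simp only [map_sub, map_smul, sub_apply, smul_apply,
      smul_eq_mul, htt, htv, hs v t]
    ring
  have hnn := lorentz_nonneg_of_spacelike hb hu0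
  have h1 : b.repr t i₀ ^ 2 * g p v v ≤ 0 :=
    mul_nonpos_of_nonneg_of_nonpos (sq_nonneg _) hneg
  have h2 : b.repr v i₀ = 0 := by
    have : b.repr v i₀ ^ 2 ≤ 0 := by linarith [sq_nonneg (b.repr v i₀)]
    exact pow_eq_zero_iff (two_ne_zero) |>.1 (le_antisymm this (sq_nonneg _))
  have h3 : g p v v = 0 := by
    have : b.repr t i₀ ^ 2 * g p v v = 0 := by
      rw [huu, h2] at hnn; linarith
    exact (mul_eq_zero.1 this).resolve_left (pow_ne_zero 2 hct)
  apply hv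
  rw [lorentz_apply_self hb] at h3
  have h4 : ∀ i : Fin n, (if i.val = 0 then (-1 : ℝ) else 1) * b.repr v i ^ 2 = 0 := by
    have := (Finset.sum_eq_zero_iff_of_nonneg (s := Finset.univ)
      (f := fun i : Fin n => (if i.val = 0 then (-1 : ℝ) else 1) * b.repr v i ^ 2) ?_).1 h3
    · exact fun i => this i (Finset.mem_univ i)
    · intro i _
      by_cases hi : i.val = 0
      · rw [hi₀ i hi, h2]; simp
      · simp [hi, sq_nonneg]
  refine b.ext_elem fun i => ?_
  have := h4 i
  split_ifs at this <;> simpa using this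

/-- The common orthogonal complement of `l` and `k` has dimension `n - 2` and is positive definite
by hypothesis; normalizing an orthogonal basis of it supplies the transverse legs. -/
theorem exists_nullFrame_of_pos (hs : ∀ v w, g p v w = g p w v) (hn : 2 ≤ n)
    {l k : TangentSpace (𝓡 n) p} (hl : g p l l = 0) (hk : g p k k = 0) (hlk : g p l k = 1)
    (hpos : ∀ v, g p l v = 0 → g p k v = 0 → v ≠ 0 → 0 < g p v v) :
    ∃ m, IsNullFrame g p m ∧ ∀ a : Fin n, a.val = 0 → m a = l := by
  set F : TangentSpace (𝓡 n) p →ₗ[ℝ] ℝ × ℝ :=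
    (g p l).toLinearMap.prod (g p k).toLinearMap with hF
  have hFa : ∀ v, F v = (g p l v, g p k v) := fun v => rfl
  have hFs : LinearMap.range F = ⊤ := by
    rw [LinearMap.range_eq_top]
    rintro ⟨x, y⟩
    refine ⟨x • k + y • l, ?_⟩
    rw [hFa]
    simp [hl, hk, hlk, hs k l]
  have hrank : Module.finrank ℝ (LinearMap.ker F) = n - 2 := by
    have := LinearMap.finrank_range_add_finrank_ker F
    rw [hFs, finrank_top, finrank_tangentSpace] at this
    simp at this
    omega
  set B : LinearMap.BilinForm ℝ (LinearMap.ker F) :=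
    LinearMap.mk₂ ℝ (fun v w => g p (v : TangentSpace (𝓡 n) p) (w : TangentSpace (𝓡 n) p))
      (by intros; simp) (by intros; simp) (by intros; simp) (by intros; simp) with hB
  have hBa : ∀ v w : LinearMap.ker F, B v w = g p (v : TangentSpace (𝓡 n) p) w := fun _ _ => rfl
  obtain ⟨e, he⟩ := LinearMap.BilinForm.exists_orthogonal_basis (B := B)
    ⟨fun v w => by simp only [hBa, RingHom.id_apply]; exact hs _ _⟩
  have hk0 : ∀ i, g p l (e i : TangentSpace (𝓡 n) p) = 0 ∧
      g p k (e i : TangentSpace (𝓡 n) p) = 0 := fun i => by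
    have := (e i).2
    rw [LinearMap.mem_ker, hFa, Prod.mk_eq_zero] at this
    exact this
  have hep : ∀ i, 0 < g p (e i : TangentSpace (𝓡 n) p) (e i : TangentSpace (𝓡 n) p) := fun i =>
    hpos _ (hk0 i).1 (hk0 i).2 fun h => e.ne_zero i (Subtype.ext h)
  set E : Fin (Module.finrank ℝ (LinearMap.ker F)) → TangentSpace (𝓡 n) p := fun i =>
    (Real.sqrt (g p (e i : TangentSpace (𝓡 n) p) (e i : TangentSpace (𝓡 n) p)))⁻¹ •
      (e i : TangentSpace (𝓡 n) p) with hE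
  have hEE : ∀ i j, g p (E i) (E j) = if i = j then 1 else 0 := by
    intro i j
    simp only [hE, map_smul, smul_apply, smul_eq_mul]
    split_ifs with hij
    · subst hij
      have h1 := Real.mul_self_sqrt (hep i).le
      have h2 := (Real.sqrt_pos.2 (hep i)).ne'
      field_simp
      rw [sq, h1]
    · have : B (e i) (e j) = 0 := he hij
      rw [hBa] at this
      rw [this]; simp
  have hlE : ∀ i, g p l (E i) = 0 := fun i => by simp [hE, (hk0 i).1]
  have hkE : ∀ i, g p k (E i) = 0 := fun i => by simp [hE, (hk0 i).2]
  refine ⟨fun a => if h0 : a.val = 0 then l else if h1 : a.val = 1 then k else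
    E ⟨a.val - 2, by omega⟩, fun a b => ?_, fun a ha => by simp [ha]⟩
  by_cases a0 : a.val = 0 <;> by_cases a1 : a.val = 1 <;> by_cases b0 : b.val = 0 <;>
    by_cases b1 : b.val = 1 <;> try omega
  all_goals simp only [a0, a1, b0, b1, dif_pos, dif_neg, not_false_eq_true, one_ne_zero]
  all_goals simp [hl, hk, hlk, hlE, hkE, hs k l, hs (E _) l, hs (E _) k, hEE, Fin.ext_iff, a0, a1,
    b0, b1]
  exact if_congr (by omega) rfl rfl

theorem IsLorentzAt.eq_zero_of_forall (hg : IsLorentzAt g p) {k : TangentSpace (𝓡 n) p}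
    (h : ∀ v, g p v k = 0) : k = 0 := by
  obtain ⟨hs, b, hb⟩ := hg
  refine b.ext_elem fun i => ?_
  have h1 := h (b i)
  rw [← b.sum_repr k] at h1
  simp only [map_sum, map_smul, smul_eq_mul, hb] at h1
  rw [Finset.sum_eq_single i (fun j _ hj => by simp [hj.symm]) (by simp), if_pos rfl] at h1
  split_ifs at h1 <;> simpa using h1

/-- Nondegeneracy gives `v'` with `v' · k = 1`; adding a multiple of the null vector `k` makes it
null without changing this product. -/
theorem IsLorentzAt.exists_partner (hg : IsLorentzAt g p) {k : TangentSpace (𝓡 n) p}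
    (hk : g p k k = 0) (hk0 : k ≠ 0) : ∃ l, g p l l = 0 ∧ g p l k = 1 := by
  have hs := hg.1
  have : ∃ v, g p v k ≠ 0 := by
    by_contra h
    push Not at h
    exact hk0 (hg.eq_zero_of_forall h)
  obtain ⟨v, hv⟩ := this
  set v' := (g p v k)⁻¹ • v with hv'
  have h1 : g p v' k = 1 := by simp [hv', hv]
  refine ⟨v' - (g p v' v' / 2) • k, ?_, ?_⟩
  · simp only [map_sub, map_smul, sub_apply, smul_apply,
      smul_eq_mul, hk, h1, hs k v']
    ring
  · simp [hk, h1]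

end Lorentz

end Frames

/-! ### Frame-independent form of the WAND conditions. -/

section Alignment

variable {n : ℕ} {M : Type*} [TopologicalSpace M] [ChartedSpace (EuclideanSpace ℝ (Fin n)) M]
  [IsManifold (𝓡 n) ∞ M] {g : BilinField n M} {p : M} {l : TangentSpace (𝓡 n) p}

theorem weylAt_eq_eval₄ (v w x z : TangentSpace (𝓡 n) p) :
    weylAt g p v w x z =
      eval₄ (fun a b c d => weyl (coordMetric g p) a b c d (extChartAt (𝓡 n) p p)) v w x z := rfl

theorem weylAt_eq_zero_of_span {S₁ S₂ S₃ S₄ : Set (TangentSpace (𝓡 n) p)}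
    (h : ∀ v ∈ S₁, ∀ w ∈ S₂, ∀ x ∈ S₃, ∀ z ∈ S₄, weylAt g p v w x z = 0)
    {v w x z : TangentSpace (𝓡 n) p} (hv : v ∈ Submodule.span ℝ S₁)
    (hw : w ∈ Submodule.span ℝ S₂) (hx : x ∈ Submodule.span ℝ S₃)
    (hz : z ∈ Submodule.span ℝ S₄) : weylAt g p v w x z = 0 :=
  eval₄_eq_zero_of_span h hv hw hx hz

/-- Alignment does not depend on the null frame. -/
theorem alignedToOrder_iff (hn : 2 ≤ n) {r : ℕ} :
    AlignedToOrder g p l r ↔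
      (∃ m, IsNullFrame g p m ∧ ∀ a : Fin n, a.val = 0 → m a = l) ∧
      ∀ i j s t : ℤ, (i = -1 ∨ i = 0 ∨ i = 1) → (j = -1 ∨ j = 0 ∨ j = 1) →
        (s = -1 ∨ s = 0 ∨ s = 1) → (t = -1 ∨ t = 0 ∨ t = 1) → 2 - (r : ℤ) < i + j + s + t →
        ∀ v ∈ boostFiltration g p l i, ∀ w ∈ boostFiltration g p l j,
        ∀ x ∈ boostFiltration g p l s, ∀ z ∈ boostFiltration g p l t,
          weylAt g p v w x z = 0 := by
  constructor
  · rintro ⟨m, hm, hl, h⟩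
    refine ⟨⟨m, hm, hl⟩, fun i j s t hi hj hs ht hw v hv w hw' x hx z hz => ?_⟩
    refine weylAt_eq_zero_of_span ?_ (boostFiltration_le_span hn hm hl hi hv)
      (boostFiltration_le_span hn hm hl hj hw') (boostFiltration_le_span hn hm hl hs hx)
      (boostFiltration_le_span hn hm hl ht hz)
    rintro _ ⟨a, ha, rfl⟩ _ ⟨b, hb, rfl⟩ _ ⟨c, hc, rfl⟩ _ ⟨d, hd, rfl⟩
    exact h a b c d (by omega)
  · rintro ⟨⟨m, hm, hl⟩, h⟩
    refine ⟨m, hm, hl, fun a b c d hw => ?_⟩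
    exact h _ _ _ _ (boostWeight_mem a) (boostWeight_mem b) (boostWeight_mem c)
      (boostWeight_mem d) hw _ (mem_boostFiltration_frame hn hm hl a)
      _ (mem_boostFiltration_frame hn hm hl b) _ (mem_boostFiltration_frame hn hm hl c)
      _ (mem_boostFiltration_frame hn hm hl d)

theorem AlignedToOrder.mono {r s : ℕ} (h : AlignedToOrder g p l r) (hsr : s ≤ r) :
    AlignedToOrder g p l s := by
  obtain ⟨m, hm, hl, h⟩ := h
  exact ⟨m, hm, hl, fun a b c d hw => h a b c d (by omega)⟩

/-- `Nat.findGreatest` returns `0` also when its predicate fails at `0`, so the criterion is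
restricted to `r ≠ 0`. Alignment conditions are nested, which gives the converse from the greatest
order to every smaller one. -/
theorem le_wandMultiplicity_iff {r : ℕ} (hr : r ≠ 0) :
    r ≤ wandMultiplicity g p l ↔ r ≤ 4 ∧ AlignedToOrder g p l r := by
  classical
  unfold wandMultiplicity
  constructor
  · intro h
    have h4 := Nat.findGreatest_le (P := AlignedToOrder g p l) 4
    refine ⟨h.trans h4, ?_⟩
    have : AlignedToOrder g p l (Nat.findGreatest (AlignedToOrder g p l) 4) :=
      Nat.findGreatest_of_ne_zero (m := Nat.findGreatest (AlignedToOrder g p l) 4) rfl (by omega)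
    exact this.mono h
  · rintro ⟨h4, h⟩
    exact Nat.le_findGreatest h4 h

theorem isMWAND_iff : IsMWAND g p l ↔ AlignedToOrder g p l 2 := by
  rw [IsMWAND, le_wandMultiplicity_iff two_ne_zero]; simp

theorem isSingleWAND_iff :
    IsSingleWAND g p l ↔ AlignedToOrder g p l 1 ∧ ¬ AlignedToOrder g p l 2 := by
  have h1 := le_wandMultiplicity_iff (g := g) (p := p) (l := l) one_ne_zero
  have h2 := le_wandMultiplicity_iff (g := g) (p := p) (l := l) two_ne_zero
  simp only [Nat.one_le_ofNat, true_and, Nat.reduceLeDiff] at h1 h2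
  rw [← h1, ← h2, IsSingleWAND]
  omega

end Alignment

/-! ### Passage between tangent vectors on the manifold and chart components. -/

section Coordinates

variable {n : ℕ} {M : Type*} [TopologicalSpace M] [ChartedSpace (EuclideanSpace ℝ (Fin n)) M]
  [IsManifold (𝓡 n) ∞ M] {g : BilinField n M} {c p : M} {y : EuclideanSpace ℝ (Fin n)}

instance isManifold_one : IsManifold (𝓡 n) 1 M := IsManifold.of_le (n := ∞) (by simp)

theorem sum_smul_single (v : EuclideanSpace ℝ (Fin n)) :
    ∑ i, v i • EuclideanSpace.single i (1 : ℝ) = v := by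
  simpa using (EuclideanSpace.basisFun (Fin n) ℝ).sum_repr v

theorem sum_smul_coordBasis (c q : M) (v : EuclideanSpace ℝ (Fin n)) :
    ∑ i, v i • coordBasis c q i = tangentCoordChange (𝓡 n) c q q v := by
  conv_rhs => rw [← sum_smul_single v]
  rw [map_sum]
  simp only [map_smul]
  rfl

theorem tangentCoordChange_inv {q : M} (hq : q ∈ (extChartAt (𝓡 n) c).source)
    (v : EuclideanSpace ℝ (Fin n)) :
    tangentCoordChange (𝓡 n) c q q (tangentCoordChange (𝓡 n) q c q v) = v := by
  rw [tangentCoordChange_comp ⟨⟨mem_extChartAt_source q, hq⟩, mem_extChartAt_source q⟩,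
    tangentCoordChange_self (mem_extChartAt_source q)]

theorem tangentCoordChange_inv' {q : M} (hq : q ∈ (extChartAt (𝓡 n) c).source)
    (v : EuclideanSpace ℝ (Fin n)) :
    tangentCoordChange (𝓡 n) q c q (tangentCoordChange (𝓡 n) c q q v) = v := by
  rw [tangentCoordChange_comp ⟨⟨hq, mem_extChartAt_source q⟩, hq⟩,
    tangentCoordChange_self hq]

theorem sum_coordMetric_mul (g : BilinField n M) (c : M) (y v : EuclideanSpace ℝ (Fin n))
    (i : Fin n) :
    ∑ j, coordMetric g c y i j * v j =
      g ((extChartAt (𝓡 n) c).symm y) (coordBasis c ((extChartAt (𝓡 n) c).symm y) i)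
        (tangentCoordChange (𝓡 n) c ((extChartAt (𝓡 n) c).symm y)
          ((extChartAt (𝓡 n) c).symm y) v) := by
  rw [← sum_smul_coordBasis]
  refine Eq.trans ?_ (map_sum (g ((extChartAt (𝓡 n) c).symm y)
    (coordBasis c ((extChartAt (𝓡 n) c).symm y) i)) _ _).symm
  refine Finset.sum_congr rfl fun j _ => ?_
  refine Eq.trans ?_ (map_smul (g ((extChartAt (𝓡 n) c).symm y)
    (coordBasis c ((extChartAt (𝓡 n) c).symm y) i)) _ _).symm
  exact mul_comm _ _

theorem lowerIndex_coordMetric (g : BilinField n M) (X : (q : M) → TangentSpace (𝓡 n) q)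
    (hy : y ∈ (extChartAt (𝓡 n) c).target) (i : Fin n) :
    lowerIndex (coordMetric g c) (coordVector X c) i y =
      g ((extChartAt (𝓡 n) c).symm y) (coordBasis c ((extChartAt (𝓡 n) c).symm y) i)
        (X ((extChartAt (𝓡 n) c).symm y)) := by
  rw [lowerIndex, sum_coordMetric_mul]
  congr 1
  exact tangentCoordChange_inv ((extChartAt (𝓡 n) c).map_target hy) _

theorem isLocalMetric_coordMetric (hL : ∀ q, IsLorentzAt g q) (hs : SmoothMetric g) (c : M) :
    IsLocalMetric (extChartAt (𝓡 n) c).target (coordMetric g c) where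
  isOpen := isOpen_extChartAt_target c
  smooth i j := hs c i j
  symm z _ i j := (hL _).1 _ _
  det_ne z hz := by
    rw [isUnit_iff_ne_zero]
    intro h0
    -- A null vector of the component matrix would be a tangent vector orthogonal to everything,
    -- which the signature excludes.
    obtain ⟨v, hv, hGv⟩ := Matrix.exists_mulVec_eq_zero_iff.2 h0
    set q := (extChartAt (𝓡 n) c).symm z with hq
    have hqs : q ∈ (extChartAt (𝓡 n) c).source := (extChartAt (𝓡 n) c).map_target hz
    set X : TangentSpace (𝓡 n) q := tangentCoordChange (𝓡 n) c q q (WithLp.toLp 2 v) with hX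
    have h1 : ∀ i, g q (coordBasis c q i) X = 0 := fun i => by
      have := congrFun hGv i
      rw [← sum_coordMetric_mul]
      exact this
    have h2 : ∀ w : TangentSpace (𝓡 n) q, g q w X = 0 := fun w => by
      have hw : w = ∑ i, (tangentCoordChange (𝓡 n) q c q w) i • coordBasis c q i :=
        ((sum_smul_coordBasis c q _).trans (tangentCoordChange_inv hqs w)).symm
      rw [hw, map_sum, sum_apply]
      refine Finset.sum_eq_zero fun i _ => ?_
      rw [map_smul, smul_apply, h1, smul_zero]
    have h3 : X = 0 := (hL q).eq_zero_of_forall h2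
    have h4 := tangentCoordChange_inv' hqs (WithLp.toLp 2 v)
    have h5 : tangentCoordChange (𝓡 n) q c q X = 0 := by rw [h3]; exact map_zero _
    apply hv
    have h6 : (WithLp.toLp 2 v : EuclideanSpace ℝ (Fin n)) = 0 := h4.symm.trans h5
    ext i
    exact congrFun (congrArg WithLp.ofLp h6) i

theorem coordMetric_self (g : BilinField n M) (p : M) (i j : Fin n) :
    coordMetric g p (extChartAt (𝓡 n) p p) i j =
      g p (coordBasis p p i) (coordBasis p p j) := by
  -- The base point `(extChartAt p).symm (extChartAt p p)` is only propositionally `p`, and the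
  -- tangent space depends on it; hence the detour over a variable `q`.
  have : ∀ q, q = p → g q (coordBasis p q i) (coordBasis p q j) =
      g p (coordBasis p p i) (coordBasis p p j) := by rintro _ rfl; rfl
  exact this _ (extChartAt_to_inv p)

theorem coordVector_self (X : (q : M) → TangentSpace (𝓡 n) q) (p : M) :
    coordVector X p (extChartAt (𝓡 n) p p) = X p := by
  have : ∀ q, q = p → tangentCoordChange (𝓡 n) q p q (X q) = X p := by
    rintro _ rfl
    exact tangentCoordChange_self (mem_extChartAt_source _)
  exact this _ (extChartAt_to_inv p)

theorem eval₂_coordMetric (g : BilinField n M) (p : M) (v w : TangentSpace (𝓡 n) p) :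
    eval₂ (fun a b => coordMetric g p (extChartAt (𝓡 n) p p) a b) v w = g p v w := by
  have h : ∀ v : TangentSpace (𝓡 n) p, v = ∑ i, (coords v) i • coordBasis p p i := fun v => by
    rw [sum_smul_coordBasis]
    exact (tangentCoordChange_self (I := 𝓡 n) (x := p) (z := p) (v := coords v)
      (mem_extChartAt_source p)).symm
  conv_rhs => rw [h v, h w]
  simp only [map_sum, map_smul, sum_apply, smul_apply, smul_eq_mul, eval₂, coordMetric_self]
  rw [Finset.sum_comm]
  refine Finset.sum_congr rfl fun i _ => ?_
  rw [Finset.mul_sum]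
  exact Finset.sum_congr rfl fun j _ => by
    change _ * (coords v) _ * (coords w) _ = _
    ring

end Coordinates

/-! ### Comparison of `k`-alignment for the background and the full metric. -/

section Family

variable {n : ℕ} {M : Type*} [TopologicalSpace M] [ChartedSpace (EuclideanSpace ℝ (Fin n)) M]
  [IsManifold (𝓡 n) ∞ M] {P : Type*} [TopologicalSpace P] [Zero P] (S : GKSFamily n M P)

namespace GKSFamily

theorem metric_apply (μ : P) (p : M) (v w : TangentSpace (𝓡 n) p) :
    S.metric μ p v w =
      S.gbar p v w - 2 * S.H μ p * (S.gbar p (S.k p) v * S.gbar p (S.k p) w) := by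
  simp only [metric, sub_apply, smul_apply, ContinuousLinearMap.smulRight_apply, smul_eq_mul]

theorem metric_k (μ : P) (p : M) (v : TangentSpace (𝓡 n) p) :
    S.metric μ p (S.k p) v = S.gbar p (S.k p) v := by
  rw [metric_apply, S.k_null]; ring

theorem isLocalKerrSchild (μ : P) (c : M) :
    IsLocalKerrSchild (extChartAt (𝓡 n) c).target (coordMetric S.gbar c)
      (coordMetric (S.metric μ) c) (coordVector S.k c) (S.H μ ∘ (extChartAt (𝓡 n) c).symm) where
  background := isLocalMetric_coordMetric S.gbar_lorentz S.gbar_smooth c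
  k_smooth := S.k_smooth c
  H_smooth := by
    rw [← contMDiffOn_iff_contDiffOn]
    exact (S.H_smooth μ).comp_contMDiffOn (contMDiffOn_extChartAt_symm c)
  k_null z hz := by
    set q := (extChartAt (𝓡 n) c).symm z with hq
    have h1 : ∑ i, coordVector S.k c z i • coordBasis c q i = S.k q :=
      (sum_smul_coordBasis c q (coordVector S.k c z)).trans
        (tangentCoordChange_inv ((extChartAt (𝓡 n) c).map_target hz) _)
    simp only [lowerIndex_coordMetric S.gbar S.k hz]
    rw [← S.k_null q]
    refine Eq.trans ?_ (congrArg (fun v => S.gbar q v (S.k q)) h1)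
    simp only [map_sum, sum_apply]
    refine Finset.sum_congr rfl fun i _ => ?_
    rw [map_smul, smul_apply, smul_eq_mul, mul_comm]
  metric_eq z hz i j := by
    rw [lowerIndex_coordMetric S.gbar S.k hz, lowerIndex_coordMetric S.gbar S.k hz,
      (S.gbar_lorentz _).1 _ (S.k _), (S.gbar_lorentz _).1 _ (S.k _)]
    exact S.metric_apply μ _ _ _

/-- The geodesic condition gives only a pointwise proportionality factor. Near `p` some component of
`k` is nonzero, and dividing that component of `∇_k k` by it shows that the factor is smooth. -/
theorem exists_isLocalGeodesic (hgeo : IsGeodesic S.gbar S.k) (p : M) :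
    ∃ V, IsOpen V ∧ V ⊆ (extChartAt (𝓡 n) p).target ∧ extChartAt (𝓡 n) p p ∈ V ∧
      ∃ f, IsLocalGeodesic V (coordMetric S.gbar p) (coordVector S.k p) f := by
  have hB := isLocalMetric_coordMetric S.gbar_lorentz S.gbar_smooth p
  have hk0 : ∃ a, coordVector S.k p (extChartAt (𝓡 n) p p) a ≠ 0 := by
    by_contra h
    push Not at h
    apply S.k_ne_zero p
    rw [← coordVector_self S.k p]
    exact PiLp.ext h
  obtain ⟨a₀, ha₀⟩ := hk0
  have hks : ∀ a, ContDiffOn ℝ ∞ (fun z => coordVector S.k p z a) (extChartAt (𝓡 n) p).target :=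
    fun a => (contDiffOn_piLp 2).1 (S.k_smooth p) a
  refine ⟨(extChartAt (𝓡 n) p).target ∩ (fun z => coordVector S.k p z a₀) ⁻¹' {0}ᶜ,
    (hks a₀).continuousOn.isOpen_inter_preimage hB.isOpen isOpen_compl_singleton,
    Set.inter_subset_left, ⟨mem_extChartAt_target p, ha₀⟩,
    fun z => ((∑ b, coordVector S.k p z b * pderiv b (fun z => coordVector S.k p z a₀) z) +
      (∑ b, ∑ d, christoffel (coordMetric S.gbar p) a₀ b d z *
        coordVector S.k p z b * coordVector S.k p z d)) / coordVector S.k p z a₀, ?_, ?_⟩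
  · refine ContDiffOn.div (ContDiffOn.mono ?_ Set.inter_subset_left)
      ((hks a₀).mono Set.inter_subset_left) fun z hz => hz.2
    exact (ContDiffOn.sum fun b _ => (hks b).mul (contDiffOn_pderiv hB.isOpen (hks a₀) b)).add
      (ContDiffOn.sum fun b _ => ContDiffOn.sum fun d _ =>
        ((hB.contDiffOn_christoffel a₀ b d).mul (hks b)).mul (hks d))
  · intro z hz a
    obtain ⟨r, hr⟩ := hgeo p z hz.1
    rw [hr a, hr a₀]
    have : coordVector S.k p z a₀ ≠ 0 := hz.2
    field_simp

end GKSFamily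

/-- A tensor with the symmetries of the Weyl tensor vanishes on vectors of positive total boost
weight if it does when the first one is `k`. -/
theorem eq_zero_of_boost_pos {V : Type*} {k : V} {κ : V → ℝ} (hκ : κ k = 0)
    {D : V → V → V → V → ℝ} (h12 : ∀ v w x z, D v w x z = -D w v x z)
    (h34 : ∀ v w x z, D v w x z = -D v w z x) (hp : ∀ v w x z, D v w x z = D x z v w)
    (hk : ∀ w x z, κ x = 0 → κ z = 0 → (κ w = 0 ∨ x = k) → D k w x z = 0)
    {i j s t : ℤ} (hpos : 1 ≤ i + j + s + t) {v w x z : V}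
    (hv : (i = 1 ∧ v = k) ∨ (i = 0 ∧ κ v = 0) ∨ i = -1)
    (hw : (j = 1 ∧ w = k) ∨ (j = 0 ∧ κ w = 0) ∨ j = -1)
    (hx : (s = 1 ∧ x = k) ∨ (s = 0 ∧ κ x = 0) ∨ s = -1)
    (hz : (t = 1 ∧ z = k) ∨ (t = 0 ∧ κ z = 0) ∨ t = -1) : D v w x z = 0 := by
  -- With `k` in the first slot, the remaining weights sum to at least `0`. If `w = k`, antisymmetry
  -- applies; otherwise the symmetries bring the term to the shape of `hk`.
  have core : ∀ {j s t : ℤ} {w x z : V}, 0 ≤ j + s + t →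
      ((j = 1 ∧ w = k) ∨ (j = 0 ∧ κ w = 0) ∨ j = -1) →
      ((s = 1 ∧ x = k) ∨ (s = 0 ∧ κ x = 0) ∨ s = -1) →
      ((t = 1 ∧ z = k) ∨ (t = 0 ∧ κ z = 0) ∨ t = -1) → D k w x z = 0 := by
    clear hpos hv hw hx hz
    intro j s t w x z hpos hw hx hz
    rcases hw with ⟨rfl, rfl⟩ | ⟨rfl, hw⟩ | rfl
    · have := h12 w w x z; linarith
    · rcases hx with ⟨rfl, rfl⟩ | ⟨rfl, hx⟩ | rfl <;> rcases hz with ⟨rfl, rfl⟩ | ⟨rfl, hz⟩ | rfl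
      · exact hk _ _ _ hκ hκ (.inl hw)
      · exact hk _ _ _ hκ hz (.inl hw)
      -- Pair symmetry turns `D k w k z` into `D k z k w`, so the unrestricted vector lands in the
      -- second slot.
      · rw [hp]; exact hk _ _ _ hκ hw (.inr rfl)
      · exact hk _ _ _ hx hκ (.inl hw)
      · exact hk _ _ _ hx hz (.inl hw)
      · omega
      · rw [h34, hp, hk _ _ _ hκ hw (.inr rfl), neg_zero]
      · omega
      · omega
    · rcases hx with ⟨rfl, rfl⟩ | ⟨rfl, hx⟩ | rfl <;> rcases hz with ⟨rfl, rfl⟩ | ⟨rfl, hz⟩ | rfl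
      · exact hk _ _ _ hκ hκ (.inr rfl)
      · exact hk _ _ _ hκ hz (.inr rfl)
      · omega
      · rw [h34, hk _ _ _ hκ hx (.inr rfl), neg_zero]
      all_goals omega
  -- A positive total weight needs some slot of weight `1`, that is, some slot equal to `k`, which
  -- is moved to the front.
  by_cases hi : i = 1
  · obtain rfl : v = k := by rcases hv with h | h | h <;> first | exact h.2 | omega
    exact core (by omega) hw hx hz
  by_cases hj : j = 1
  · obtain rfl : w = k := by rcases hw with h | h | h <;> first | exact h.2 | omega
    rw [h12, core (by omega) hv hx hz, neg_zero]
  by_cases hs : s = 1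
  · obtain rfl : x = k := by rcases hx with h | h | h <;> first | exact h.2 | omega
    rw [hp, core (by omega) hz hv hw]
  by_cases ht : t = 1
  · obtain rfl : z = k := by rcases hz with h | h | h <;> first | exact h.2 | omega
    rw [h34, hp, core (by omega) hx hv hw, neg_zero]
  omega

namespace GKSFamily

theorem weylAt_k_eq (hgeo : IsGeodesic S.gbar S.k) (μ : P) (p : M)
    {w x z : TangentSpace (𝓡 n) p} (hx : S.gbar p (S.k p) x = 0) (hz : S.gbar p (S.k p) z = 0)
    (hw : S.gbar p (S.k p) w = 0 ∨ x = S.k p) :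
    weylAt (S.metric μ) p (S.k p) w x z = weylAt S.gbar p (S.k p) w x z := by
  obtain ⟨V, hVo, hVs, hpV, f, hf⟩ := S.exists_isLocalGeodesic hgeo p
  have h := (S.isLocalKerrSchild μ p).mono hVo hVs
  obtain ⟨u, -, hu⟩ := (S.gbar_lorentz p).exists_partner (S.k_null p) (S.k_ne_zero p)
  have hk := coordVector_self S.k p
  have hu' : ∑ i, lowerIndex (coordMetric S.gbar p) (coordVector S.k p) i
      (extChartAt (𝓡 n) p p) * coords u i = 1 := by
    rw [← hu, (S.gbar_lorentz p).1, ← eval₂_coordMetric S.gbar p (S.k p) u, ← hk]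
    exact (h.eval₂_background_k hpV u).symm
  have key := h.eval₄_weyl_eq hf hpV (X := x) (Y := z) (Z := w) hu'
    (by rw [hk]; exact (eval₂_coordMetric ..).trans hx)
    (by rw [hk]; exact (eval₂_coordMetric ..).trans hz)
    (by rw [hk]; exact hw.imp (fun hw => (eval₂_coordMetric ..).trans hw) id)
  rw [hk] at key
  exact key

/-- Only `g(k, ·)` enters, and it does not depend on `μ`. -/
theorem boostFiltration_k (μ : P) (p : M) (w : ℤ) :
    boostFiltration (S.metric μ) p (S.k p) w = boostFiltration S.gbar p (S.k p) w := by
  unfold boostFiltration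
  split_ifs
  · rfl
  · ext v
    simp only [LinearMap.mem_ker, ContinuousLinearMap.coe_coe, S.metric_k]
  · rfl

/-- The difference of the two Weyl tensors inherits their symmetries, so it suffices to test it with
`k` in the first slot. -/
theorem weylAt_eq_of_boost_pos (hgeo : IsGeodesic S.gbar S.k) (μ : P) (p : M)
    {i j s t : ℤ} (hi : i = -1 ∨ i = 0 ∨ i = 1) (hj : j = -1 ∨ j = 0 ∨ j = 1)
    (hs : s = -1 ∨ s = 0 ∨ s = 1) (ht : t = -1 ∨ t = 0 ∨ t = 1) (hpos : 1 ≤ i + j + s + t)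
    {v w x z : TangentSpace (𝓡 n) p} (hv : v ∈ boostFiltration S.gbar p (S.k p) i)
    (hw : w ∈ boostFiltration S.gbar p (S.k p) j) (hx : x ∈ boostFiltration S.gbar p (S.k p) s)
    (hz : z ∈ boostFiltration S.gbar p (S.k p) t) :
    weylAt (S.metric μ) p v w x z = weylAt S.gbar p v w x z := by
  have hG := (S.isLocalKerrSchild μ p).isLocalMetric
  have hB := (S.isLocalKerrSchild μ p).background
  have hp := mem_extChartAt_target (I := 𝓡 n) p
  set T : Fin n → Fin n → Fin n → Fin n → ℝ := fun a b c d =>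
    weyl (coordMetric (S.metric μ) p) a b c d (extChartAt (𝓡 n) p p)
      - weyl (coordMetric S.gbar p) a b c d (extChartAt (𝓡 n) p p) with hT
  have hTe : ∀ v w x z : TangentSpace (𝓡 n) p, eval₄ T v w x z =
      weylAt (S.metric μ) p v w x z - weylAt S.gbar p v w x z := fun v w x z => by
    simp only [weylAt, eval₄, hT, ← Finset.sum_sub_distrib, sub_mul]
    rfl
  rw [← sub_eq_zero, ← hTe]
  have hgen : ∀ {i : ℤ}, (i = -1 ∨ i = 0 ∨ i = 1) → boostFiltration S.gbar p (S.k p) i ≤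
      Submodule.span ℝ {v | (i = 1 ∧ v = S.k p) ∨ (i = 0 ∧ S.gbar p (S.k p) v = 0) ∨ i = -1} := by
    rintro i (rfl | rfl | rfl) v hv
    · exact Submodule.subset_span (by simp)
    · exact Submodule.subset_span (by simpa using mem_boostFiltration_zero.1 hv)
    · rw [boostFiltration_one] at hv
      refine Submodule.span_mono ?_ hv
      rintro _ rfl
      simp
  refine eval₄_eq_zero_of_span ?_ (hgen hi hv) (hgen hj hw) (hgen hs hx) (hgen ht hz)
  intro v hv w hw x hx z hz
  refine eq_zero_of_boost_pos (k := S.k p) (κ := fun v => S.gbar p (S.k p) v)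
    (D := fun v w x z => eval₄ T v w x z) (S.k_null p) ?_ ?_ ?_ ?_ hpos hv hw hx hz
  · exact eval₄_antisymm_left fun a b c d => by
      rw [hT]; simp only []
      rw [hG.weyl_antisymm_left hp, hB.weyl_antisymm_left hp]; ring
  · exact eval₄_antisymm_right fun a b c d => by
      rw [hT]; simp only []
      rw [IsLocalMetric.weyl_antisymm_right, IsLocalMetric.weyl_antisymm_right a b c d]; ring
  · exact eval₄_pair_symm fun a b c d => by
      rw [hT]; simp only []
      rw [hG.weyl_pair_symm hp, hB.weyl_pair_symm hp]
  · intro w x z hx hz hw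
    exact (hTe _ _ _ _).trans (sub_eq_zero.2 (S.weylAt_k_eq hgeo μ p hx hz hw))

theorem exists_nullFrame (hn : 2 ≤ n) (p : M) {l k : TangentSpace (𝓡 n) p}
    (hl : S.gbar p l l = 0) (hk : S.gbar p k k = 0) (hlk : S.gbar p l k = 1) :
    ∃ m, IsNullFrame S.gbar p m ∧ ∀ a : Fin n, a.val = 0 → m a = l :=
  exists_nullFrame_of_pos (S.gbar_lorentz p).1 hn hl hk hlk fun _ hlv hkv hv =>
    (S.gbar_lorentz p).pos_of_orthogonal (by omega) hl hk hlk hlv hkv hv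

theorem exists_nullFrame_k (hn : 2 ≤ n) (p : M) :
    ∃ m, IsNullFrame S.gbar p m ∧ ∀ a : Fin n, a.val = 0 → m a = S.k p := by
  obtain ⟨l, hl, hlk⟩ := (S.gbar_lorentz p).exists_partner (S.k_null p) (S.k_ne_zero p)
  exact S.exists_nullFrame hn p (S.k_null p) hl (((S.gbar_lorentz p).1 _ _).trans hlk)

theorem exists_nullFrame_metric_k (hn : 2 ≤ n) (μ : P) (p : M) :
    ∃ m, IsNullFrame (S.metric μ) p m ∧ ∀ a : Fin n, a.val = 0 → m a = S.k p := by
  obtain ⟨m, hm, hl⟩ := S.exists_nullFrame_k hn p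
  have hl0 : m ⟨0, by omega⟩ = S.k p := hl _ rfl
  -- The shift by `H k` makes `m 1` null for the full metric: its square is `2H - 2H = 0`. All other
  -- products are unchanged.
  refine ⟨fun a => if a.val = 1 then m a + S.H μ p • S.k p else m a, fun a b => ?_,
    fun a ha => by simp [ha, hl]⟩
  have hkm : ∀ a : Fin n, S.gbar p (S.k p) (m a) = if a.val = 1 then 1 else 0 := fun a => by
    rw [← hl0, hm]
    refine if_congr ?_ rfl rfl
    simp
  have hmk : ∀ a : Fin n, S.gbar p (m a) (S.k p) = if a.val = 1 then 1 else 0 := fun a => by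
    rw [(S.gbar_lorentz p).1, hkm]
  rw [← hm a b, S.metric_apply]
  by_cases ha : a.val = 1 <;> by_cases hb : b.val = 1
  all_goals simp only [ha, hb, if_true, if_false, map_add, map_smul, add_apply, smul_apply,
    smul_eq_mul, S.k_null, hkm, hmk]
  all_goals ring

/-- For `r ≤ 2` only boost weights above `2 - r ≥ 0` are involved, precisely those on which the Weyl
tensors agree. -/
theorem alignedToOrder_k_iff (hn : 2 ≤ n) (hgeo : IsGeodesic S.gbar S.k) (μ : P) (p : M) {r : ℕ}
    (hr : r ≤ 2) :
    AlignedToOrder S.gbar p (S.k p) r ↔ AlignedToOrder (S.metric μ) p (S.k p) r := by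
  rw [alignedToOrder_iff hn, alignedToOrder_iff hn]
  simp only [S.boostFiltration_k]
  refine and_congr (iff_of_true (S.exists_nullFrame_k hn p) (S.exists_nullFrame_metric_k hn μ p)) ?_
  constructor
  · intro h i j s t hi hj hs ht hw v hv w hw' x hx z hz
    rw [S.weylAt_eq_of_boost_pos hgeo μ p hi hj hs ht (by omega) hv hw' hx hz]
    exact h i j s t hi hj hs ht hw v hv w hw' x hx z hz
  · intro h i j s t hi hj hs ht hw v hv w hw' x hx z hz
    rw [← S.weylAt_eq_of_boost_pos hgeo μ p hi hj hs ht (by omega) hv hw' hx hz]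
    exact h i j s t hi hj hs ht hw v hv w hw' x hx z hz

end GKSFamily

end Family

/-! ### Convergence of curvature under convergence of 2-jets. -/

section Limits

variable {n : ℕ} {U : Set (EuclideanSpace ℝ (Fin n))} {y : EuclideanSpace ℝ (Fin n)}
  {Gb : EuclideanSpace ℝ (Fin n) → Matrix (Fin n) (Fin n) ℝ} {P : Type*} {F : Filter P}
  {G : P → EuclideanSpace ℝ (Fin n) → Matrix (Fin n) (Fin n) ℝ}

/-- The 2-jets at `y` of the metrics `G μ` converge to that of `Gb`. -/
structure JetTendsto (F : Filter P)
    (G : P → EuclideanSpace ℝ (Fin n) → Matrix (Fin n) (Fin n) ℝ)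
    (Gb : EuclideanSpace ℝ (Fin n) → Matrix (Fin n) (Fin n) ℝ)
    (y : EuclideanSpace ℝ (Fin n)) : Prop where
  metric : ∀ i j, Tendsto (fun μ => G μ y i j) F (𝓝 (Gb y i j))
  inv : ∀ i j, Tendsto (fun μ => (G μ y)⁻¹ i j) F (𝓝 ((Gb y)⁻¹ i j))
  fst : ∀ c i j, Tendsto (fun μ => pderiv c (fun z => G μ z i j) y) F
    (𝓝 (pderiv c (fun z => Gb z i j) y))
  snd : ∀ c d i j, Tendsto (fun μ => pderiv c (pderiv d fun z => G μ z i j) y) F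
    (𝓝 (pderiv c (pderiv d fun z => Gb z i j) y))

namespace JetTendsto

theorem christoffelLower (h : JetTendsto F G Gb y) (l i j : Fin n) :
    Tendsto (fun μ => christoffelLower (G μ) l i j y) F (𝓝 (christoffelLower Gb l i j y)) :=
  (((h.fst i j l).add (h.fst j i l)).sub (h.fst l i j)).const_mul (1 / 2)

theorem christoffel (h : JetTendsto F G Gb y) (k i j : Fin n) :
    Tendsto (fun μ => christoffel (G μ) k i j y) F (𝓝 (christoffel Gb k i j y)) := by
  simp only [christoffel_eq_sum]
  exact tendsto_finsetSum _ fun l _ => (h.inv k l).mul (h.christoffelLower l i j)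

/-- `riemann_eq` expresses the tensor polynomially through the 2-jet and the inverse metric, so the
limit can be taken term by term. -/
theorem riemann (h : JetTendsto F G Gb y) (hG : ∀ μ, IsLocalMetric U (G μ))
    (hB : IsLocalMetric U Gb) (hy : y ∈ U) (a b c d : Fin n) :
    Tendsto (fun μ => riemann (G μ) a b c d y) F (𝓝 (riemann Gb a b c d y)) := by
  simp only [(hG _).riemann_eq hy, hB.riemann_eq hy]
  refine Tendsto.sub (Tendsto.add (Tendsto.const_mul _ ?_) ?_) ?_
  · exact (((h.snd _ _ _ _).add (h.snd _ _ _ _)).sub (h.snd _ _ _ _)).sub (h.snd _ _ _ _)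
  · exact tendsto_finsetSum _ fun e _ => (h.christoffelLower _ _ _).mul (h.christoffel _ _ _)
  · exact tendsto_finsetSum _ fun e _ => (h.christoffelLower _ _ _).mul (h.christoffel _ _ _)

theorem ricci (h : JetTendsto F G Gb y) (hG : ∀ μ, IsLocalMetric U (G μ))
    (hB : IsLocalMetric U Gb) (hy : y ∈ U) (b d : Fin n) :
    Tendsto (fun μ => ricci (G μ) b d y) F (𝓝 (ricci Gb b d y)) := by
  simp only [(hG _).ricci_eq hy, hB.ricci_eq hy]
  exact tendsto_finsetSum _ fun a _ => tendsto_finsetSum _ fun c _ =>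
    (h.inv a c).mul (h.riemann hG hB hy c b a d)

theorem weyl (h : JetTendsto F G Gb y) (hG : ∀ μ, IsLocalMetric U (G μ))
    (hB : IsLocalMetric U Gb) (hy : y ∈ U) (a b c d : Fin n) :
    Tendsto (fun μ => weyl (G μ) a b c d y) F (𝓝 (weyl Gb a b c d y)) := by
  have hr := h.ricci hG hB hy
  have hs : Tendsto (fun μ => scalarCurvature (G μ) y) F (𝓝 (scalarCurvature Gb y)) :=
    tendsto_finsetSum _ fun b _ => tendsto_finsetSum _ fun d _ => (h.inv b d).mul (hr b d)
  refine Tendsto.add (Tendsto.sub (h.riemann hG hB hy a b c d) (Tendsto.const_mul _ ?_))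
    (Tendsto.mul (hs.div_const _) ?_)
  · exact ((((h.metric _ _).mul (hr _ _)).sub ((h.metric _ _).mul (hr _ _))).sub
      ((h.metric _ _).mul (hr _ _))).add ((h.metric _ _).mul (hr _ _))
  · exact ((h.metric _ _).mul (h.metric _ _)).sub ((h.metric _ _).mul (h.metric _ _))

end JetTendsto

theorem IsLocalKerrSchild.pderiv_pderiv_metric {G : EuclideanSpace ℝ (Fin n) →
    Matrix (Fin n) (Fin n) ℝ} {k : EuclideanSpace ℝ (Fin n) → EuclideanSpace ℝ (Fin n)}
    {H : EuclideanSpace ℝ (Fin n) → ℝ} (h : IsLocalKerrSchild U Gb G k H) (hy : y ∈ U)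
    (c d i j : Fin n) :
    pderiv c (pderiv d fun z => G z i j) y = pderiv c (pderiv d fun z => Gb z i j) y
      - 2 * (pderiv c (pderiv d H) y * (lowerIndex Gb k i y * lowerIndex Gb k j y)
        + pderiv d H y * pderiv c (fun z => lowerIndex Gb k i z * lowerIndex Gb k j z) y
        + (pderiv c H y * pderiv d (fun z => lowerIndex Gb k i z * lowerIndex Gb k j z) y
        + H y * pderiv c (pderiv d fun z => lowerIndex Gb k i z * lowerIndex Gb k j z) y)) := by
  have hU := h.background.isOpen
  have hw : ContDiffOn ℝ ∞ (fun z => lowerIndex Gb k i z * lowerIndex Gb k j z) U :=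
    (h.contDiffOn_lowerIndex i).mul (h.contDiffOn_lowerIndex j)
  set w := fun z => lowerIndex Gb k i z * lowerIndex Gb k j z with hwdef
  have hD : ∀ {f : EuclideanSpace ℝ (Fin n) → ℝ}, ContDiffOn ℝ ∞ f U → ∀ {z}, z ∈ U →
      DifferentiableAt ℝ f z := fun hf _ hz => differentiableAt_of_contDiffOn hU hf hz
  have e1 : ∀ z ∈ U, pderiv d (fun z => G z i j) z =
      pderiv d (fun z => Gb z i j) z - 2 * (pderiv d H z * w z + H z * pderiv d w z) := by
    intro z hz
    have hG : ∀ z ∈ U, G z i j = Gb z i j - 2 * (H z * w z) := fun z hz => by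
      rw [h.metric_eq z hz]; ring
    rw [pderiv_congr_of_isOpen hU hz hG, pderiv_sub (h.background.differentiableAt hz i j)
      (((hD h.H_smooth hz).fun_mul (hD hw hz)).const_mul 2),
      pderiv_const_mul 2 ((hD h.H_smooth hz).fun_mul (hD hw hz)),
      pderiv_mul (hD h.H_smooth hz) (hD hw hz)]
  have hdH := contDiffOn_pderiv hU h.H_smooth d
  have hdw := contDiffOn_pderiv hU hw d
  have d1 := (hD hdH hy).fun_mul (hD hw hy)
  have d2 := (hD h.H_smooth hy).fun_mul (hD hdw hy)
  rw [pderiv_congr_of_isOpen hU hy e1,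
    pderiv_sub (hD (contDiffOn_pderiv hU (h.background.smooth i j) d) hy)
      ((d1.fun_add d2).const_mul 2),
    pderiv_const_mul 2 (d1.fun_add d2), pderiv_add d1 d2, pderiv_mul (hD hdH hy) (hD hw hy),
    pderiv_mul (hD h.H_smooth hy) (hD hdw hy)]

theorem jetTendsto_of_kerrSchild {k : EuclideanSpace ℝ (Fin n) → EuclideanSpace ℝ (Fin n)}
    {H : P → EuclideanSpace ℝ (Fin n) → ℝ} (h : ∀ μ, IsLocalKerrSchild U Gb (G μ) k (H μ))
    (hy : y ∈ U) (h0 : Tendsto (fun μ => H μ y) F (𝓝 0))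
    (h1 : ∀ c, Tendsto (fun μ => pderiv c (H μ) y) F (𝓝 0))
    (h2 : ∀ c d, Tendsto (fun μ => pderiv c (pderiv d (H μ)) y) F (𝓝 0)) :
    JetTendsto F G Gb y where
  metric i j := by
    simp only [(h _).metric_eq y hy]
    have := ((h0.const_mul 2).mul_const (lowerIndex Gb k i y * lowerIndex Gb k j y)).const_sub
      (Gb y i j)
    simpa using this
  inv i j := by
    simp only [(h _).inv_eq hy]
    have := ((h0.const_mul 2).mul_const (k y i * k y j)).const_add ((Gb y)⁻¹ i j)
    simpa using this
  fst c i j := by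
    simp only [(h _).pderiv_metric hy]
    have := ((((h1 c).mul_const (lowerIndex Gb k i y * lowerIndex Gb k j y)).add
      (h0.mul_const (pderiv c (lowerIndex Gb k i) y * lowerIndex Gb k j y
          + lowerIndex Gb k i y * pderiv c (lowerIndex Gb k j) y))).const_mul 2).const_sub
      (pderiv c (fun z => Gb z i j) y)
    simpa using this
  snd c d i j := by
    simp only [(h _).pderiv_pderiv_metric hy]
    have := (((((h2 c d).mul_const (lowerIndex Gb k i y * lowerIndex Gb k j y)).add
      ((h1 d).mul_const (pderiv c (fun z => lowerIndex Gb k i z * lowerIndex Gb k j z) y))).add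
      (((h1 c).mul_const (pderiv d (fun z => lowerIndex Gb k i z * lowerIndex Gb k j z) y)).add
      (h0.mul_const (pderiv c (pderiv d fun z => lowerIndex Gb k i z * lowerIndex Gb k j z)
        y)))).const_mul 2).const_sub (pderiv c (pderiv d fun z => Gb z i j) y)
    simpa using this

end Limits

/-! ### Alignment in the limit `μ → 0`. -/

section FamilyLimits

variable {n : ℕ} {M : Type*} [TopologicalSpace M] [ChartedSpace (EuclideanSpace ℝ (Fin n)) M]
  [IsManifold (𝓡 n) ∞ M] {P : Type*} [TopologicalSpace P] [Zero P] (S : GKSFamily n M P)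

namespace GKSFamily

theorem tendsto_H (p : M) : Tendsto (fun μ => S.H μ p) (𝓝 0) (𝓝 0) := by
  have h := S.H_continuous_at_zero p 0 (by norm_num)
  have h2 := tendsto_zero_iff_norm_tendsto_zero.1 h
  simp only [norm_iteratedFDeriv_zero, Function.comp_apply, extChartAt_to_inv] at h2
  exact tendsto_zero_iff_norm_tendsto_zero.2 h2

theorem jetTendsto (p : M) :
    JetTendsto (𝓝 0) (fun μ => coordMetric (S.metric μ) p) (coordMetric S.gbar p)
      (extChartAt (𝓡 n) p p) := by
  have hy := mem_extChartAt_target (I := 𝓡 n) p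
  refine jetTendsto_of_kerrSchild (fun μ => S.isLocalKerrSchild μ p) hy ?_ ?_ ?_
  · simpa only [Function.comp_apply, extChartAt_to_inv] using S.tendsto_H p
  · intro c
    have h := (S.H_continuous_at_zero p 1 (by norm_num))
    have h' := ((ContinuousMultilinearMap.apply ℝ (fun _ : Fin 1 => EuclideanSpace ℝ (Fin n)) ℝ
      (fun _ => EuclideanSpace.single c (1 : ℝ))).continuous.tendsto _).comp h
    simpa [Function.comp_def, iteratedFDeriv_one_apply, pderiv] using h'
  · intro c d
    have h := (S.H_continuous_at_zero p 2 le_rfl)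
    have h' := ((ContinuousMultilinearMap.apply ℝ (fun _ : Fin 2 => EuclideanSpace ℝ (Fin n)) ℝ
      ![EuclideanSpace.single c (1 : ℝ), EuclideanSpace.single d (1 : ℝ)]).continuous.tendsto
        _).comp h
    have e : ∀ μ, pderiv c (pderiv d (S.H μ ∘ (extChartAt (𝓡 n) p).symm)) (extChartAt (𝓡 n) p p) =
        iteratedFDeriv ℝ 2 (S.H μ ∘ (extChartAt (𝓡 n) p).symm) (extChartAt (𝓡 n) p p)
          ![EuclideanSpace.single c (1 : ℝ), EuclideanSpace.single d (1 : ℝ)] := fun μ => by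
      rw [pderiv_pderiv_eq (isOpen_extChartAt_target p) (S.isLocalKerrSchild μ p).H_smooth hy,
        iteratedFDeriv_two_apply]
      rfl
    simp only [e]
    simpa [Function.comp_def] using h'

theorem tendsto_weylAt {F : Filter P} (hF : F ≤ 𝓝 0) (p : M)
    {v w x z : P → TangentSpace (𝓡 n) p} {v₀ w₀ x₀ z₀ : TangentSpace (𝓡 n) p}
    (hv : Tendsto v F (𝓝 v₀)) (hw : Tendsto w F (𝓝 w₀)) (hx : Tendsto x F (𝓝 x₀))
    (hz : Tendsto z F (𝓝 z₀)) :
    Tendsto (fun μ => weylAt (S.metric μ) p (v μ) (w μ) (x μ) (z μ)) F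
      (𝓝 (weylAt S.gbar p v₀ w₀ x₀ z₀)) := by
  refine tendsto_finsetSum _ fun a _ => tendsto_finsetSum _ fun b _ =>
    tendsto_finsetSum _ fun c _ => tendsto_finsetSum _ fun d _ => ?_
  refine ((((?_ : Tendsto _ _ _).mul (tendsto_coords hv a)).mul (tendsto_coords hw b)).mul
    (tendsto_coords hx c)).mul (tendsto_coords hz d)
  exact ((S.jetTendsto p).weyl (fun μ => (S.isLocalKerrSchild μ p).isLocalMetric)
    (S.isLocalKerrSchild 0 p).background (mem_extChartAt_target p) a b c d).mono_left hF

theorem tendsto_metric {F : Filter P} (hF : F ≤ 𝓝 0) (p : M)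
    {v w : P → TangentSpace (𝓡 n) p} {v₀ w₀ : TangentSpace (𝓡 n) p}
    (hv : Tendsto v F (𝓝 v₀)) (hw : Tendsto w F (𝓝 w₀)) :
    Tendsto (fun μ => S.metric μ p (v μ) (w μ)) F (𝓝 (S.gbar p v₀ w₀)) := by
  simp only [S.metric_apply]
  have hH := (S.tendsto_H p).mono_left hF
  have h1 : Tendsto (fun μ => S.gbar p (v μ) (w μ)) F (𝓝 (S.gbar p v₀ w₀)) := by
    simp only [← eval₂_coordMetric S.gbar p]
    exact tendsto_finsetSum _ fun a _ => tendsto_finsetSum _ fun b _ =>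
      ((tendsto_coords hv a).const_mul _).mul (tendsto_coords hw b)
  have h2 := (((S.gbar p (S.k p)).continuous.tendsto v₀).comp hv).mul
    (((S.gbar p (S.k p)).continuous.tendsto w₀).comp hw)
  simpa using h1.sub ((hH.const_mul 2).mul h2)

/-- Alignment passes to the background. -/
theorem alignedToOrder_of_tendsto (hn : 2 ≤ n) (p : M) {r : ℕ} {l : P → TangentSpace (𝓡 n) p}
    {l₀ u : TangentSpace (𝓡 n) p} (hl : Tendsto l (𝓝[≠] 0) (𝓝 l₀))
    (hu : ∀ μ, μ ≠ 0 → S.metric μ p (l μ) u = 1)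
    (hm : ∃ m, IsNullFrame S.gbar p m ∧ ∀ a : Fin n, a.val = 0 → m a = l₀)
    (h : ∀ μ, μ ≠ 0 → AlignedToOrder (S.metric μ) p (l μ) r) :
    AlignedToOrder S.gbar p l₀ r := by
  have := S.zero_not_isolated
  have hF : 𝓝[≠] (0 : P) ≤ 𝓝 0 := nhdsWithin_le_nhds
  rw [alignedToOrder_iff hn]
  refine ⟨hm, fun i j s t hi hj hs ht hpos v hv w hw x hx z hz => ?_⟩
  have key : ∀ {i : ℤ}, (i = -1 ∨ i = 0 ∨ i = 1) → ∀ {v}, v ∈ boostFiltration S.gbar p l₀ i →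
      ∃ V : P → TangentSpace (𝓡 n) p, Tendsto V (𝓝[≠] 0) (𝓝 v) ∧
        ∀ μ, μ ≠ 0 → V μ ∈ boostFiltration (S.metric μ) p (l μ) i := by
    rintro i (rfl | rfl | rfl) v hv
    · exact ⟨fun _ => v, tendsto_const_nhds, fun μ _ => by rw [boostFiltration_neg_one]; trivial⟩
    · rw [mem_boostFiltration_zero] at hv
      -- The projection along `u` to the orthogonal complement of `l μ`; the correction tends to
      -- `ḡ(l₀,v) u = 0`.
      refine ⟨fun μ => v - S.metric μ p (l μ) v • u, ?_, fun μ hμ => ?_⟩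
      · have h1 := S.tendsto_metric hF p hl (tendsto_const_nhds (x := v))
        rw [hv] at h1
        simpa using (h1.smul_const u).const_sub v
      · rw [mem_boostFiltration_zero, map_sub, map_smul, hu μ hμ, smul_eq_mul, mul_one, sub_self]
    · rw [boostFiltration_one, Submodule.mem_span_singleton] at hv
      obtain ⟨c, rfl⟩ := hv
      refine ⟨fun μ => c • l μ, hl.const_smul c, fun μ _ => ?_⟩
      rw [boostFiltration_one]
      exact Submodule.smul_mem _ _ (Submodule.mem_span_singleton_self _)
  obtain ⟨V, hV, hV'⟩ := key hi hv
  obtain ⟨W, hW, hW'⟩ := key hj hw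
  obtain ⟨X, hX, hX'⟩ := key hs hx
  obtain ⟨Z, hZ, hZ'⟩ := key ht hz
  refine tendsto_nhds_unique (S.tendsto_weylAt hF p hV hW hX hZ) ?_
  refine tendsto_const_nhds.congr' ?_
  filter_upwards [self_mem_nhdsWithin] with μ hμ
  exact (((alignedToOrder_iff hn).1 (h μ hμ)).2 i j s t hi hj hs ht hpos _ (hV' μ hμ) _ (hW' μ hμ)
    _ (hX' μ hμ) _ (hZ' μ hμ)).symm

theorem le_wandMultiplicity_k (hn : 2 ≤ n) (p : M) (τ : ℕ)
    (h : ∀ μ, μ ≠ 0 → τ ≤ wandMultiplicity (S.metric μ) p (S.k p)) :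
    τ ≤ wandMultiplicity S.gbar p (S.k p) := by
  rcases eq_or_ne τ 0 with rfl | hτ
  · exact Nat.zero_le _
  have := S.zero_not_isolated
  -- Some nonzero parameter is needed to read off `τ ≤ 4`.
  obtain ⟨μ₀, hμ₀⟩ := (𝓝[≠] (0 : P)).nonempty_of_mem self_mem_nhdsWithin
  simp only [le_wandMultiplicity_iff hτ] at h ⊢
  obtain ⟨u, -, hu⟩ := (S.gbar_lorentz p).exists_partner (S.k_null p) (S.k_ne_zero p)
  refine ⟨(h μ₀ hμ₀).1, S.alignedToOrder_of_tendsto hn p (l := fun _ => S.k p) (u := u)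
    tendsto_const_nhds (fun μ _ => ?_) (S.exists_nullFrame_k hn p) fun μ hμ => (h μ hμ).2⟩
  rw [S.metric_k, (S.gbar_lorentz p).1, hu]

/-- As `H → 0`, `l μ` itself converges to `l₀`. The limit is null with `l₀ · k = 1`, so it starts a
null frame of the background; the auxiliary vector `u` is `k`. -/
theorem le_wandMultiplicity_of_tendsto (hn : 2 ≤ n) (p : M) (l : P → TangentSpace (𝓡 n) p)
    (l₀ : TangentSpace (𝓡 n) p) (χ : ℕ)
    (h : ∀ μ, μ ≠ 0 → S.metric μ p (l μ) (S.k p) = 1 ∧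
      χ ≤ wandMultiplicity (S.metric μ) p (l μ))
    (hl : Tendsto (fun μ => l μ - S.H μ p • S.k p) (𝓝[≠] 0) (𝓝 l₀)) :
    χ ≤ wandMultiplicity S.gbar p l₀ := by
  rcases eq_or_ne χ 0 with rfl | hχ
  · exact Nat.zero_le _
  have := S.zero_not_isolated
  have hF : 𝓝[≠] (0 : P) ≤ 𝓝 0 := nhdsWithin_le_nhds
  obtain ⟨μ₀, hμ₀⟩ := (𝓝[≠] (0 : P)).nonempty_of_mem self_mem_nhdsWithin
  simp only [le_wandMultiplicity_iff hχ] at h ⊢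
  have hl' : Tendsto l (𝓝[≠] 0) (𝓝 l₀) := by
    have := hl.add (((S.tendsto_H p).mono_left hF).smul_const (S.k p))
    simpa using this
  have hev : ∀ᶠ μ in 𝓝[≠] (0 : P), μ ≠ 0 := self_mem_nhdsWithin
  have hll : S.gbar p l₀ l₀ = 0 := by
    refine tendsto_nhds_unique (S.tendsto_metric hF p hl' hl') (tendsto_const_nhds.congr' ?_)
    filter_upwards [hev] with μ hμ
    obtain ⟨m, hm, hml, -⟩ := (h μ hμ).2.2
    have := hm ⟨0, by omega⟩ ⟨0, by omega⟩
    rw [hml _ rfl] at this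
    simpa using this.symm
  have hlk : S.gbar p l₀ (S.k p) = 1 := by
    refine tendsto_nhds_unique (S.tendsto_metric hF p hl' tendsto_const_nhds)
      (tendsto_const_nhds.congr' ?_)
    filter_upwards [hev] with μ hμ
    exact (h μ hμ).1.symm
  exact ⟨(h μ₀ hμ₀).2.1, S.alignedToOrder_of_tendsto hn p hl' (fun μ hμ => (h μ hμ).1)
    (S.exists_nullFrame hn p hll (S.k_null p) hlk) fun μ hμ => (h μ hμ).2.2⟩

theorem le_wandMultiplicity_of_eq (hn : 2 ≤ n) (p : M) (l : P → TangentSpace (𝓡 n) p)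
    (l₀ : TangentSpace (𝓡 n) p) (χ : ℕ)
    (h : ∀ μ, μ ≠ 0 → S.metric μ p (l μ) (S.k p) = 1 ∧
      χ ≤ wandMultiplicity (S.metric μ) p (l μ) ∧ l₀ = l μ - S.H μ p • S.k p) :
    χ ≤ wandMultiplicity S.gbar p l₀ := by
  refine S.le_wandMultiplicity_of_tendsto hn p l l₀ χ (fun μ hμ => ⟨(h μ hμ).1, (h μ hμ).2.1⟩) ?_
  refine tendsto_const_nhds.congr' ?_
  filter_upwards [self_mem_nhdsWithin] with μ hμ
  exact (h μ hμ).2.2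

theorem isMWAND_of_weylVanishes (hn : 2 ≤ n) (hgeo : IsGeodesic S.gbar S.k) (p : M)
    (h : WeylVanishesAt S.gbar p) (μ : P) : IsMWAND (S.metric μ) p (S.k p) := by
  rw [isMWAND_iff, ← S.alignedToOrder_k_iff hn hgeo μ p le_rfl]
  obtain ⟨m, hm, hl⟩ := S.exists_nullFrame_k hn p
  exact ⟨m, hm, hl, fun a b c d _ => h _ _ _ _⟩

end GKSFamily

end FamilyLimits

/-! ### The example metric: curvature and absence of multiple WANDs. -/

section TypeI

variable {m : ℕ}

/-- The Kronecker delta. -/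
def kronecker {n : ℕ} (a b : Fin n) : ℝ := if a = b then 1 else 0

theorem sum_kronecker_mul {n : ℕ} (a : Fin n) (f : Fin n → ℝ) :
    ∑ b, kronecker a b * f b = f a := by
  simp [kronecker]

theorem kronecker_comm {n : ℕ} (a b : Fin n) : kronecker a b = kronecker b a := by
  simp only [kronecker, eq_comm]

/-- Used to bring equal tensor components to a common normal form before `linear_combination`. -/
theorem kronecker_mul_eq {n : ℕ} (a b : Fin n) (f : Fin n → ℝ) :
    kronecker a b * f a = kronecker a b * f b := by
  unfold kronecker; split_ifs with h
  · rw [h]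
  · simp

/-- The exponents `p_i`: `-2, 1, …, 1` in the transverse directions `2, 3, …`. -/
def exponent (a : Fin (m + 4)) : ℝ := if a = 0 ∨ a = 1 then 0 else if a = 2 then -2 else 1

/-- The transverse metric components `e^{2 p_i v}`. -/
noncomputable def transverse (a : Fin (m + 4)) (y : EuclideanSpace ℝ (Fin (m + 4))) : ℝ :=
  -- The value `0` in the null directions makes the component formulas uniform in the indices, with
  -- no case distinctions.
  if a = 0 ∨ a = 1 then 0 else Real.exp (2 * exponent a * y 1)

/-- The metric `2 du dv - 2 μ du² + ∑ e^{2 p_i v} dx_i²`. -/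
noncomputable def exampleMetric (μ : ℝ) (y : EuclideanSpace ℝ (Fin (m + 4))) :
    Matrix (Fin (m + 4)) (Fin (m + 4)) ℝ :=
  fun a b => kronecker a b * transverse a y
    + (kronecker 0 a * kronecker 1 b + kronecker 1 a * kronecker 0 b)
    - 2 * μ * (kronecker 0 a * kronecker 0 b)

theorem transverse_zero (y : EuclideanSpace ℝ (Fin (m + 4))) : transverse 0 y = 0 := by
  simp [transverse]

theorem transverse_one (y : EuclideanSpace ℝ (Fin (m + 4))) : transverse 1 y = 0 := by
  simp [transverse]

theorem transverse_pos {a : Fin (m + 4)} (h0 : a ≠ 0) (h1 : a ≠ 1)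
    (y : EuclideanSpace ℝ (Fin (m + 4))) : 0 < transverse a y := by
  simp [transverse, h0, h1, Real.exp_pos]

theorem kronecker_mul_transverse_zero (a : Fin (m + 4)) (y : EuclideanSpace ℝ (Fin (m + 4))) :
    kronecker 0 a * transverse a y = 0 := by
  unfold kronecker; split_ifs with h
  · rw [← h, transverse_zero, mul_zero]
  · exact zero_mul _

theorem kronecker_mul_transverse_one (a : Fin (m + 4)) (y : EuclideanSpace ℝ (Fin (m + 4))) :
    kronecker 1 a * transverse a y = 0 := by
  unfold kronecker; split_ifs with h
  · rw [← h, transverse_one, mul_zero]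
  · exact zero_mul _

theorem hasFDerivAt_transverse (a : Fin (m + 4)) (y : EuclideanSpace ℝ (Fin (m + 4))) :
    HasFDerivAt (transverse a) ((2 * exponent a * transverse a y) •
      (EuclideanSpace.proj (𝕜 := ℝ) (1 : Fin (m + 4)) :
        EuclideanSpace ℝ (Fin (m + 4)) →L[ℝ] ℝ)) y := by
  by_cases h : a = 0 ∨ a = 1
  · have : (transverse a : EuclideanSpace ℝ (Fin (m + 4)) → ℝ) = fun _ => 0 := by
      funext y; simp [transverse, h]
    rw [this]
    simpa using hasFDerivAt_const (0 : ℝ) y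
  · have : (transverse a : EuclideanSpace ℝ (Fin (m + 4)) → ℝ) =
        fun y => Real.exp (2 * exponent a * y 1) := by
      funext y; simp [transverse, h]
    rw [this]
    have h1 : HasFDerivAt (fun y : EuclideanSpace ℝ (Fin (m + 4)) => y 1)
      (EuclideanSpace.proj (𝕜 := ℝ) (1 : Fin (m + 4)) :
        EuclideanSpace ℝ (Fin (m + 4)) →L[ℝ] ℝ) y :=
      (EuclideanSpace.proj (𝕜 := ℝ) (1 : Fin (m + 4))).hasFDerivAt
    have h2 := (h1.const_mul (2 * exponent a)).exp
    exact h2.congr_fderiv (by rw [smul_smul, mul_comm])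

theorem contDiff_transverse (a : Fin (m + 4)) : ContDiff ℝ ∞ (transverse a) := by
  unfold transverse
  split_ifs
  · exact contDiff_const
  · refine Real.contDiff_exp.comp (contDiff_const.mul ?_)
    exact (EuclideanSpace.proj (𝕜 := ℝ) (1 : Fin (m + 4))).contDiff

theorem pderiv_transverse (c a : Fin (m + 4)) (y : EuclideanSpace ℝ (Fin (m + 4))) :
    pderiv c (transverse a) y = kronecker 1 c * (2 * exponent a * transverse a y) := by
  rw [pderiv, (hasFDerivAt_transverse a y).fderiv]
  simp [kronecker]

theorem contDiff_exampleMetric (μ : ℝ) (a b : Fin (m + 4)) :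
    ContDiff ℝ ∞ (fun y => exampleMetric μ y a b) :=
  ((contDiff_const.mul (contDiff_transverse a)).add contDiff_const).sub contDiff_const

theorem pderiv_exampleMetric (μ : ℝ) (c a b : Fin (m + 4))
    (y : EuclideanSpace ℝ (Fin (m + 4))) :
    pderiv c (fun y => exampleMetric μ y a b) y =
      kronecker 1 c * (2 * (kronecker a b * (exponent a * transverse a y))) := by
  have ht : DifferentiableAt ℝ (transverse a) y := (hasFDerivAt_transverse a y).differentiableAt
  have h1 : DifferentiableAt ℝ (fun y => kronecker a b * transverse a y) y := ht.const_mul _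
  have h2 : ∀ r : ℝ, DifferentiableAt ℝ (fun _ : EuclideanSpace ℝ (Fin (m + 4)) => r) y :=
    fun r => differentiableAt_const r
  simp only [exampleMetric]
  rw [pderiv_sub (h1.fun_add (h2 _)) (h2 _), pderiv_add h1 (h2 _), pderiv_const_mul _ ht,
    pderiv_const, pderiv_const, pderiv_transverse]
  ring

theorem pderiv_pderiv_exampleMetric (μ : ℝ) (c d a b : Fin (m + 4))
    (y : EuclideanSpace ℝ (Fin (m + 4))) :
    pderiv c (pderiv d fun y => exampleMetric μ y a b) y =
      kronecker 1 c * kronecker 1 d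
        * (4 * (kronecker a b * (exponent a ^ 2 * transverse a y))) := by
  have ht : DifferentiableAt ℝ (transverse a) y := (hasFDerivAt_transverse a y).differentiableAt
  have : (pderiv d fun y => exampleMetric μ y a b) =
      fun y => (kronecker 1 d * (2 * (kronecker a b * exponent a))) * transverse a y := by
    funext z
    rw [pderiv_exampleMetric]; ring
  rw [this, pderiv_const_mul _ ht, pderiv_transverse]
  ring

/-- The inverse of `exampleMetric`. -/
noncomputable def exampleInverse (μ : ℝ) (y : EuclideanSpace ℝ (Fin (m + 4))) :
    Matrix (Fin (m + 4)) (Fin (m + 4)) ℝ :=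
  -- In the null directions `transverse` is `0` and its inverse is `0` by convention, so this term
  -- is supported on the transverse block.
  fun a b => kronecker a b * (transverse a y)⁻¹
    + (kronecker 0 a * kronecker 1 b + kronecker 1 a * kronecker 0 b)
    + 2 * μ * (kronecker 1 a * kronecker 1 b)

theorem exampleMetric_mul_inverse (μ : ℝ) (y : EuclideanSpace ℝ (Fin (m + 4))) :
    exampleMetric μ y * exampleInverse μ y = 1 := by
  ext a b
  rw [Matrix.mul_apply]
  have e1 : ∀ c, exampleMetric μ y a c * exampleInverse μ y c b =
      kronecker a c * (transverse a y * exampleInverse μ y c b)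
      + kronecker 1 c * (kronecker 0 a * exampleInverse μ y c b)
      + kronecker 0 c * ((kronecker 1 a - 2 * μ * kronecker 0 a) * exampleInverse μ y c b) :=
    fun c => by simp only [exampleMetric]; ring
  simp only [e1, Finset.sum_add_distrib, sum_kronecker_mul]
  rw [Matrix.one_apply]
  by_cases ha0 : a = 0
  · subst ha0
    simp [exampleInverse, transverse_zero, transverse_one, kronecker]
    split_ifs <;> ring
  by_cases ha1 : a = 1
  · subst ha1
    simp [exampleInverse, transverse_zero, transverse_one, kronecker]
  have hE := (transverse_pos ha0 ha1 y).ne'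
  simp [exampleInverse, kronecker, Ne.symm ha0, Ne.symm ha1, hE]

theorem exampleMetric_inv (μ : ℝ) (y : EuclideanSpace ℝ (Fin (m + 4))) :
    (exampleMetric μ y)⁻¹ = exampleInverse μ y :=
  Matrix.inv_eq_right_inv (exampleMetric_mul_inverse μ y)

theorem exampleMetric_symm (μ : ℝ) (y : EuclideanSpace ℝ (Fin (m + 4))) (a b : Fin (m + 4)) :
    exampleMetric μ y a b = exampleMetric μ y b a := by
  have h := kronecker_mul_eq a b fun a => transverse a y
  simp only [exampleMetric, kronecker_comm b a] at h ⊢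
  rw [h]; ring

theorem isLocalMetric_exampleMetric (μ : ℝ) :
    IsLocalMetric Set.univ (exampleMetric (m := m) μ) where
  isOpen := isOpen_univ
  smooth i j := (contDiff_exampleMetric μ i j).contDiffOn
  symm z _ i j := exampleMetric_symm μ z i j
  det_ne z _ := by
    have := congrArg Matrix.det (exampleMetric_mul_inverse μ z)
    rw [Matrix.det_mul, Matrix.det_one] at this
    exact IsUnit.of_mul_eq_one _ this

theorem christoffelLower_exampleMetric (μ : ℝ) (y : EuclideanSpace ℝ (Fin (m + 4)))
    (l i j : Fin (m + 4)) :
    christoffelLower (exampleMetric μ) l i j y =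
      kronecker j l * (kronecker 1 i * (exponent l * transverse l y))
      + kronecker i l * (kronecker 1 j * (exponent l * transverse l y))
      - kronecker 1 l * (kronecker i j * (exponent i * transverse i y)) := by
  have h1 := kronecker_mul_eq j l fun a => exponent a * transverse a y
  have h2 := kronecker_mul_eq i l fun a => exponent a * transverse a y
  simp only [christoffelLower, pderiv_exampleMetric, h1, h2]
  ring

theorem exponent_mul_transverse (a : Fin (m + 4)) (y : EuclideanSpace ℝ (Fin (m + 4))) :
    (transverse a y)⁻¹ * (exponent a * transverse a y) = exponent a := by
  by_cases h : a = 0 ∨ a = 1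
  · simp [exponent, h]
  · push Not at h
    have := (transverse_pos h.1 h.2 y).ne'
    field_simp

theorem christoffel_exampleMetric (μ : ℝ) (y : EuclideanSpace ℝ (Fin (m + 4)))
    (e i j : Fin (m + 4)) :
    christoffel (exampleMetric μ) e i j y =
      kronecker j e * kronecker 1 i * exponent e + kronecker i e * kronecker 1 j * exponent e
      - (kronecker 0 e + 2 * μ * kronecker 1 e) * (kronecker i j * (exponent i * transverse i y)) := by
  have e1 : ∀ l, (exampleMetric μ y)⁻¹ e l * christoffelLower (exampleMetric μ) l i j y =
      kronecker e l * ((transverse e y)⁻¹ * christoffelLower (exampleMetric μ) l i j y)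
      + kronecker 1 l * ((kronecker 0 e + 2 * μ * kronecker 1 e)
        * christoffelLower (exampleMetric μ) l i j y)
      + kronecker 0 l * (kronecker 1 e * christoffelLower (exampleMetric μ) l i j y) := fun l => by
    rw [exampleMetric_inv, exampleInverse]; ring
  rw [christoffel_eq_sum]
  simp only [e1, Finset.sum_add_distrib, sum_kronecker_mul]
  have h1 : kronecker 1 e * (transverse e y)⁻¹ = 0 := by
    unfold kronecker; split_ifs with h
    · rw [← h, transverse_one]; simp
    · simp
  have h2 := exponent_mul_transverse e y
  have h3 : kronecker (1 : Fin (m + 4)) 0 = 0 := by simp [kronecker]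
  have h4 : kronecker (1 : Fin (m + 4)) 1 = 1 := by simp [kronecker]
  simp only [christoffelLower_exampleMetric, transverse_zero, transverse_one, h3, h4]
  linear_combination (kronecker j e * kronecker 1 i + kronecker i e * kronecker 1 j) * h2
    - (kronecker i j * (exponent i * transverse i y)) * h1

/-- With `E_i` the transverse components, the independent nonzero components are `R_{1i1i} = -p_i²
E_i` and `R_{ijij} = -2μ p_i p_j E_i E_j` for `i ≠ j`. -/
theorem riemann_exampleMetric (μ : ℝ) (y : EuclideanSpace ℝ (Fin (m + 4)))
    (a b c d : Fin (m + 4)) :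
    riemann (exampleMetric μ) a b c d y =
      (kronecker a d * (exponent a ^ 2 * transverse a y)) * (kronecker 1 b * kronecker 1 c)
      + (kronecker 1 a * kronecker 1 d) * (kronecker b c * (exponent b ^ 2 * transverse b y))
      - (kronecker 1 a * kronecker 1 c) * (kronecker b d * (exponent b ^ 2 * transverse b y))
      - (kronecker a c * (exponent a ^ 2 * transverse a y)) * (kronecker 1 b * kronecker 1 d)
      + 2 * μ * ((kronecker a d * (exponent a * transverse a y))
          * (kronecker b c * (exponent b * transverse b y))
        - (kronecker a c * (exponent a * transverse a y))
          * (kronecker b d * (exponent b * transverse b y))) := by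
  have key : ∀ a d b c : Fin (m + 4), ∑ e, christoffelLower (exampleMetric μ) e a d y
      * christoffel (exampleMetric μ) e b c y =
      kronecker 1 a * kronecker 1 b * (kronecker c d * (exponent d ^ 2 * transverse d y))
      + kronecker 1 a * kronecker 1 c * (kronecker b d * (exponent d ^ 2 * transverse d y))
      + kronecker 1 d * kronecker 1 b * (kronecker c a * (exponent a ^ 2 * transverse a y))
      + kronecker 1 d * kronecker 1 c * (kronecker b a * (exponent a ^ 2 * transverse a y))
      + 2 * μ * ((kronecker a d * (exponent a * transverse a y))
          * (kronecker b c * (exponent b * transverse b y))) := by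
    intro a d b c
    have e1 : ∀ e, christoffelLower (exampleMetric μ) e a d y
        * christoffel (exampleMetric μ) e b c y =
        kronecker d e * (kronecker 1 a * (exponent e * transverse e y)
          * christoffel (exampleMetric μ) e b c y)
        + kronecker a e * (kronecker 1 d * (exponent e * transverse e y)
          * christoffel (exampleMetric μ) e b c y)
        - kronecker 1 e * ((kronecker a d * (exponent a * transverse a y))
          * christoffel (exampleMetric μ) e b c y) := fun e => by
      rw [christoffelLower_exampleMetric]; ring
    rw [Finset.sum_congr rfl fun e _ => e1 e]
    simp only [Finset.sum_add_distrib, Finset.sum_sub_distrib, sum_kronecker_mul]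
    simp only [christoffel_exampleMetric]
    have h3 : kronecker (0 : Fin (m + 4)) 1 = 0 := by simp [kronecker]
    have h4 : kronecker (1 : Fin (m + 4)) 1 = 1 := by simp [kronecker]
    have h5 : exponent (1 : Fin (m + 4)) = 0 := by simp [exponent]
    rw [h3, h4, h5]
    have hd0 := kronecker_mul_transverse_zero d y
    have hd1 := kronecker_mul_transverse_one d y
    have ha0 := kronecker_mul_transverse_zero a y
    have ha1 := kronecker_mul_transverse_one a y
    linear_combination
      (-(kronecker 1 a * exponent d * (kronecker b c * (exponent b * transverse b y)))) * hd0
      - (kronecker 1 a * exponent d * (2 * μ) * (kronecker b c * (exponent b * transverse b y)))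
        * hd1
      - (kronecker 1 d * exponent a * (kronecker b c * (exponent b * transverse b y))) * ha0
      - (kronecker 1 d * exponent a * (2 * μ) * (kronecker b c * (exponent b * transverse b y)))
        * ha1
  rw [(isLocalMetric_exampleMetric μ).riemann_eq (Set.mem_univ y), key, key]
  simp only [pderiv_pderiv_exampleMetric]
  have h1 := kronecker_mul_eq b d fun a => exponent a ^ 2 * transverse a y
  have h2 := kronecker_mul_eq b c fun a => exponent a ^ 2 * transverse a y
  have h3 := kronecker_mul_eq c d fun a => exponent a ^ 2 * transverse a y
  simp only [kronecker_comm d c, kronecker_comm b a, kronecker_comm c a, kronecker_comm d a] at *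
  linear_combination (kronecker 1 a * kronecker 1 c) * (-1) * h1
    + (kronecker 1 a * kronecker 1 d) * h2
    - (kronecker 1 b * kronecker 1 a) * h3

variable (μ : ℝ) (y : EuclideanSpace ℝ (Fin (m + 4)))

theorem ricci_exampleMetric (b d : Fin (m + 4)) :
    ricci (exampleMetric μ) b d y =
      -(∑ a, exponent (m := m) a ^ 2) * (kronecker 1 b * kronecker 1 d)
      - 2 * μ * (∑ a, exponent (m := m) a) * (kronecker b d * (exponent b * transverse b y)) := by
  have hV : ∀ a : Fin (m + 4), (transverse a y)⁻¹ * kronecker 1 a = 0 := fun a => by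
    unfold kronecker; split_ifs with h
    · rw [← h, transverse_one]; simp
    · simp
  have h0 : exponent (0 : Fin (m + 4)) = 0 := by simp [exponent]
  have h1 : exponent (1 : Fin (m + 4)) = 0 := by simp [exponent]
  have h3 : kronecker (1 : Fin (m + 4)) 0 = 0 := by simp [kronecker]
  have h4 : kronecker (1 : Fin (m + 4)) 1 = 1 := by simp [kronecker]
  have e1 : ∀ a c, (exampleMetric μ y)⁻¹ a c * riemann (exampleMetric μ) c b a d y =
      kronecker a c * ((transverse a y)⁻¹ * riemann (exampleMetric μ) c b a d y)
      + kronecker 1 c * ((kronecker 0 a + 2 * μ * kronecker 1 a)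
        * riemann (exampleMetric μ) c b a d y)
      + kronecker 0 c * (kronecker 1 a * riemann (exampleMetric μ) c b a d y) := fun a c => by
    rw [exampleMetric_inv, exampleInverse]; ring
  have e2 : ∀ a, (transverse a y)⁻¹ * riemann (exampleMetric μ) a b a d y =
      -exponent a ^ 2 * (kronecker 1 b * kronecker 1 d)
      + 2 * μ * (kronecker b a * (kronecker a d * (exponent a * (exponent b * transverse b y))))
      - exponent a * (2 * μ * (kronecker b d * (exponent b * transverse b y))) := fun a => by
    have ht := exponent_mul_transverse a y
    have ha : kronecker a a = 1 := by simp [kronecker]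
    rw [riemann_exampleMetric, ha, kronecker_comm b a]
    linear_combination ((kronecker a d * (exponent a ^ 2 * transverse a y)) * kronecker 1 b
        + kronecker 1 d * (kronecker a b * (exponent b ^ 2 * transverse b y))
        - kronecker 1 a * (kronecker b d * (exponent b ^ 2 * transverse b y))) * hV a
      + (-exponent a * (kronecker 1 b * kronecker 1 d)
        + 2 * μ * (kronecker a d * (kronecker a b * (exponent b * transverse b y))
          - kronecker b d * (exponent b * transverse b y))) * ht
  have e3 : ∀ a, (kronecker 0 a + 2 * μ * kronecker 1 a) * riemann (exampleMetric μ) 1 b a d y =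
      kronecker 0 a * riemann (exampleMetric μ) 1 b a d y
      + kronecker 1 a * (2 * μ * riemann (exampleMetric μ) 1 b a d y) := fun a => by ring
  rw [(isLocalMetric_exampleMetric μ).ricci_eq (Set.mem_univ y)]
  simp only [e1, Finset.sum_add_distrib, sum_kronecker_mul, e3]
  simp only [e2, Finset.sum_add_distrib, Finset.sum_sub_distrib, ← Finset.mul_sum,
    ← Finset.sum_mul, sum_kronecker_mul, Finset.sum_neg_distrib]
  simp only [riemann_exampleMetric, h0, h1, h3, h4]
  have k0 := kronecker_mul_eq b 0 fun a => exponent a ^ 2 * transverse a y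
  have k1 := kronecker_mul_eq b 1 fun a => exponent a ^ 2 * transverse a y
  simp only [h0, h1] at k0 k1
  linear_combination kronecker 1 d * k0 + 2 * μ * kronecker 1 d * k1

/-- The bilinear form with matrix `diag f`. -/
noncomputable def diagForm {n : ℕ} (f : Fin n → ℝ) (v w : EuclideanSpace ℝ (Fin n)) : ℝ :=
  ∑ i, f i * v i * w i

theorem eval₂_kronecker_mul {n : ℕ} (f : Fin n → ℝ) (v w : EuclideanSpace ℝ (Fin n)) :
    eval₂ (fun a b => kronecker a b * f a) v w = diagForm f v w := by
  simp only [eval₂, diagForm, mul_assoc, sum_kronecker_mul]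

theorem eval₂_kronecker_kronecker {n : ℕ} (i j : Fin n) (v w : EuclideanSpace ℝ (Fin n)) :
    eval₂ (fun a b => kronecker i a * kronecker j b) v w = v i * w j := by
  have : ∀ a b, kronecker i a * kronecker j b * v a * w b =
    kronecker i a * (kronecker j b * (v a * w b)) := fun a b => by ring
  simp only [eval₂, this, ← Finset.mul_sum, sum_kronecker_mul]

theorem eval₂_exampleMetric (v w : EuclideanSpace ℝ (Fin (m + 4))) :
    eval₂ (fun a b => exampleMetric μ y a b) v w =
      diagForm (fun a => transverse a y) v w + (v 0 * w 1 + v 1 * w 0) - 2 * μ * (v 0 * w 0) := by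
  rw [← eval₂_kronecker_mul, ← eval₂_kronecker_kronecker 0 1, ← eval₂_kronecker_kronecker 1 0,
    ← eval₂_kronecker_kronecker 0 0]
  simp only [eval₂, exampleMetric, Finset.mul_sum, ← Finset.sum_sub_distrib,
    ← Finset.sum_add_distrib]
  exact Finset.sum_congr rfl fun a _ => Finset.sum_congr rfl fun b _ => by ring

theorem eval₂_ricci_exampleMetric (v w : EuclideanSpace ℝ (Fin (m + 4))) :
    eval₂ (fun b d => ricci (exampleMetric μ) b d y) v w =
      -(∑ a, exponent (m := m) a ^ 2) * (v 1 * w 1)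
      - 2 * μ * (∑ a, exponent (m := m) a) * diagForm (fun a => exponent a * transverse a y) v w := by
  rw [← eval₂_kronecker_mul, ← eval₂_kronecker_kronecker 1 1]
  simp only [ricci_exampleMetric]
  generalize -(∑ a, exponent (m := m) a ^ 2) = Q
  generalize 2 * μ * (∑ a, exponent (m := m) a) = R
  simp only [eval₂, Finset.mul_sum, ← Finset.sum_sub_distrib]
  exact Finset.sum_congr rfl fun a _ => Finset.sum_congr rfl fun b _ => by ring

theorem eval₄_riemann_exampleMetric (v w x z : EuclideanSpace ℝ (Fin (m + 4))) :
    eval₄ (fun a b c d => riemann (exampleMetric μ) a b c d y) v w x z =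
      diagForm (fun a => exponent a ^ 2 * transverse a y) v z * (w 1 * x 1)
      + (v 1 * z 1) * diagForm (fun a => exponent a ^ 2 * transverse a y) w x
      - (v 1 * x 1) * diagForm (fun a => exponent a ^ 2 * transverse a y) w z
      - diagForm (fun a => exponent a ^ 2 * transverse a y) v x * (w 1 * z 1)
      + 2 * μ * (diagForm (fun a => exponent a * transverse a y) v z
          * diagForm (fun a => exponent a * transverse a y) w x
        - diagForm (fun a => exponent a * transverse a y) v x
          * diagForm (fun a => exponent a * transverse a y) w z) := by
  simp only [← eval₂_kronecker_mul, ← eval₂_kronecker_kronecker 1 1]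
  simp only [← eval₂_mul_eval₂ _ _ v w x z, ← eval₂_mul_eval₂' _ _ v w x z]
  simp only [eval₄, riemann_exampleMetric, Finset.mul_sum, ← Finset.sum_sub_distrib,
    ← Finset.sum_add_distrib]
  exact Finset.sum_congr rfl fun a _ => Finset.sum_congr rfl fun b _ =>
    Finset.sum_congr rfl fun c _ => Finset.sum_congr rfl fun d _ => by ring

theorem two_ne_zero_fin : (2 : Fin (m + 4)) ≠ 0 := by
  rw [Ne, Fin.ext_iff, Fin.val_two]; simp

theorem two_ne_one_fin : (2 : Fin (m + 4)) ≠ 1 := by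
  rw [Ne, Fin.ext_iff, Fin.val_two]; simp

theorem exponent_succ_succ_succ (i : Fin (m + 1)) :
    exponent (m := m) i.succ.succ.succ = 1 := by
  have h0 : i.succ.succ.succ ≠ 0 := Fin.succ_ne_zero _
  have h1 : i.succ.succ.succ ≠ 1 := by rw [Ne, Fin.ext_iff]; simp
  have h2 : i.succ.succ.succ ≠ 2 := by rw [Ne, Fin.ext_iff, Fin.val_two]; simp
  rw [exponent, if_neg (by tauto), if_neg h2]

theorem exponent_two : exponent (2 : Fin (m + 4)) = -2 := by
  simp [exponent, two_ne_zero_fin, two_ne_one_fin]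

/-- The two null indices contribute `f 0` each, index `2` gives `f (-2)`, and `m + 1` transverse
directions remain. -/
theorem sum_comp_exponent (f : ℝ → ℝ) :
    ∑ a, f (exponent (m := m) a) = 2 * f 0 + f (-2) + (m + 1) * f 1 := by
  have e0 : exponent (0 : Fin (m + 4)) = 0 := by simp [exponent]
  have e1 : exponent (Fin.succ 0 : Fin (m + 4)) = 0 := by simp [exponent]
  have e2 : exponent (Fin.succ (Fin.succ 0) : Fin (m + 4)) = -2 := exponent_two
  rw [Fin.sum_univ_succ, Fin.sum_univ_succ, Fin.sum_univ_succ]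
  simp only [exponent_succ_succ_succ, e0, e1, e2]
  simp
  ring

theorem sum_exponent : ∑ a, exponent (m := m) a = m - 1 := by
  rw [sum_comp_exponent fun x => x]; ring

theorem sum_exponent_sq : ∑ a, exponent (m := m) a ^ 2 = m + 5 := by
  rw [sum_comp_exponent fun x => x ^ 2]; ring

theorem exponent_eq {i : Fin (m + 4)} (h0 : i ≠ 0) (h1 : i ≠ 1) :
    exponent i = -2 ∨ exponent i = 1 := by
  by_cases h2 : i = 2
  · exact Or.inl (h2 ▸ exponent_two)
  · simp [exponent, h0, h1, h2]

theorem diagForm_lin {n : ℕ} (c d : ℝ) (f g : Fin n → ℝ) (v w : EuclideanSpace ℝ (Fin n)) :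
    diagForm (fun i => c * f i + d * g i) v w = c * diagForm f v w + d * diagForm g v w := by
  simp only [diagForm, Finset.mul_sum, ← Finset.sum_add_distrib]
  exact Finset.sum_congr rfl fun i _ => by ring

theorem diagForm_comm {n : ℕ} (f : Fin n → ℝ) (v w : EuclideanSpace ℝ (Fin n)) :
    diagForm f v w = diagForm f w v :=
  Finset.sum_congr rfl fun i _ => by ring

theorem diagForm_single {n : ℕ} (f : Fin n → ℝ) (v : EuclideanSpace ℝ (Fin n)) (i : Fin n) :
    diagForm f v (EuclideanSpace.single i 1) = f i * v i := by
  simp [diagForm]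

theorem diagForm_add_smul {n : ℕ} (f : Fin n → ℝ) (v w x : EuclideanSpace ℝ (Fin n)) (r s : ℝ) :
    diagForm f v (r • w + s • x) = r * diagForm f v w + s * diagForm f v x := by
  simp only [diagForm, Finset.mul_sum, ← Finset.sum_add_distrib]
  exact Finset.sum_congr rfl fun i _ => by simp; ring

theorem eq_zero_of_diagForm_eq_zero {f : Fin (m + 4) → ℝ} (h0 : f 0 = 0) (h1 : f 1 = 0)
    (hf : ∀ i, i ≠ 0 → i ≠ 1 → 0 < f i) {v : EuclideanSpace ℝ (Fin (m + 4))}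
    (h : diagForm f v v = 0) {i : Fin (m + 4)} (hi0 : i ≠ 0) (hi1 : i ≠ 1) : v i = 0 := by
  have hn : ∀ i, 0 ≤ f i * v i * v i := fun i => by
    rw [mul_assoc]
    refine mul_nonneg ?_ (mul_self_nonneg _)
    by_cases hi0 : i = 0
    · rw [hi0, h0]
    by_cases hi1 : i = 1
    · rw [hi1, h1]
    exact (hf i hi0 hi1).le
  have := (Finset.sum_eq_zero_iff_of_nonneg fun i _ => hn i).1 h i (Finset.mem_univ i)
  simpa [(hf i hi0 hi1).ne'] using this

theorem diagForm_eq_zero {f : Fin (m + 4) → ℝ} (h0 : f 0 = 0) (h1 : f 1 = 0)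
    {v : EuclideanSpace ℝ (Fin (m + 4))} (hv : ∀ i, i ≠ 0 → i ≠ 1 → v i = 0)
    (w : EuclideanSpace ℝ (Fin (m + 4))) : diagForm f v w = 0 := by
  refine Finset.sum_eq_zero fun i _ => ?_
  by_cases hi0 : i = 0
  · simp [hi0, h0]
  by_cases hi1 : i = 1
  · simp [hi1, h1]
  simp [hv i hi0 hi1]

variable {μ y} in
/-- The Weyl tensor of `exampleMetric` has no multiple aligned null direction. -/
theorem eq_zero_of_weyl_exampleMetric (hμ : μ ≠ 0) {l : EuclideanSpace ℝ (Fin (m + 4))}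
    (hl : eval₂ (fun a b => exampleMetric μ y a b) l l = 0)
    (h : ∀ w z, eval₂ (fun a b => exampleMetric μ y a b) l z = 0 →
      eval₄ (fun a b c d => weyl (exampleMetric μ) a b c d y) l w l z = 0) : l = 0 := by
  have hm : (0 : ℝ) ≤ m := Nat.cast_nonneg m
  have hcoef : ((m + 4 : ℕ) : ℝ) - 2 = m + 2 := by push_cast; ring
  -- `n - 2 = m + 2` times the Weyl component: since `g(l,l) = g(l,z) = 0`, the scalar curvature
  -- term and two of the Ricci terms disappear.
  have key : ∀ w z, eval₂ (fun a b => exampleMetric μ y a b) l z = 0 →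
      (m + 2) * eval₄ (fun a b c d => riemann (exampleMetric μ) a b c d y) l w l z
        + eval₂ (fun a b => exampleMetric μ y a b) w l
          * eval₂ (fun b d => ricci (exampleMetric μ) b d y) l z
        - eval₂ (fun a b => exampleMetric μ y a b) w z
          * eval₂ (fun b d => ricci (exampleMetric μ) b d y) l l = 0 := by
    intro w z hz
    have := h w z hz
    rw [eval₄_weyl, hl, hz, hcoef] at this
    have h2 : (m : ℝ) + 2 ≠ 0 := by positivity
    field_simp at this
    linear_combination this
  simp only [eval₂_exampleMetric, eval₂_ricci_exampleMetric, eval₄_riemann_exampleMetric,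
    sum_exponent, sum_exponent_sq] at key hl
  have h01 : (0 : Fin (m + 4)) ≠ 1 := by simp
  have p0 : exponent (0 : Fin (m + 4)) = 0 := by simp [exponent]
  have p1 : exponent (1 : Fin (m + 4)) = 0 := by simp [exponent]
  have h20 := two_ne_zero_fin (m := m)
  have h21 := two_ne_one_fin (m := m)
  have finish : (∀ i, i ≠ 0 → i ≠ 1 → l i = 0) → l 0 = 0 → l 1 = 0 → l = 0 := by
    intro hi h0 h1
    ext i
    by_cases hi0 : i = 0
    · rw [hi0]; exact h0
    by_cases hi1 : i = 1
    · rw [hi1]; exact h1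
    exact hi i hi0 hi1
  have hE : ∀ i : Fin (m + 4), i ≠ 0 → i ≠ 1 → 0 < transverse i y :=
    fun i h0 h1 => transverse_pos h0 h1 y
  -- `r` is the gradient of `v`, so `g(r,w) = w 1`. The next vector `t = ∂_u` satisfies `g(t,w) = w
  -- 1 - 2μ w 0`. Both have no transverse part.
  obtain ⟨r, r0, r1, hr⟩ : ∃ r : EuclideanSpace ℝ (Fin (m + 4)), r 0 = 1 ∧ r 1 = 2 * μ ∧
      ∀ i, i ≠ 0 → i ≠ 1 → r i = 0 :=
    ⟨EuclideanSpace.single 0 (1 : ℝ) + EuclideanSpace.single 1 (2 * μ), by simp, by simp,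
      fun i h0 h1 => by simp [h0, h1]⟩
  obtain ⟨t, t0, t1, ht⟩ : ∃ t : EuclideanSpace ℝ (Fin (m + 4)), t 0 = 1 ∧ t 1 = 0 ∧
      ∀ i, i ≠ 0 → i ≠ 1 → t i = 0 :=
    ⟨EuclideanSpace.single 0 (1 : ℝ), by simp, by simp, fun i h0 h1 => by simp [h0]⟩
  have dr0 : ∀ v, diagForm (fun a => transverse a y) r v = 0 :=
    diagForm_eq_zero (transverse_zero y) (transverse_one y) hr
  have dr1 : ∀ v, diagForm (fun a => exponent a * transverse a y) r v = 0 :=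
    diagForm_eq_zero (by simp [p0]) (by simp [p1]) hr
  have dr2 : ∀ v, diagForm (fun a => exponent a ^ 2 * transverse a y) r v = 0 :=
    diagForm_eq_zero (by simp [p0]) (by simp [p1]) hr
  have dt0 : ∀ v, diagForm (fun a => transverse a y) t v = 0 :=
    diagForm_eq_zero (transverse_zero y) (transverse_one y) ht
  have dt1 : ∀ v, diagForm (fun a => exponent a * transverse a y) t v = 0 :=
    diagForm_eq_zero (by simp [p0]) (by simp [p1]) ht
  have dt2 : ∀ v, diagForm (fun a => exponent a ^ 2 * transverse a y) t v = 0 :=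
    diagForm_eq_zero (by simp [p0]) (by simp [p1]) ht
  -- Case `l ⊥ r`. Taking `w = z = r` gives a diagonal form in the transverse part of `l` with
  -- weights `(m+2) p_i² - (m-1) p_i`, which are positive: `6m + 6` for `p_i = -2` and `3` for `p_i
  -- = 1`.
  by_cases hlr : l 1 = 0
  · have h1 := key r r (by rw [diagForm_comm, dr0, r0, r1, hlr]; ring)
    simp only [diagForm_comm _ l r, dr0, dr1, dr2, r0, r1, hlr] at h1
    have h2 : diagForm (fun i => (m + 2) * (exponent i ^ 2 * transverse i y)
        + (-(m - 1)) * (exponent i * transverse i y)) l l = 0 := by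
      rw [diagForm_lin]
      have : (4 * μ ^ 2) * ((m + 2) * diagForm (fun i => exponent i ^ 2 * transverse i y) l l
        + (-(m - 1)) * diagForm (fun i => exponent i * transverse i y) l l) = 0 := by
        linear_combination -h1
      exact (mul_eq_zero.1 this).resolve_left (by positivity)
    have h3 : ∀ i, i ≠ 0 → i ≠ 1 → l i = 0 := fun i hi0 hi1 =>
      eq_zero_of_diagForm_eq_zero (by simp [p0]) (by simp [p1]) (fun j hj0 hj1 => by
        have := hE j hj0 hj1
        rcases exponent_eq hj0 hj1 with h | h <;> rw [h] <;> nlinarith) h2 hi0 hi1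
    refine finish h3 ?_ hlr
    rw [diagForm_eq_zero (transverse_zero y) (transverse_one y) h3, hlr] at hl
    have : (-2 * μ) * (l 0 * l 0) = 0 := by linear_combination hl
    simpa [hμ] using this
  -- Case `l ⊥ t`. Taking `w = z = t` amounts to `Ric(l,l) = 0`. Eliminating `l 0` by nullness
  -- leaves the weights `(m+5) - (m-1) p_i`, that is, `3m + 3` and `6`.
  by_cases hlt : l 1 = 2 * μ * l 0
  · have h1 := key t t (by rw [diagForm_comm, dt0, t0, t1, hlt]; ring)
    simp only [diagForm_comm _ l t, dt0, dt1, dt2, t0, t1] at h1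
    have h2 : diagForm (fun i => (m + 5) * transverse i y
        + (-(m - 1)) * (exponent i * transverse i y)) l l = 0 := by
      rw [diagForm_lin]
      have : (4 * μ ^ 2) * ((m + 5) * diagForm (fun i => transverse i y) l l
        + (-(m - 1)) * diagForm (fun i => exponent i * transverse i y) l l) = 0 := by
        rw [hlt] at hl h1
        linear_combination 4 * μ ^ 2 * (m + 5) * hl + h1
      exact (mul_eq_zero.1 this).resolve_left (by positivity)
    have h3 : ∀ i, i ≠ 0 → i ≠ 1 → l i = 0 := fun i hi0 hi1 =>
      eq_zero_of_diagForm_eq_zero (by simp [p0, transverse_zero]) (by simp [p1, transverse_one])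
        (fun j hj0 hj1 => by
          have := hE j hj0 hj1
          rcases exponent_eq hj0 hj1 with h | h <;> rw [h] <;> nlinarith) h2 hi0 hi1
    rw [diagForm_eq_zero (transverse_zero y) (transverse_one y) h3, hlt] at hl
    have h4 : (2 * μ) * (l 0 * l 0) = 0 := by linear_combination hl
    have h5 : l 0 = 0 := by simpa [hμ] using h4
    exact absurd (by rw [hlt, h5, mul_zero]) hlr
  exfalso
  have h3 : ∀ i, i ≠ 0 → i ≠ 1 → l i = 0 := fun i hi0 hi1 => by
    -- In the generic case, `z = E_i l_i r - l_1 e_i` is orthogonal to `l`; together with `w = t` it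
    -- isolates the component `l_i`, with the nonzero weight found before.
    obtain ⟨z, z0, z1, hz⟩ : ∃ z : EuclideanSpace ℝ (Fin (m + 4)),
        z 0 = transverse i y * l i ∧ z 1 = transverse i y * l i * (2 * μ) ∧
        ∀ (f : Fin (m + 4) → ℝ) v, diagForm f v z =
          transverse i y * l i * diagForm f v r + (-l 1) * (f i * v i) :=
      ⟨(transverse i y * l i) • r + (-l 1) • EuclideanSpace.single i (1 : ℝ),
        by simp [hi0.symm, r0], by simp [hi1.symm, r1], fun f v => by
          rw [diagForm_add_smul, diagForm_single]⟩
    have h1 := key t z (by rw [hz, diagForm_comm _ l r, dr0, z0, z1]; ring)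
    simp only [hz, diagForm_comm _ l r, dr1, dr2, dt0, dt1, dt2,
      ht i hi0 hi1, z0, z1, t0, t1] at h1
    have h2 : (l 1 - 2 * μ * l 0) * (2 * μ * l 1 * transverse i y * (m + 5 - (m - 1) * exponent i))
        * l i = 0 := by linear_combination -h1
    refine (mul_eq_zero.1 h2).resolve_left (mul_ne_zero (sub_ne_zero.2 hlt)
      (mul_ne_zero (mul_ne_zero (mul_ne_zero (mul_ne_zero two_ne_zero hμ) hlr)
        (hE i hi0 hi1).ne') ?_))
    rcases exponent_eq hi0 hi1 with h | h <;> rw [h]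
    · have : (0 : ℝ) < m + 5 - (m - 1) * (-2) := by linarith
      exact this.ne'
    · norm_num
  have d0 := diagForm_eq_zero (f := fun a => transverse a y) (transverse_zero y) (transverse_one y) h3
  have d1 := diagForm_eq_zero (f := fun a => exponent a * transverse a y)
    (by simp [p0]) (by simp [p1]) h3
  have d2 := diagForm_eq_zero (f := fun a => exponent a ^ 2 * transverse a y)
    (by simp [p0]) (by simp [p1]) h3
  have s0 : (EuclideanSpace.single 2 1 : EuclideanSpace ℝ (Fin (m + 4))) 0 = 0 := by
    simp [h20.symm]
  have s1 : (EuclideanSpace.single 2 1 : EuclideanSpace ℝ (Fin (m + 4))) 1 = 0 := by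
    simp [h21.symm]
  have s2 : (EuclideanSpace.single 2 1 : EuclideanSpace ℝ (Fin (m + 4))) 2 = 1 := by simp
  -- Now `l` lies in the plane of the null coordinates, and `w = z = e_2` leaves a multiple of
  -- `(n-2) p_2² - ∑ p_i² = 3(m+1)`. For exponents `-1, 1, …, 1` this number would be `0`, hence the
  -- choice `p_2 = -2`.
  have h1 := key (EuclideanSpace.single 2 1) (EuclideanSpace.single 2 1) (by
    rw [d0, s0, s1]; ring)
  simp only [diagForm_comm _ _ l, d0, d1, d2, s0, s1] at h1
  simp only [diagForm_single, s2, exponent_two] at h1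
  have h4 : (3 * (m + 1)) * transverse 2 y * (l 1 * l 1) = 0 := by linear_combination -h1
  have h5 := hE 2 h20 h21
  have h6 : (3 * (m + 1)) * transverse 2 y * (l 1 * l 1) ≠ 0 := by positivity
  exact h6 h4

end TypeI

/-! ### Metrics on `ℝⁿ` given by their components. -/

section ModelSpace

variable {n : ℕ}

theorem tangentCoordChange_model (c c' q : EuclideanSpace ℝ (Fin n)) :
    tangentCoordChange (𝓡 n) c c' q = ContinuousLinearMap.id ℝ _ := by
  exact tangentBundleCore_coordChange_model_space c c' q

theorem coordBasis_model (c q : EuclideanSpace ℝ (Fin n)) (i : Fin n) :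
    coordBasis c q i = (EuclideanSpace.single i (1 : ℝ) : EuclideanSpace ℝ (Fin n)) := by
  rw [coordBasis, tangentCoordChange_model]; rfl

theorem coordMetric_model (g : BilinField n (EuclideanSpace ℝ (Fin n)))
    (c y : EuclideanSpace ℝ (Fin n)) (i j : Fin n) :
    coordMetric g c y i j = g y (EuclideanSpace.single i (1 : ℝ) : EuclideanSpace ℝ (Fin n))
      (EuclideanSpace.single j (1 : ℝ) : EuclideanSpace ℝ (Fin n)) := by
  rw [coordMetric, coordBasis_model, coordBasis_model]
  rfl

theorem coordVector_model (X : (p : EuclideanSpace ℝ (Fin n)) → TangentSpace (𝓡 n) p)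
    (c y : EuclideanSpace ℝ (Fin n)) : coordVector X c y = X y := by
  rw [coordVector, tangentCoordChange_model]
  simp
  rfl

/-- The field of bilinear forms with components `G`. -/
noncomputable def ofComponents (G : EuclideanSpace ℝ (Fin n) → Matrix (Fin n) (Fin n) ℝ) :
    BilinField n (EuclideanSpace ℝ (Fin n)) :=
  fun y => (∑ a, ∑ b, G y a b • (EuclideanSpace.proj (𝕜 := ℝ) a :
      EuclideanSpace ℝ (Fin n) →L[ℝ] ℝ).smulRight (EuclideanSpace.proj (𝕜 := ℝ) b :
      EuclideanSpace ℝ (Fin n) →L[ℝ] ℝ) :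
    EuclideanSpace ℝ (Fin n) →L[ℝ] EuclideanSpace ℝ (Fin n) →L[ℝ] ℝ)

theorem ofComponents_apply (G : EuclideanSpace ℝ (Fin n) → Matrix (Fin n) (Fin n) ℝ)
    (y v w : EuclideanSpace ℝ (Fin n)) :
    ofComponents G y v w = eval₂ (fun a b => G y a b) v w := by
  have : ofComponents G y v w = (∑ a, ∑ b, G y a b • (EuclideanSpace.proj (𝕜 := ℝ) a :
      EuclideanSpace ℝ (Fin n) →L[ℝ] ℝ).smulRight (EuclideanSpace.proj (𝕜 := ℝ) b :
      EuclideanSpace ℝ (Fin n) →L[ℝ] ℝ) :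
    EuclideanSpace ℝ (Fin n) →L[ℝ] EuclideanSpace ℝ (Fin n) →L[ℝ] ℝ) v w := rfl
  rw [this]
  simp [eval₂, mul_assoc]

theorem coordMetric_ofComponents (G : EuclideanSpace ℝ (Fin n) → Matrix (Fin n) (Fin n) ℝ)
    (c : EuclideanSpace ℝ (Fin n)) : coordMetric (ofComponents G) c = G := by
  funext y i j
  rw [coordMetric_model]
  refine (ofComponents_apply ..).trans ?_
  simp [eval₂]

end ModelSpace

/-! ### The example as a generalized Kerr-Schild family. -/

section TypeI

variable {m : ℕ}

/-- An orthonormal frame of `exampleMetric 0`. -/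
noncomputable def orthonormalFrame (y : EuclideanSpace ℝ (Fin (m + 4))) (i : Fin (m + 4)) :
    EuclideanSpace ℝ (Fin (m + 4)) :=
  if i = 0 then EuclideanSpace.single 0 (1 : ℝ) + EuclideanSpace.single 1 (-1 / 2 : ℝ)
  else if i = 1 then EuclideanSpace.single 0 (1 : ℝ) + EuclideanSpace.single 1 (1 / 2 : ℝ)
  else EuclideanSpace.single i (Real.exp (-(exponent i * y 1)))

theorem eval₂_orthonormalFrame (y : EuclideanSpace ℝ (Fin (m + 4))) (i j : Fin (m + 4)) :
    eval₂ (fun a b => exampleMetric 0 y a b) (orthonormalFrame y i) (orthonormalFrame y j) =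
      if i = j then (if i.val = 0 then -1 else 1) else 0 := by
  have hz : ∀ {v : EuclideanSpace ℝ (Fin (m + 4))}, (∀ i, i ≠ 0 → i ≠ 1 → v i = 0) → ∀ w,
      diagForm (fun a => transverse a y) v w = 0 := fun hv =>
    diagForm_eq_zero (transverse_zero y) (transverse_one y) hv
  have hz' : ∀ {v : EuclideanSpace ℝ (Fin (m + 4))}, (∀ i, i ≠ 0 → i ≠ 1 → v i = 0) → ∀ w,
      diagForm (fun a => transverse a y) w v = 0 := fun hv w => by rw [diagForm_comm, hz hv]
  have a0 : orthonormalFrame y 0 0 = 1 := by simp [orthonormalFrame]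
  have a1 : orthonormalFrame y 0 1 = -1 / 2 := by simp [orthonormalFrame]
  have ai : ∀ i, i ≠ 0 → i ≠ 1 → orthonormalFrame y 0 i = 0 := fun i h0 h1 => by
    simp [orthonormalFrame, h0, h1]
  have b0 : orthonormalFrame y 1 0 = 1 := by simp [orthonormalFrame]
  have b1 : orthonormalFrame y 1 1 = 1 / 2 := by simp [orthonormalFrame]
  have bi : ∀ i, i ≠ 0 → i ≠ 1 → orthonormalFrame y 1 i = 0 := fun i h0 h1 => by
    simp [orthonormalFrame, h0, h1]
  have c0 : ∀ i, i ≠ 0 → i ≠ 1 → orthonormalFrame y i 0 = 0 := fun i h0 h1 => by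
    simp [orthonormalFrame, h0, h1, h0.symm]
  have c1 : ∀ i, i ≠ 0 → i ≠ 1 → orthonormalFrame y i 1 = 0 := fun i h0 h1 => by
    simp [orthonormalFrame, h0, h1, h1.symm]
  rw [eval₂_exampleMetric]
  by_cases i0 : i = 0
  · subst i0
    rw [hz ai, a0, a1]
    by_cases j0 : j = 0
    · subst j0; rw [a0, a1]; norm_num
    by_cases j1 : j = 1
    · subst j1; rw [b0, b1]; norm_num
    rw [c0 j j0 j1, c1 j j0 j1, if_neg (Ne.symm j0)]; ring
  by_cases i1 : i = 1
  · subst i1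
    rw [hz bi, b0, b1]
    by_cases j0 : j = 0
    · subst j0; rw [a0, a1]; norm_num
    by_cases j1 : j = 1
    · subst j1; rw [b0, b1]; norm_num
    rw [c0 j j0 j1, c1 j j0 j1, if_neg (Ne.symm j1)]; ring
  rw [c0 i i0 i1, c1 i i0 i1]
  by_cases j0 : j = 0
  · subst j0; rw [hz' ai, if_neg i0]; ring
  by_cases j1 : j = 1
  · subst j1; rw [hz' bi, if_neg i1]; ring
  have hi : i.val ≠ 0 := fun h => i0 (Fin.ext h)
  rw [if_neg hi]
  simp only [orthonormalFrame, i0, i1, j0, j1, if_false]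
  split_ifs with hij
  · subst hij
    simp only [diagForm, transverse]
    rw [Finset.sum_eq_single i (fun k _ hk => by simp [hk]) (by simp)]
    simp only [i0, i1, or_self, if_false, PiLp.single_apply, if_true, ← Real.exp_add]
    ring_nf
    simp
  · rw [diagForm, Finset.sum_eq_zero]
    · ring
    · intro k _
      by_cases hk : k = i
      · subst hk; simp [hij]
      · simp [hk]

theorem eval₂_exampleMetric_comm (μ : ℝ) (y v w : EuclideanSpace ℝ (Fin (m + 4))) :
    eval₂ (fun a b => exampleMetric μ y a b) v w =
      eval₂ (fun a b => exampleMetric μ y a b) w v := by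
  rw [eval₂_exampleMetric, eval₂_exampleMetric, diagForm_comm]; ring

theorem linearIndependent_orthonormalFrame (p : EuclideanSpace ℝ (Fin (m + 4))) :
    LinearIndependent ℝ (orthonormalFrame p) := by
  obtain ⟨B, hB⟩ : ∃ B : EuclideanSpace ℝ (Fin (m + 4)) →L[ℝ]
      EuclideanSpace ℝ (Fin (m + 4)) →L[ℝ] ℝ, ∀ i j,
      B (orthonormalFrame p i) (orthonormalFrame p j) =
        if i = j then (if i.val = 0 then -1 else 1) else 0 :=
    ⟨ofComponents (exampleMetric 0) p, fun i j =>
      (ofComponents_apply ..).trans (eval₂_orthonormalFrame p i j)⟩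
  -- The sign compensates `-1` for the timelike leg, so that the functionals are dual to the frame.
  refine linearIndependent_of_dual (φ := fun j => (if j.val = 0 then -1 else 1 : ℝ) •
    (B (orthonormalFrame p j)).toLinearMap) fun i j => ?_
  rw [LinearMap.smul_apply, ContinuousLinearMap.coe_coe, hB]
  by_cases hij : j = i
  · subst hij; split_ifs <;> simp
  · simp [hij, Ne.symm hij]

theorem isLorentzAt_example (p : EuclideanSpace ℝ (Fin (m + 4))) :
    IsLorentzAt (ofComponents (exampleMetric 0)) p := by
  refine ⟨fun v w => ?_, ?_⟩
  · exact (ofComponents_apply _ p v w).trans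
      ((eval₂_exampleMetric_comm 0 p v w).trans (ofComponents_apply _ p w v).symm)
  · let b : Module.Basis (Fin (m + 4)) ℝ (EuclideanSpace ℝ (Fin (m + 4))) :=
      basisOfLinearIndependentOfCardEqFinrank (linearIndependent_orthonormalFrame p) (by simp)
    have hb : ∀ i, b i = orthonormalFrame p i := fun i => by
      simp only [b, coe_basisOfLinearIndependentOfCardEqFinrank]
    refine ⟨b, fun i j => (ofComponents_apply _ p (b i) (b j)).trans ?_⟩
    rw [hb, hb]
    exact eval₂_orthonormalFrame p i j

/-- The family `2 du dv - 2 μ du² + ∑ e^{2 p_i v} dx_i²` with `k = ∂_v`. -/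
noncomputable def exampleFamily (m : ℕ) :
    GKSFamily (m + 4) (EuclideanSpace ℝ (Fin (m + 4))) ℝ where
  gbar := ofComponents (exampleMetric 0)
  gbar_lorentz := isLorentzAt_example
  gbar_smooth c i j := by
    rw [coordMetric_ofComponents]
    exact (contDiff_exampleMetric 0 i j).contDiffOn
  k _ := (EuclideanSpace.single 1 (1 : ℝ) : EuclideanSpace ℝ (Fin (m + 4)))
  k_smooth c := by
    refine (contDiff_const (c := EuclideanSpace.single 1 (1 : ℝ))).contDiffOn.congr fun y _ => ?_
    exact coordVector_model _ c y
  k_ne_zero p h := one_ne_zero ((PiLp.single_eq_zero_iff 2 (1 : Fin (m + 4))).1 h)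
  k_null p := by
    refine (ofComponents_apply ..).trans ?_
    rw [eval₂_exampleMetric, diagForm_single, transverse_one]
    simp
  H μ _ := μ
  H_smooth _ := contMDiff_const
  H_zero _ := rfl
  zero_not_isolated := inferInstance
  H_continuous_at_zero p j _ := by
    have h : ∀ μ : ℝ, ((fun _ : EuclideanSpace ℝ (Fin (m + 4)) => μ) ∘
      (extChartAt (𝓡 (m + 4)) p).symm) = fun _ => μ := fun _ => rfl
    simp only [h]
    rw [tendsto_zero_iff_norm_tendsto_zero]
    rcases eq_or_ne j 0 with rfl | hj
    · simp only [norm_iteratedFDeriv_zero]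
      simpa using (continuous_norm (E := ℝ)).tendsto 0
    · simp [iteratedFDeriv_const_of_ne hj]

theorem exampleFamily_metric (μ : ℝ) :
    (exampleFamily m).metric μ = ofComponents (exampleMetric μ) := by
  have hk : ∀ p v : EuclideanSpace ℝ (Fin (m + 4)), ofComponents (exampleMetric 0) p
      (EuclideanSpace.single 1 (1 : ℝ) : EuclideanSpace ℝ (Fin (m + 4))) v = v 0 := fun p v => by
    rw [ofComponents_apply, eval₂_exampleMetric, diagForm_comm, diagForm_single, transverse_one]
    simp
  funext p
  refine ContinuousLinearMap.ext fun v => ContinuousLinearMap.ext fun w => ?_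
  rw [GKSFamily.metric_apply]
  refine Eq.trans ?_ (ofComponents_apply _ p v w).symm
  refine (congrArg₂ (· - ·) (ofComponents_apply (exampleMetric 0) p v w)
    (congrArg₂ (fun r s => 2 * μ * (r * s)) (hk p v) (hk p w))).trans ?_
  change eval₂ (fun a b => exampleMetric 0 p a b) v w - 2 * μ * (coords v 0 * coords w 0) =
    eval₂ (fun a b => exampleMetric μ p a b) (coords v) (coords w)
  rw [eval₂_exampleMetric μ]
  refine (congrArg (· - _) (eval₂_exampleMetric 0 p (coords v) (coords w))).trans ?_
  ring

/-- All `Γ^a_{11}` vanish, so `∂_v` is geodesic with factor `0`. -/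
theorem isGeodesic_exampleFamily :
    IsGeodesic (exampleFamily m).gbar (exampleFamily m).k := by
  intro c y _
  have hG : coordMetric (exampleFamily m).gbar c = exampleMetric 0 :=
    coordMetric_ofComponents _ c
  have hk : coordVector (exampleFamily m).k c = fun _ => EuclideanSpace.single 1 (1 : ℝ) :=
    funext fun y => coordVector_model _ c y
  refine ⟨0, fun a => ?_⟩
  have h0 : exponent (1 : Fin (m + 4)) = 0 := by simp [exponent]
  have h1 : christoffel (exampleMetric (m := m) 0) a 1 1 y = 0 := by
    rw [christoffel_exampleMetric, h0]
    by_cases ha : 1 = a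
    · rw [← ha, h0]; ring
    · simp [kronecker, ha]
  rw [hG, hk]
  simp [pderiv_const, h1]

theorem not_weylTypeIIOrMoreSpecial_exampleFamily {μ : ℝ} (hμ : μ ≠ 0)
    (p : EuclideanSpace ℝ (Fin (m + 4))) :
    ¬ WeylTypeIIOrMoreSpecial ((exampleFamily m).metric μ) p := by
  rintro ⟨l, hl⟩
  rw [isMWAND_iff, alignedToOrder_iff (by omega), exampleFamily_metric] at hl
  obtain ⟨⟨f, hf, hfl⟩, h⟩ := hl
  have hf0 : f 0 = l := hfl 0 rfl
  have hll : ofComponents (exampleMetric μ) p l l = 0 := by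
    rw [← hf0, hf, if_neg]; simp
  have hl0 : l = 0 := by
    refine eq_zero_of_weyl_exampleMetric (y := p) hμ ((ofComponents_apply _ p l l).symm.trans hll)
      fun w z hz => ?_
    -- The weights of `l, w, l, z` with `z ⊥ l` and `w` arbitrary; their sum `1` exceeds `2 - 2`.
    have := h 1 (-1) 1 0 (by simp) (by simp) (by simp) (by simp) (by norm_num) l
      (by rw [boostFiltration_one]; exact Submodule.mem_span_singleton_self l) w
      (by rw [boostFiltration_neg_one]; trivial) l
      (by rw [boostFiltration_one]; exact Submodule.mem_span_singleton_self l) z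
      (mem_boostFiltration_zero.2 ((ofComponents_apply _ p l z).trans hz))
    have hw := weylAt_eq_eval₄ (g := ofComponents (exampleMetric μ)) (p := p) l w l z
    rw [coordMetric_ofComponents] at hw
    exact hw.symm.trans this
  -- `l = 0` contradicts `m 0 · m 1 = 1`.
  have h1 := hf 0 1
  rw [hf0, hl0, if_pos (by simp)] at h1
  simp at h1

end TypeI

end GKS

theorem mainTheorem5 (n : ℕ) (hn : 4 ≤ n) :
    (∀ (M : Type*) [TopologicalSpace M] [ChartedSpace (EuclideanSpace ℝ (Fin n)) M]
        [IsManifold (𝓡 n) ∞ M] (P : Type*) [TopologicalSpace P] [Zero P]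
        (S : GKS.GKSFamily n M P), GKS.IsGeodesic S.gbar S.k → ∀ p : M,
      -- `k` is a single (multiple) WAND of the background iff it is one of the full geometry
      (∀ μ : P, GKS.IsSingleWAND S.gbar p (S.k p) ↔ GKS.IsSingleWAND (S.metric μ) p (S.k p)) ∧
      (∀ μ : P, GKS.IsMWAND S.gbar p (S.k p) ↔ GKS.IsMWAND (S.metric μ) p (S.k p)) ∧
      -- a WAND `l ≠ k` of the full geometry gives the WAND `lbar = l - H k` of the background
      (∀ (l : P → TangentSpace (𝓡 n) p) (lbar : TangentSpace (𝓡 n) p),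
        (∀ μ, μ ≠ 0 → S.metric μ p (l μ) (S.k p) = 1 ∧ GKS.IsWAND (S.metric μ) p (l μ) ∧
          lbar = l μ - S.H μ p • S.k p) →
        GKS.IsWAND S.gbar p lbar) ∧
      -- multiplicity of `k`
      (∀ τ : ℕ, (∀ μ, μ ≠ 0 → τ ≤ GKS.wandMultiplicity (S.metric μ) p (S.k p)) →
        τ ≤ GKS.wandMultiplicity S.gbar p (S.k p)) ∧
      -- multiplicity of `lbar`
      (∀ (l : P → TangentSpace (𝓡 n) p) (lbar : TangentSpace (𝓡 n) p) (χ : ℕ),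
        (∀ μ, μ ≠ 0 → S.metric μ p (l μ) (S.k p) = 1 ∧
          χ ≤ GKS.wandMultiplicity (S.metric μ) p (l μ) ∧
          lbar = l μ - S.H μ p • S.k p) →
        χ ≤ GKS.wandMultiplicity S.gbar p lbar) ∧
      -- the same for WANDs `l` for which `l - H k` depends on `μ` and converges as `μ → 0`
      (∀ (l : P → TangentSpace (𝓡 n) p) (lbar : TangentSpace (𝓡 n) p) (χ : ℕ),
        (∀ μ, μ ≠ 0 → S.metric μ p (l μ) (S.k p) = 1 ∧
          χ ≤ GKS.wandMultiplicity (S.metric μ) p (l μ)) →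
        Tendsto (fun μ => l μ - S.H μ p • S.k p) (𝓝[≠] 0) (𝓝 lbar) →
        χ ≤ GKS.wandMultiplicity S.gbar p lbar) ∧
      -- the Kerr-Schild case: type II or more special, with `k` a multiple WAND
      (GKS.WeylVanishesAt S.gbar p → ∀ μ : P, GKS.IsMWAND (S.metric μ) p (S.k p))) ∧
    -- generalized Kerr-Schild spacetimes less special than type II
    (∃ S : GKS.GKSFamily n (EuclideanSpace ℝ (Fin n)) ℝ, GKS.IsGeodesic S.gbar S.k ∧
      ∀ μ : ℝ, μ ≠ 0 → ∀ p, S.H μ p ≠ 0 ∧ ¬ GKS.WeylTypeIIOrMoreSpecial (S.metric μ) p) := by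
  have hn2 : 2 ≤ n := by omega
  refine ⟨fun M _ _ _ P _ _ S hgeo p => ⟨fun μ => ?_, fun μ => ?_, fun l lbar h => ?_,
    fun τ h => S.le_wandMultiplicity_k hn2 p τ h,
    fun l lbar χ h => S.le_wandMultiplicity_of_eq hn2 p l lbar χ h,
    fun l lbar χ h hl => S.le_wandMultiplicity_of_tendsto hn2 p l lbar χ h hl,
    fun h μ => S.isMWAND_of_weylVanishes hn2 hgeo p h μ⟩, ?_⟩
  · rw [GKS.isSingleWAND_iff, GKS.isSingleWAND_iff,
      S.alignedToOrder_k_iff hn2 hgeo μ p one_le_two, S.alignedToOrder_k_iff hn2 hgeo μ p le_rfl]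
  · rw [GKS.isMWAND_iff, GKS.isMWAND_iff, S.alignedToOrder_k_iff hn2 hgeo μ p le_rfl]
  · exact S.le_wandMultiplicity_of_eq hn2 p l lbar 1 h
  · obtain ⟨m, rfl⟩ : ∃ m, n = m + 4 := ⟨n - 4, by omega⟩
    exact ⟨GKS.exampleFamily m, GKS.isGeodesic_exampleFamily, fun μ hμ p =>
      ⟨hμ, GKS.not_weylTypeIIOrMoreSpecial_exampleFamily hμ p⟩⟩
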